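/- Identify $\mathbb{T}^2$ with $[-1,1]^2$ (opposite sides glued), let $P_t=e^{t\Delta}$ be its heat semigroup, and let $\mathcal{S}'(\mathbb{T}^2)$ be the space of real distributions on $\mathbb{T}^2$, with $(z,\phi)$ the pairing of $z\in\mathcal{S}'(\mathbb{T}^2)$ with $\phi\in C^\infty(\mathbb{T}^2)$. Let $(\Omega,\mathcal{F},(\mathcal{F}_t)_{t\ge0},\mathbb{P})$ be a filtered probability space and let $\overline{Z}=(\overline{Z}(t))_{t\ge 0}$ be an adapted random process with paths in $C(\mathbb{R}_+,\mathcal{S}'(\mathbb{T}^2))$. For $\phi\in C^\infty(\mathbb{T}^2)$ put $$\mathcal{M}_\phi(t)=(\overline{Z}(t),\phi)-(\overline{Z}(0),\phi)-\int_0^t(\overline{Z}(s),\Delta\phi)\,ds,\qquad \Gamma_\phi(t)=\mathcal{M}_\phi(t)^2-2t\|\phi\|_{L^2}^2 .$$ Suppose that for every $\phi\in C^\infty(\mathbb{T}^2)$ the processes $\mathcal{M}_\phi$ and $\Gamma_\phi$ are local martingales with respect to $(\mathcal{F}_t)$. Then $\overline{Z}$ has the same law on $C(\mathbb{R}_+,\mathcal{S}'(\mathbb{T}^2))$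 as the solution $Z$ of the stochastic heat equation $$dZ=\Delta Z\,dt+\sqrt{2}\,dW,\qquad Z(0)=z_0,$$ with initial condition $z_0=\overline{Z}(0)$. That is: there exist, on some probability space, a cylindrical Wiener process $W$ over $L^2(\mathbb{T}^2)$, a random variable $z_0$ in $\mathcal{S}'(\mathbb{T}^2)$ independent of $W$ with the law of $\overline{Z}(0)$, and a random process $Z$ with paths in $C(\mathbb{R}_+,\mathcal{S}'(\mathbb{T}^2))$ such that for all $t\ge0$ and $\phi\in C^\infty(\mathbb{T}^2)$, almost surely, $$(Z(t),\phi)=(z_0,P_t\phi)+\sqrt{2}\int_0^tP_{t-s}\phi\,dW(s);$$ and for every such $(W,z_0,Z)$, on any probability space, $Z$ and $\overline{Z}$ have the same law. -/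

import Mathlib

open MeasureTheory ProbabilityTheory Filter Topology
open scoped NNReal ENNReal

universe u v

noncomputable section

namespace SHE

section Torus

open scoped ContDiff

/-! ### Smooth functions on the two-dimensional torus

The torus is `[-1,1]²` with opposite sides glued, that is `ℝ² / (2ℤ)²`. Functions on it are functions
on the plane that are `2`-periodic in each variable. -/

/-- The plane. -/
abbrev Plane : Type := EuclideanSpace ℝ (Fin 2)

/-- The point `2k` of the lattice `(2ℤ)²`. -/
def lattice (k : Fin 2 → ℤ) : Plane := WithLp.toLp 2 (fun i => 2 * (k i : ℝ))

/-- Invariance under translation by `(2ℤ)²`. -/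
def IsPeriodic {F : Type*} (f : Plane → F) : Prop := ∀ (k : Fin 2 → ℤ) (x : Plane), f (x + lattice k) = f x

/-- The fundamental domain `[-1,1]²`. -/
def cube : Set Plane := {x | ∀ i, x i ∈ Set.Icc (-1 : ℝ) 1}

/-- Lebesgue measure on the torus. -/
abbrev torusVol : Measure Plane := volume.restrict cube

/-- The real vector space of smooth real-valued functions on the torus, as a subspace. -/
def smoothPeriodic : Submodule ℝ (Plane → ℝ) where
  carrier := {f | ContDiff ℝ ∞ f ∧ IsPeriodic f}
  add_mem' {f g} hf hg := ⟨hf.1.add hg.1, fun k x => by simp [hf.2 k x, hg.2 k x]⟩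
  zero_mem' := ⟨contDiff_const, fun _ _ => rfl⟩
  smul_mem' c f hf := ⟨hf.1.const_smul c, fun k x => by simp [hf.2 k x]⟩

/-- The space `C^∞(𝕋²)` of test functions. -/
def TestFn : Type := smoothPeriodic

namespace TestFn

instance : AddCommGroup TestFn := inferInstanceAs (AddCommGroup smoothPeriodic)
instance : Module ℝ TestFn := inferInstanceAs (Module ℝ smoothPeriodic)

/-- The underlying periodic function. -/
def toFun (φ : TestFn) : Plane → ℝ := Subtype.val φ

instance : CoeFun TestFn (fun _ => Plane → ℝ) := ⟨toFun⟩

lemma smooth (φ : TestFn) : ContDiff ℝ ∞ φ := φ.2.1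

lemma periodic (φ : TestFn) : IsPeriodic φ := φ.2.2

lemma toFun_add (φ ψ : TestFn) : (φ + ψ).toFun = φ.toFun + ψ.toFun := rfl

lemma toFun_smul (c : ℝ) (φ : TestFn) : (c • φ).toFun = c • φ.toFun := rfl

end TestFn

lemma isCompact_cube : IsCompact cube := by
  have h : cube = (EuclideanSpace.equiv (Fin 2) ℝ).symm ''
      (Set.univ.pi fun _ => Set.Icc (-1 : ℝ) 1) := by
    ext x
    constructor
    · intro hx
      exact ⟨EuclideanSpace.equiv (Fin 2) ℝ x, fun i _ => hx i, by simp⟩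
    · rintro ⟨y, hy, rfl⟩ i
      exact hy i (Set.mem_univ i)
  rw [h]
  exact (isCompact_univ_pi fun _ => isCompact_Icc).image
    (EuclideanSpace.equiv (Fin 2) ℝ).symm.continuous

lemma exists_lattice_mem_cube (x : Plane) : ∃ k, x + lattice k ∈ cube := by
  refine ⟨fun i => - round (x i / 2), fun i => ?_⟩
  have h := abs_le.1 (abs_sub_round (x i / 2))
  simp only [lattice, PiLp.add_apply, Int.cast_neg, Set.mem_Icc]
  constructor <;> linarith [h.1, h.2]

lemma IsPeriodic.exists_bound {F : Type*} [NormedAddCommGroup F] {f : Plane → F}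
    (hp : IsPeriodic f) (hc : Continuous f) : ∃ C, ∀ x, ‖f x‖ ≤ C := by
  obtain ⟨C, hC⟩ := isCompact_cube.exists_bound_of_continuousOn hc.continuousOn
  refine ⟨C, fun x => ?_⟩
  obtain ⟨k, hk⟩ := exists_lattice_mem_cube x
  rw [← hp k x]
  exact hC _ hk

lemma IsPeriodic.iteratedFDeriv {F : Type*} [NormedAddCommGroup F] [NormedSpace ℝ F]
    {f : Plane → F} (hp : IsPeriodic f) (n : ℕ) : IsPeriodic (iteratedFDeriv ℝ n f) := by
  intro k x
  rw [← iteratedFDeriv_comp_add_right]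
  congr 1
  exact funext (hp k)

lemma IsPeriodic.fderiv {F : Type*} [NormedAddCommGroup F] [NormedSpace ℝ F]
    {f : Plane → F} (hp : IsPeriodic f) : IsPeriodic (fderiv ℝ f) := by
  intro k x
  rw [← fderiv_comp_add_right]
  congr 1
  exact funext (hp k)

lemma TestFn.bddAbove (φ : TestFn) (n : ℕ) :
    BddAbove (Set.range fun x => ‖iteratedFDeriv ℝ n φ x‖) := by
  obtain ⟨C, hC⟩ := (φ.periodic.iteratedFDeriv n).exists_bound
    (φ.smooth.continuous_iteratedFDeriv (by exact_mod_cast le_top))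
  exact ⟨C, by rintro _ ⟨x, rfl⟩; exact hC x⟩

/-- The seminorms `sup_x ‖Dⁿ φ(x)‖` on `C^∞(𝕋²)`. -/
def TestFn.seminormFamily : SeminormFamily ℝ TestFn ℕ := fun n =>
  Seminorm.of (fun φ => ⨆ x, ‖iteratedFDeriv ℝ n φ x‖)
    (fun φ ψ => by
      refine ciSup_le fun x => ?_
      rw [TestFn.toFun_add, iteratedFDeriv_add_apply (φ.smooth.contDiffAt.of_le (by exact_mod_cast le_top))
        (ψ.smooth.contDiffAt.of_le (by exact_mod_cast le_top))]
      exact (norm_add_le _ _).trans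
        (add_le_add (le_ciSup (φ.bddAbove n) x) (le_ciSup (ψ.bddAbove n) x)))
    (fun c φ => by
      rw [Real.norm_eq_abs, Real.mul_iSup_of_nonneg (abs_nonneg c)]
      congr 1
      funext x
      rw [TestFn.toFun_smul, iteratedFDeriv_const_smul_apply
        (φ.smooth.contDiffAt.of_le (by exact_mod_cast le_top)), norm_smul, Real.norm_eq_abs])

/-- The usual Fréchet topology of `C^∞(𝕋²)`: uniform convergence of all derivatives. -/
instance : TopologicalSpace TestFn := TestFn.seminormFamily.moduleFilterBasis.topology'

/-- The space `S'(𝕋²)` of distributions on the torus, with the topology of convergence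
against every test function. -/
abbrev Distr : Type := WeakDual ℝ TestFn

/-- The σ-algebra on `S'(𝕋²)` generated by the evaluations `z ↦ (z, φ)`. -/
instance : MeasurableSpace Distr := ⨆ φ : TestFn, MeasurableSpace.comap (fun z => z φ) inferInstance

/-- The path space `C(ℝ₊, S'(𝕋²))`. -/
abbrev Path : Type := C(ℝ≥0, Distr)

/-- The σ-algebra on the path space generated by the evaluations `z ↦ z(t)`, that is by all
`z ↦ (z(t), φ)`. -/
instance : MeasurableSpace Path := ⨆ t : ℝ≥0, MeasurableSpace.comap (fun z => z t) inferInstance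

/-! ### `L²(𝕋²)`, the Laplacian and the heat semigroup -/

/-- `L²(𝕋²)`. -/
abbrev L2 : Type := Lp ℝ 2 torusVol

lemma TestFn.memLp (φ : TestFn) : MemLp φ 2 torusVol := by
  have : IsFiniteMeasure torusVol := ⟨by simpa using isCompact_cube.measure_lt_top⟩
  obtain ⟨C, hC⟩ := φ.periodic.exists_bound φ.smooth.continuous
  exact MemLp.of_bound φ.smooth.continuous.aestronglyMeasurable C (ae_of_all _ hC)

/-- The class of a test function in `L²(𝕋²)`. -/
def TestFn.toL2 (φ : TestFn) : L2 := φ.memLp.toLp φ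

/-- The Laplacian on test functions. -/
def TestFn.laplacian (φ : TestFn) : TestFn :=
  ⟨Laplacian.laplacian φ.toFun, by
    have h := InnerProductSpace.laplacian_eq_iteratedFDeriv_orthonormalBasis φ.toFun
      (EuclideanSpace.basisFun (Fin 2) ℝ)
    constructor
    · rw [h]
      refine ContDiff.sum fun i _ => ?_
      have h2 : ContDiff ℝ ∞ (iteratedFDeriv ℝ 2 φ.toFun) :=
        φ.smooth.iteratedFDeriv_right (m := ∞) (i := 2) le_rfl
      exact (ContinuousMultilinearMap.apply ℝ (fun _ : Fin 2 => Plane) ℝ _).contDiff.comp h2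
    · intro k x
      simp only [h, φ.periodic.iteratedFDeriv 2 k x]⟩

lemma contDiff_average {F : Type} [NormedAddCommGroup F] [NormedSpace ℝ F] [CompleteSpace F]
    (μ : Measure Plane) [IsProbabilityMeasure μ] (c : ℝ) (n : ℕ) (f : Plane → F)
    (hf : ContDiff ℝ ∞ f) (hp : IsPeriodic f) :
    ContDiff ℝ n (fun x => ∫ y, f (x + c • y) ∂μ) := by
  induction n generalizing F with
  | zero =>
    obtain ⟨C, hC⟩ := hp.exists_bound hf.continuous
    refine contDiff_zero.2 (continuous_of_dominated (bound := fun _ => C) (fun x => ?_)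
      (fun x => ae_of_all _ fun y => hC _) (integrable_const _) (ae_of_all _ fun y => ?_))
    · exact (hf.continuous.comp (by fun_prop)).aestronglyMeasurable
    · exact hf.continuous.comp (by fun_prop)
  | succ n ih =>
    obtain ⟨C₀, hC₀⟩ := hp.exists_bound hf.continuous
    have hf' : ContDiff ℝ ∞ (fderiv ℝ f) := hf.fderiv_right (by exact_mod_cast le_top)
    obtain ⟨C, hC⟩ := hp.fderiv.exists_bound hf'.continuous
    have key : ∀ x, HasFDerivAt (fun x => ∫ y, f (x + c • y) ∂μ)
        (∫ y, fderiv ℝ f (x + c • y) ∂μ) x := by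
      intro x
      refine hasFDerivAt_integral_of_dominated_of_fderiv_le (bound := fun _ => C)
        (F' := fun x y => fderiv ℝ f (x + c • y)) (Filter.univ_mem) ?_ ?_ ?_ ?_ (integrable_const _) ?_
      · exact Eventually.of_forall fun x =>
          (hf.continuous.comp (by fun_prop)).aestronglyMeasurable
      · exact Integrable.of_bound (hf.continuous.comp (by fun_prop)).aestronglyMeasurable C₀
          (ae_of_all _ fun y => hC₀ _)
      · exact (hf'.continuous.comp (by fun_prop)).aestronglyMeasurable
      · exact ae_of_all _ fun y x _ => hC _
      · refine ae_of_all _ fun y x _ => ?_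
        have hd : HasFDerivAt f (fderiv ℝ f (x + c • y)) (x + c • y) :=
          (hf.differentiable (by simp) _).hasFDerivAt
        exact (hasFDerivAt_comp_add_right (c • y)).2 hd
    have : ((n + 1 : ℕ) : WithTop ℕ∞) = (n : WithTop ℕ∞) + 1 := by norm_cast
    rw [this, contDiff_succ_iff_hasFDerivAt]
    exact ⟨_, ih _ hf' hp.fderiv, key⟩

/-- The heat semigroup `P_t = e^{tΔ}`: convolution with the Gaussian measure of covariance `2t`,
`(P_t φ)(x) = 𝔼 φ(x + √(2t) N)` with `N` a standard Gaussian vector in the plane, that is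
`∫ (4πt)⁻¹ exp(-|y|²/(4t)) φ(x + y) dy` for `t > 0` and `φ(x)` for `t = 0`. -/
def TestFn.heat (t : ℝ≥0) (φ : TestFn) : TestFn :=
  ⟨fun x => ∫ y, φ (x + Real.sqrt (2 * t) • y) ∂(stdGaussian Plane),
    contDiff_infty.2 fun n => contDiff_average _ _ n _ φ.smooth φ.periodic, fun k x => by
      simp only [add_right_comm x (lattice k), φ.periodic k _]⟩

end Torus

/-! ### Cylindrical Wiener process and Wiener integral -/

section Wiener

variable {Ω : Type*} [MeasurableSpace Ω]

/-- A cylindrical Wiener process over `L²(𝕋²)`: a centred Gaussian family `W(t, f)` with covariance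
`𝔼 W(s, f) W(t, g) = min s t * ⟨f, g⟩` and, for each `f`, almost surely continuous paths. -/
structure IsCylindricalWiener (W : ℝ≥0 → L2 → Ω → ℝ) (P : Measure Ω) : Prop where
  measurable : ∀ t f, Measurable (W t f)
  gaussian : IsGaussianProcess (fun (p : ℝ≥0 × L2) ω => W p.1 p.2 ω) P
  mean_zero : ∀ t f, ∫ ω, W t f ω ∂P = 0
  covariance : ∀ s t f g, cov[W s f, W t g; P] = min (s : ℝ) t * inner ℝ f g
  continuous_paths : ∀ f, ∀ᵐ ω ∂P, Continuous fun t => W t f ω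

/-- The deterministic step integrand `∑_{i < n} h_i 1_{(τ_i, τ_{i+1}]}`. -/
def stepFn (n : ℕ) (τ : ℕ → ℝ≥0) (h : ℕ → L2) (s : ℝ≥0) : L2 :=
  ∑ i ∈ Finset.range n, (Set.Ioc (τ i) (τ (i + 1))).indicator (fun _ => h i) s

/-- The integral against `W` of a step integrand. -/
def stepIntegral (W : ℝ≥0 → L2 → Ω → ℝ) (n : ℕ) (τ : ℕ → ℝ≥0) (h : ℕ → L2) (ω : Ω) : ℝ :=
  ∑ i ∈ Finset.range n, (W (τ (i + 1)) (h i) ω - W (τ i) (h i) ω)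

/-- `I` is (a version of) the stochastic integral `∫₀ᵗ f(s) dW(s)` of the deterministic integrand
`f ∈ L²([0,t]; L²(𝕋²))`: the limit in `L²(P)` of the integrals of step integrands which converge
to `f` in `L²([0,t]; L²(𝕋²))`. -/
def IsWienerIntegral (W : ℝ≥0 → L2 → Ω → ℝ) (P : Measure Ω) (t : ℝ≥0) (f : ℝ≥0 → L2)
    (I : Ω → ℝ) : Prop :=
  MemLp (fun s : ℝ => f s.toNNReal) 2 (volume.restrict (Set.Icc 0 (t : ℝ))) ∧ MemLp I 2 P ∧
  ∃ (n : ℕ → ℕ) (τ : ℕ → ℕ → ℝ≥0) (h : ℕ → ℕ → L2),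
    (∀ m, Monotone (τ m) ∧ ∀ i, τ m i ≤ t) ∧
    Tendsto (fun m => eLpNorm (fun s : ℝ => stepFn (n m) (τ m) (h m) s.toNNReal - f s.toNNReal) 2
      (volume.restrict (Set.Icc 0 (t : ℝ)))) atTop (𝓝 0) ∧
    Tendsto (fun m => eLpNorm (fun ω => stepIntegral W (n m) (τ m) (h m) ω - I ω) 2 P)
      atTop (𝓝 0)

/-- `Z`, with paths in `C(ℝ₊, S'(𝕋²))`, is the (mild) solution of the stochastic heat equation
`dZ = ΔZ dt + √2 dW`, `Z(0) = z₀`, driven by the cylindrical Wiener process `W`, with an initial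
condition `z₀` independent of `W`: for all `t` and `φ`, almost surely,
`(Z(t), φ) = (z₀, P_t φ) + √2 ∫₀ᵗ P_{t-s} φ dW(s)`. -/
structure IsSHESolution (P : Measure Ω) (W : ℝ≥0 → L2 → Ω → ℝ) (z₀ : Ω → Distr) (Z : Ω → Path) :
    Prop where
  wiener : IsCylindricalWiener W P
  measurable_init : Measurable z₀
  indep : IndepFun z₀ (fun ω (p : ℝ≥0 × L2) => W p.1 p.2 ω) P
  measurable : Measurable Z
  mild : ∀ (t : ℝ≥0) (φ : TestFn), ∃ I : Ω → ℝ,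
    IsWienerIntegral W P t (fun s => (φ.heat (t - s)).toL2) I ∧
    ∀ᵐ ω ∂P, Z ω t φ = z₀ ω (φ.heat t) + Real.sqrt 2 * I ω

end Wiener

/-! ### The martingale problem -/

section MartingaleProblem

variable {Ω : Type*} [mΩ : MeasurableSpace Ω]

/-- Local martingales. -/
def IsLocalMartingale (X : ℝ≥0 → Ω → ℝ) (𝓕 : Filtration ℝ≥0 mΩ) (P : Measure Ω) : Prop :=
  Locally (fun Y => Martingale Y 𝓕 P) 𝓕 X P

/-- `M_φ(t) = (Z(t), φ) - (Z(0), φ) - ∫₀ᵗ (Z(s), Δφ) ds`. -/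
def martM (Z : Ω → Path) (φ : TestFn) (t : ℝ≥0) (ω : Ω) : ℝ :=
  Z ω t φ - Z ω 0 φ - ∫ s in (0 : ℝ)..t, Z ω s.toNNReal φ.laplacian

/-- `Γ_φ(t) = M_φ(t)² - 2t ‖φ‖²_{L²}`. -/
def martG (Z : Ω → Path) (φ : TestFn) (t : ℝ≥0) (ω : Ω) : ℝ :=
  martM Z φ t ω ^ 2 - 2 * t * ∫ x, φ x ^ 2 ∂torusVol

end MartingaleProblem

end SHE

end

noncomputable section

namespace SHE

section OptionalStopping

variable {Ω : Type*} [mΩ : MeasurableSpace Ω] {P : Measure Ω} [IsProbabilityMeasure P]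
  {𝓕 : Filtration ℝ≥0 mΩ} {X : ℝ≥0 → Ω → ℝ}

/-- The minimum of a finite time and a possibly infinite time. -/
def tmin {ι : Type*} [LinearOrder ι] [Nonempty ι] (t : ι) (a : WithTop ι) : ι :=
  (min (t : WithTop ι) a).untopA

section tmin

variable {ι : Type*} [LinearOrder ι] [Nonempty ι]

@[simp] lemma tmin_top (t : ι) : tmin t ⊤ = t := by simp [tmin]

@[simp] lemma tmin_coe (t s : ι) : tmin t (s : WithTop ι) = min t s := by
  rw [tmin, ← WithTop.coe_min]; rfl

lemma tmin_le (t : ι) (a : WithTop ι) : tmin t a ≤ t := by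
  induction a <;> simp

lemma tmin_mono {s t : ι} (h : s ≤ t) (a : WithTop ι) : tmin s a ≤ tmin t a := by
  induction a with
  | top => simpa
  | coe a => rw [tmin_coe, tmin_coe]; exact min_le_min_right a h

lemma tmin_of_le {t : ι} {a : WithTop ι} (h : (t : WithTop ι) ≤ a) : tmin t a = t := by
  induction a with
  | top => simp
  | coe a => simpa using h

lemma tmin_le_iff {t r : ι} {a : WithTop ι} : tmin t a ≤ r ↔ t ≤ r ∨ a ≤ (r : WithTop ι) := by
  induction a <;> simp

lemma coe_tmin_le_iff {t r : ι} {a : WithTop ι} :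
    ((tmin t a : ι) : WithTop ι) ≤ r ↔ t ≤ r ∨ a ≤ (r : WithTop ι) := by
  rw [WithTop.coe_le_coe, tmin_le_iff]

lemma tmin_tmin (t : ι) (a b : WithTop ι) : tmin (tmin t a) b = tmin t (min a b) := by
  induction a with
  | top => simp
  | coe a =>
    induction b with
    | top => simp
    | coe b => rw [← WithTop.coe_min]; simp only [tmin_coe, min_assoc]

end tmin

lemma tmin_sub_le {s t : ℝ≥0} (h : s ≤ t) (a : WithTop ℝ≥0) :
    ((tmin t a : ℝ≥0) : ℝ) - (tmin s a : ℝ≥0) ≤ t - s := by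
  have hst : (s : ℝ) ≤ t := by exact_mod_cast h
  induction a with
  | top => rw [tmin_top, tmin_top]
  | coe a =>
    rw [tmin_coe, tmin_coe, NNReal.coe_min, NNReal.coe_min]
    rcases le_total (t : ℝ) a with h1 | h1 <;> rcases le_total (s : ℝ) a with h2 | h2 <;>
      simp [h1, h2] <;> linarith

lemma isStoppingTime_tmin {τ : Ω → WithTop ℝ≥0} (hτ : IsStoppingTime 𝓕 τ) (t : ℝ≥0) :
    IsStoppingTime 𝓕 (fun ω => ((tmin t (τ ω) : ℝ≥0) : WithTop ℝ≥0)) := by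
  intro r
  simp only [coe_tmin_le_iff]
  by_cases h : t ≤ r
  · simp [h]
  · simpa [h] using hτ r

lemma measurable_tmin {τ : Ω → WithTop ℝ≥0} (hτ : IsStoppingTime 𝓕 τ) (t : ℝ≥0) :
    Measurable[𝓕 t] (fun ω => tmin t (τ ω)) := by
  refine @measurable_of_Iic ℝ≥0 Ω _ _ _ (𝓕 t) _ _ _ _ fun r => ?_
  have : (fun ω => tmin t (τ ω)) ⁻¹' Set.Iic r = {ω | t ≤ r} ∪ {ω | τ ω ≤ r} := by
    ext ω; simp [tmin_le_iff]
  rw [this]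
  by_cases h : t ≤ r
  · simp [h]
  · simpa [h] using 𝓕.mono (not_le.1 h).le _ (hτ r)

/-- Dyadic-type approximation from above of a bounded time. -/
def gridAbove (t : ℝ≥0) (n : ℕ) (r : ℝ≥0) : ℝ≥0 := min t ((⌊(n + 1 : ℝ≥0) * r⌋₊ + 1 : ℝ≥0) / (n + 1))

lemma gridAbove_le (t : ℝ≥0) (n : ℕ) (r : ℝ≥0) : gridAbove t n r ≤ t := min_le_left _ _

lemma tendsto_gridAbove {t r : ℝ≥0} (h : r ≤ t) :
    Tendsto (fun n => gridAbove t n r) atTop (𝓝 r) := by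
  have hlow : ∀ n, r ≤ gridAbove t n r := fun n => by
    refine le_min h ?_
    rw [le_div_iff₀ (by positivity), mul_comm]
    exact (Nat.lt_floor_add_one _).le
  have hup : ∀ n : ℕ, gridAbove t n r ≤ r + 1 / (n + 1) := fun n => by
    refine (min_le_right _ _).trans ?_
    rw [add_div]
    gcongr
    rw [div_le_iff₀ (by positivity), mul_comm]
    exact Nat.floor_le (by positivity)
  refine tendsto_of_tendsto_of_tendsto_of_le_of_le tendsto_const_nhds ?_ hlow hup
  have : Tendsto (fun n : ℕ => (1 : ℝ≥0) / (n + 1)) atTop (𝓝 0) :=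
    tendsto_one_div_add_atTop_nhds_zero_nat
  simpa using tendsto_const_nhds.add this

lemma isStoppingTime_gridAbove {ρ : Ω → ℝ≥0} (hρ : IsStoppingTime 𝓕 (fun ω => (ρ ω : WithTop ℝ≥0)))
    (t : ℝ≥0) (n : ℕ) : IsStoppingTime 𝓕 (fun ω => (gridAbove t n (ρ ω) : WithTop ℝ≥0)) := by
  intro r
  by_cases h : t ≤ r
  · have : {ω | (gridAbove t n (ρ ω) : WithTop ℝ≥0) ≤ r} = Set.univ := by
      ext ω
      rw [Set.mem_ofPred_eq, WithTop.coe_le_coe]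
      exact iff_of_true ((gridAbove_le t n _).trans h) trivial
    rw [this]
    exact MeasurableSet.univ
  · set q : ℝ≥0 := (⌊(n + 1 : ℝ≥0) * r⌋₊ : ℝ≥0) / (n + 1) with hq
    have hqr : q ≤ r := by
      rw [hq, div_le_iff₀ (by positivity), mul_comm]
      exact Nat.floor_le (by positivity)
    have : {ω | (gridAbove t n (ρ ω) : WithTop ℝ≥0) ≤ r} = {ω | (ρ ω : WithTop ℝ≥0) < q} := by
      ext ω
      simp only [gridAbove, WithTop.coe_le_coe, Set.mem_ofPred_eq, min_le_iff, h, false_or,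
        WithTop.coe_lt_coe]
      rw [div_le_iff₀ (by positivity), hq, lt_div_iff₀ (by positivity), mul_comm r, mul_comm (ρ ω),
        ← Nat.floor_lt (by positivity), ← Nat.succ_le_iff, Nat.le_floor_iff (by positivity)]
      simp
    rw [this]
    exact 𝓕.mono hqr _ (hρ.measurableSet_lt q)

lemma countable_range_gridAbove {α : Type*} (ρ : α → ℝ≥0) (t : ℝ≥0) (n : ℕ) :
    (Set.range fun ω : α => (gridAbove t n (ρ ω) : WithTop ℝ≥0)).Countable := by
  refine (Set.countable_range fun k : ℕ =>
    ((min t ((k + 1 : ℝ≥0) / (n + 1)) : ℝ≥0) : WithTop ℝ≥0)).mono ?_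
  rintro _ ⟨ω, rfl⟩
  exact ⟨⌊(n + 1 : ℝ≥0) * ρ ω⌋₊, rfl⟩

/-- Optional sampling for a continuous martingale at a bounded stopping time. -/
lemma integral_stopped_eq (hM : Martingale X 𝓕 P) (hc : ∀ ω, Continuous (X · ω)) {ρ : Ω → ℝ≥0}
    (hρ : IsStoppingTime 𝓕 (fun ω => (ρ ω : WithTop ℝ≥0))) {t : ℝ≥0} (hle : ∀ ω, ρ ω ≤ t) :
    Integrable (fun ω => X (ρ ω) ω) P ∧ ∫ ω, X (ρ ω) ω ∂P = ∫ ω, X t ω ∂P := by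
  have hst := fun n => isStoppingTime_gridAbove hρ t n
  have hle' : ∀ n ω, (gridAbove t n (ρ ω) : WithTop ℝ≥0) ≤ t := fun n ω =>
    WithTop.coe_le_coe.2 (gridAbove_le t n _)
  have hce : ∀ n, (fun ω => X (gridAbove t n (ρ ω)) ω) =ᵐ[P] P[X t | (hst n).measurableSpace] :=
    fun n => hM.stoppedValue_ae_eq_condExp_of_le_const_of_countable_range (hst n) (hle' n)
      (countable_range_gridAbove ρ t n)
  have hint : Integrable (X t) P := hM.integrable t
  have hui : UniformIntegrable (fun n ω => X (gridAbove t n (ρ ω)) ω) 1 P :=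
    (uniformIntegrable_congr_ae (fun n => hce n)).2
      (hint.uniformIntegrable_condExp fun n => (hst n).measurableSpace_le)
  have hlim : ∀ᵐ ω ∂P, Tendsto (fun n => X (gridAbove t n (ρ ω)) ω) atTop (𝓝 (X (ρ ω) ω)) :=
    ae_of_all _ fun ω => ((hc ω).tendsto _).comp (tendsto_gridAbove (hle ω))
  have hmeas : AEStronglyMeasurable (fun ω => X (ρ ω) ω) P :=
    aestronglyMeasurable_of_tendsto_ae atTop (fun n => hui.1 n) hlim
  have hL : MemLp (fun ω => X (ρ ω) ω) 1 P := hui.memLp_of_ae_tendsto hlim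
  have hconv := tendsto_Lp_finite_of_tendsto_ae le_rfl ENNReal.one_ne_top (fun n => hui.1 n) hL
    hui.2.1 hlim
  have hI : Integrable (fun ω => X (ρ ω) ω) P := memLp_one_iff_integrable.1 hL
  refine ⟨hI, ?_⟩
  have h1 : Tendsto (fun n => ∫ ω, X (gridAbove t n (ρ ω)) ω ∂P) atTop (𝓝 (∫ ω, X (ρ ω) ω ∂P)) :=
    tendsto_integral_of_L1' _ hI.aestronglyMeasurable
      (Eventually.of_forall fun n => memLp_one_iff_integrable.1 (hui.memLp n)) hconv
  have h2 : ∀ n, ∫ ω, X (gridAbove t n (ρ ω)) ω ∂P = ∫ ω, X t ω ∂P := fun n => by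
    rw [integral_congr_ae (hce n), integral_condExp]
  simp_rw [h2] at h1
  exact tendsto_nhds_unique h1 tendsto_const_nhds

/-- Optional stopping for a continuous martingale, in integrated form. -/
lemma setIntegral_stopped_eq (hM : Martingale X 𝓕 P) (hc : ∀ ω, Continuous (X · ω))
    {τ : Ω → WithTop ℝ≥0} (hτ : IsStoppingTime 𝓕 τ) {s t : ℝ≥0} (hst : s ≤ t) {A : Set Ω}
    (hA : MeasurableSet[𝓕 s] A) :
    ∫ ω in A, X (tmin t (τ ω)) ω ∂P = ∫ ω in A, X (tmin s (τ ω)) ω ∂P := by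
  classical
  have hs := integral_stopped_eq hM hc (isStoppingTime_tmin hτ s) (t := t)
    (fun ω => (tmin_le s _).trans hst)
  have ht := integral_stopped_eq hM hc (isStoppingTime_tmin hτ t) (fun ω => tmin_le t _)
  have hAm : MeasurableSet A := 𝓕.le s _ hA
  have hρ : IsStoppingTime 𝓕
      (fun ω => ((if ω ∈ A then tmin t (τ ω) else tmin s (τ ω) : ℝ≥0) : WithTop ℝ≥0)) := by
    intro r
    by_cases hr : s ≤ r
    · have : {ω | ((if ω ∈ A then tmin t (τ ω) else tmin s (τ ω) : ℝ≥0) : WithTop ℝ≥0) ≤ r} =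
          (A ∩ {ω | ((tmin t (τ ω) : ℝ≥0) : WithTop ℝ≥0) ≤ r}) ∪
          (Aᶜ ∩ {ω | ((tmin s (τ ω) : ℝ≥0) : WithTop ℝ≥0) ≤ r}) := by
        ext ω
        by_cases h : ω ∈ A <;> simp [h]
      rw [this]
      exact ((𝓕.mono hr _ hA).inter (isStoppingTime_tmin hτ t r)).union
        ((𝓕.mono hr _ hA.compl).inter (isStoppingTime_tmin hτ s r))
    · have : {ω | ((if ω ∈ A then tmin t (τ ω) else tmin s (τ ω) : ℝ≥0) : WithTop ℝ≥0) ≤ r} =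
          {ω | τ ω ≤ r} := by
        ext ω
        by_cases h : ω ∈ A
        · have htr : ¬ t ≤ r := fun h' => hr (hst.trans h')
          simp only [Set.mem_ofPred_eq, h, if_true, coe_tmin_le_iff, htr, false_or]
        · simp only [Set.mem_ofPred_eq, h, if_false, coe_tmin_le_iff, hr, false_or]
      rw [this]
      exact hτ r
  have h := integral_stopped_eq hM hc hρ (t := t) (fun ω => by
    split_ifs
    · exact tmin_le t _
    · exact (tmin_le s _).trans hst)
  have key : ∫ ω, X (if ω ∈ A then tmin t (τ ω) else tmin s (τ ω)) ω ∂P =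
      ∫ ω in A, X (tmin t (τ ω)) ω ∂P + ∫ ω in Aᶜ, X (tmin s (τ ω)) ω ∂P := by
    rw [← integral_add_compl hAm h.1]
    congr 1
    · exact setIntegral_congr_fun hAm fun ω hω => by simp [hω]
    · exact setIntegral_congr_fun hAm.compl fun ω hω => by simp [(show ω ∉ A from hω)]
  have key2 := integral_add_compl hAm hs.1
  linarith [h.2, hs.2]

end OptionalStopping

section ExitTime

variable {Ω : Type*} [mΩ : MeasurableSpace Ω] {𝓕 : Filtration ℝ≥0 mΩ} {X : ℝ≥0 → Ω → ℝ}

/-- Before time `t`, some increment of `x` over a pair of times in `K` has size at least `ε`. -/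
def HasExit (K : Set (ℝ≥0 × ℝ≥0)) (ε : ℝ) (x : ℝ≥0 → ℝ) (t : ℝ≥0) : Prop :=
  ∃ p ∈ K, p.1 ≤ t ∧ p.2 ≤ t ∧ ε ≤ |x p.1 - x p.2|

lemma exists_exitTime {K : Set (ℝ≥0 × ℝ≥0)} (hK : IsClosed K) (ε : ℝ) {x : ℝ≥0 → ℝ}
    (hx : Continuous x) : ∃ a : WithTop ℝ≥0, ∀ t : ℝ≥0, a ≤ t ↔ HasExit K ε x t := by
  by_cases h : ∃ T, HasExit K ε x T
  · obtain ⟨T, p₀, hp₀, h1, h2, h3⟩ := h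
    set C : Set (ℝ≥0 × ℝ≥0) := (K ∩ {p | ε ≤ |x p.1 - x p.2|}) ∩ Set.Icc 0 T ×ˢ Set.Icc 0 T
    have hC : IsCompact C := (isCompact_Icc.prod isCompact_Icc).inter_left
      (hK.inter (isClosed_le continuous_const (by fun_prop)))
    have hne : C.Nonempty := ⟨p₀, ⟨hp₀, h3⟩, ⟨zero_le, h1⟩, ⟨zero_le, h2⟩⟩
    obtain ⟨q, hq, hmin⟩ := hC.exists_isMinOn hne
      (f := fun p : ℝ≥0 × ℝ≥0 => max p.1 p.2) (by fun_prop)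
    refine ⟨(max q.1 q.2 : ℝ≥0), fun t => ?_⟩
    rw [WithTop.coe_le_coe]
    constructor
    · intro ht
      exact ⟨q, hq.1.1, (le_max_left _ _).trans ht, (le_max_right _ _).trans ht, hq.1.2⟩
    · rintro ⟨p, hp, hp1, hp2, hp3⟩
      by_cases hpT : max p.1 p.2 ≤ T
      · have : p ∈ C := ⟨⟨hp, hp3⟩, ⟨zero_le, (le_max_left _ _).trans hpT⟩,
          ⟨zero_le, (le_max_right _ _).trans hpT⟩⟩
        exact (hmin this).trans (max_le hp1 hp2)
      · exact (max_le hq.2.1.2 hq.2.2.2).trans ((not_le.1 hpT).le.trans (max_le hp1 hp2))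
  · refine ⟨⊤, fun t => ?_⟩
    simp only [not_exists] at h
    exact iff_of_false (not_le.2 (WithTop.coe_lt_top t)) (h t)

/-- The first time at which some increment over a pair of times in `K` has size at least `ε`. -/
def exitTime {Ω : Type*} (K : Set (ℝ≥0 × ℝ≥0)) (ε : ℝ) (X : ℝ≥0 → Ω → ℝ) (ω : Ω) : WithTop ℝ≥0 :=
  Classical.epsilon fun a : WithTop ℝ≥0 => ∀ t : ℝ≥0, a ≤ t ↔ HasExit K ε (X · ω) t

lemma exitTime_le_iff {Ω : Type*} {X : ℝ≥0 → Ω → ℝ} {K : Set (ℝ≥0 × ℝ≥0)} (hK : IsClosed K) (ε : ℝ) {ω : Ω}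
    (hc : Continuous (X · ω)) (t : ℝ≥0) :
    exitTime K ε X ω ≤ t ↔ HasExit K ε (X · ω) t :=
  Classical.epsilon_spec (exists_exitTime hK ε hc) t

lemma measurableSet_hasExit {Ω : Type*} {X : ℝ≥0 → Ω → ℝ} {m : MeasurableSpace Ω} {K : Set (ℝ≥0 × ℝ≥0)} (hK : IsClosed K) (ε : ℝ)
    (hc : ∀ ω, Continuous (X · ω)) {t : ℝ≥0} (hX : ∀ s ≤ t, Measurable[m] (X s)) :
    MeasurableSet[m] {ω | HasExit K ε (X · ω) t} := by
  set L : Set (ℝ≥0 × ℝ≥0) := K ∩ Set.Icc 0 t ×ˢ Set.Icc 0 t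
  have hL : IsCompact L := (isCompact_Icc.prod isCompact_Icc).inter_left hK
  obtain ⟨D, hDL, hDc, hD⟩ := (TopologicalSpace.IsSeparable.of_separableSpace L).exists_countable_dense_subset
  have heq : {ω | HasExit K ε (X · ω) t} =
      ⋂ n : ℕ, ⋃ p ∈ D, {ω | ε - 1 / (n + 1 : ℝ) < |X p.1 ω - X p.2 ω|} := by
    ext ω
    simp only [Set.mem_iInter, Set.mem_iUnion, Set.mem_ofPred_eq, exists_prop]
    have hcont : Continuous fun p : ℝ≥0 × ℝ≥0 => |X p.1 ω - X p.2 ω| := by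
      have := hc ω
      fun_prop
    constructor
    · rintro ⟨p, hp, hp1, hp2, hp3⟩ n
      have hpL : p ∈ closure D := hD ⟨hp, ⟨zero_le, hp1⟩, ⟨zero_le, hp2⟩⟩
      have hopen : IsOpen {q : ℝ≥0 × ℝ≥0 | ε - 1 / (n + 1 : ℝ) < |X q.1 ω - X q.2 ω|} :=
        isOpen_lt continuous_const hcont
      have hpos : (0 : ℝ) < 1 / (n + 1) := by positivity
      obtain ⟨q, hq1, hq2⟩ := mem_closure_iff.1 hpL _ hopen
        (by simp only [Set.mem_ofPred_eq]; linarith)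
      exact ⟨q, hq2, hq1⟩
    · intro h
      have hne : L.Nonempty := by
        obtain ⟨q, hq, -⟩ := h 0
        exact ⟨q, hDL hq⟩
      obtain ⟨p, hp, hmax⟩ := hL.exists_isMaxOn hne hcont.continuousOn
      refine ⟨p, hp.1, hp.2.1.2, hp.2.2.2, ?_⟩
      refine le_of_forall_pos_lt_add fun δ hδ => ?_
      obtain ⟨n, hn⟩ := exists_nat_one_div_lt hδ
      obtain ⟨q, hq, hq'⟩ := h n
      have : |X q.1 ω - X q.2 ω| ≤ |X p.1 ω - X p.2 ω| := hmax (hDL hq)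
      linarith
  rw [heq]
  refine MeasurableSet.iInter fun n => MeasurableSet.biUnion hDc fun p hp => ?_
  have h1 := hX p.1 (hDL hp).2.1.2
  have h2 := hX p.2 (hDL hp).2.2.2
  exact measurableSet_lt measurable_const (by simpa using (h1.sub h2).abs)

lemma isStoppingTime_exitTime {K : Set (ℝ≥0 × ℝ≥0)} (hK : IsClosed K) (ε : ℝ)
    (hX : ∀ t, Measurable[𝓕 t] (X t)) (hc : ∀ ω, Continuous (X · ω)) :
    IsStoppingTime 𝓕 (exitTime K ε X) := by
  intro t
  have : {ω | exitTime K ε X ω ≤ t} = {ω | HasExit K ε (X · ω) t} := by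
    ext ω
    exact exitTime_le_iff hK ε (hc ω) t
  rw [this]
  exact measurableSet_hasExit hK ε hc fun s hs => (hX s).mono (𝓕.mono hs) le_rfl

/-- The process stopped at its exit time has increments bounded by the threshold. -/
lemma abs_sub_le_of_exitTime {Ω : Type*} {X : ℝ≥0 → Ω → ℝ} {K : Set (ℝ≥0 × ℝ≥0)} (hK : IsClosed K) {ε : ℝ} (hε : 0 < ε)
    (hKmin : ∀ p ∈ K, ∀ s, (min p.1 s, min p.2 s) ∈ K) {ω : Ω} (hc : Continuous (X · ω))
    {a : WithTop ℝ≥0} (ha : a ≤ exitTime K ε X ω) {p : ℝ≥0 × ℝ≥0} (hp : p ∈ K) :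
    |X (tmin p.1 a) ω - X (tmin p.2 a) ω| ≤ ε := by
  have hlt : ∀ s : ℝ≥0, (s : WithTop ℝ≥0) < a → |X (min p.1 s) ω - X (min p.2 s) ω| < ε := by
    intro s hs
    by_contra h
    have : exitTime K ε X ω ≤ s := (exitTime_le_iff hK ε hc s).2
      ⟨_, hKmin p hp s, min_le_right _ _, min_le_right _ _, not_lt.1 h⟩
    exact absurd (hs.trans_le (ha.trans this)) (lt_irrefl _)
  induction a with
  | top =>
    have := hlt (max p.1 p.2) (WithTop.coe_lt_top _)
    rw [min_eq_left (le_max_left _ _), min_eq_left (le_max_right _ _)] at this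
    rw [tmin_top, tmin_top]
    exact this.le
  | coe a =>
    rw [tmin_coe, tmin_coe]
    rcases eq_or_ne a 0 with rfl | ha0
    · rw [min_eq_right zero_le, min_eq_right zero_le, sub_self, abs_zero]
      exact hε.le
    · have hclosed : IsClosed {s : ℝ≥0 | |X (min p.1 s) ω - X (min p.2 s) ω| ≤ ε} :=
        isClosed_le (((hc.comp (by fun_prop : Continuous fun s : ℝ≥0 => min p.1 s)).sub
          (hc.comp (by fun_prop : Continuous fun s : ℝ≥0 => min p.2 s))).abs) continuous_const
      have hsub : Set.Iio a ⊆ {s : ℝ≥0 | |X (min p.1 s) ω - X (min p.2 s) ω| ≤ ε} :=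
        fun s hs => (hlt s (WithTop.coe_lt_coe.2 hs)).le
      have hmem : a ∈ closure (Set.Iio a) := by
        rw [closure_Iio' ⟨0, pos_iff_ne_zero.2 ha0⟩]
        exact Set.mem_Iic.2 le_rfl
      exact closure_minimal hsub hclosed hmem

end ExitTime

section QuadMart

variable {Ω : Type*} [mΩ : MeasurableSpace Ω] {P : Measure Ω} [IsProbabilityMeasure P]
  {𝓕 : Filtration ℝ≥0 mΩ} {X : ℝ≥0 → Ω → ℝ} {c : ℝ} {σ : Ω → WithTop ℝ≥0}

/-- The process `X` stopped at `σ` is a square integrable martingale with bracket `c (t ∧ σ)`. -/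
structure IsQuadMart (X : ℝ≥0 → Ω → ℝ) (c : ℝ) (𝓕 : Filtration ℝ≥0 mΩ) (P : Measure Ω)
    (σ : Ω → WithTop ℝ≥0) : Prop where
  stopping : IsStoppingTime 𝓕 σ
  memLp : ∀ t, MemLp (fun ω => X (tmin t (σ ω)) ω) 2 P
  mart : ∀ s t, s ≤ t → ∀ A, MeasurableSet[𝓕 s] A →
    ∫ ω in A, X (tmin t (σ ω)) ω ∂P = ∫ ω in A, X (tmin s (σ ω)) ω ∂P
  quad : ∀ s t, s ≤ t → ∀ A, MeasurableSet[𝓕 s] A →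
    ∫ ω in A, (X (tmin t (σ ω)) ω ^ 2 - c * (tmin t (σ ω) : ℝ≥0)) ∂P =
      ∫ ω in A, (X (tmin s (σ ω)) ω ^ 2 - c * (tmin s (σ ω) : ℝ≥0)) ∂P

lemma stoppedProcess_indicator_eq {Ω : Type*} {Z : ℝ≥0 → Ω → ℝ} (h0 : ∀ ω, Z 0 ω = 0) (τ : Ω → WithTop ℝ≥0) :
    stoppedProcess (fun i => {ω | ⊥ < τ ω}.indicator (Z i)) τ =
      fun t ω => Z (tmin t (τ ω)) ω := by
  funext t ω
  rw [stoppedProcess_indicator_comm]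
  by_cases h : ⊥ < τ ω
  · rw [Set.indicator_of_mem (by exact h)]
    rfl
  · have h' : τ ω = ((0 : ℝ≥0) : WithTop ℝ≥0) := not_bot_lt_iff.1 h
    rw [Set.indicator_of_notMem (by exact h), h', tmin_coe, min_eq_right zero_le, h0]

lemma setIntegral_of_stopped_martingale {Z : ℝ≥0 → Ω → ℝ} (hc : ∀ ω, Continuous (Z · ω))
    (h0 : ∀ ω, Z 0 ω = 0) {τ : Ω → WithTop ℝ≥0}
    (hM : Martingale (stoppedProcess (fun i => {ω | ⊥ < τ ω}.indicator (Z i)) τ) 𝓕 P)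
    (hσ : IsStoppingTime 𝓕 σ) (hle : ∀ ω, σ ω ≤ τ ω) :
    (∀ t, Integrable (fun ω => Z (tmin t (σ ω)) ω) P) ∧
      ∀ s t, s ≤ t → ∀ A, MeasurableSet[𝓕 s] A →
        ∫ ω in A, Z (tmin t (σ ω)) ω ∂P = ∫ ω in A, Z (tmin s (σ ω)) ω ∂P := by
  rw [stoppedProcess_indicator_eq h0] at hM
  have heq : ∀ t ω, Z (tmin (tmin t (σ ω)) (τ ω)) ω = Z (tmin t (σ ω)) ω := fun t ω => by
    rw [tmin_tmin, min_eq_left (hle ω)]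
  have hc' : ∀ ω, Continuous fun t => Z (tmin t (τ ω)) ω := fun ω => by
    refine (hc ω).comp ?_
    cases h : τ ω with
    | top => simpa only [tmin_top] using continuous_id'
    | coe a => simpa only [tmin_coe] using continuous_id'.min continuous_const
  constructor
  · intro t
    have := (integral_stopped_eq hM hc' (isStoppingTime_tmin hσ t) (fun ω => tmin_le t _)).1
    simpa only [heq] using this
  · intro s t hst A hA
    have := setIntegral_stopped_eq hM hc' hσ hst hA
    simpa only [heq] using this

lemma exists_localizing_quadMart (hc : ∀ ω, Continuous (X · ω)) (h0 : ∀ ω, X 0 ω = 0)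
    (hM : IsLocalMartingale X 𝓕 P)
    (hG : IsLocalMartingale (fun t ω => X t ω ^ 2 - c * t) 𝓕 P) :
    ∃ τ : ℕ → Ω → WithTop ℝ≥0, (∀ᵐ ω ∂P, Tendsto (τ · ω) atTop (𝓝 ⊤)) ∧
      ∀ n (σ : Ω → WithTop ℝ≥0), IsStoppingTime 𝓕 σ →
        IsQuadMart X c 𝓕 P (fun ω => min (τ n ω) (σ ω)) := by
  obtain ⟨τ₁, hτ₁, hM⟩ := hM
  obtain ⟨τ₂, hτ₂, hG⟩ := hG
  have hloc := hτ₁.min hτ₂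
  refine ⟨min τ₁ τ₂, hloc.tendsto_top, fun n σ hσ => ?_⟩
  have hst : IsStoppingTime 𝓕 (fun ω => min ((min τ₁ τ₂) n ω) (σ ω)) :=
    (hloc.isStoppingTime n).min hσ
  have h1 := setIntegral_of_stopped_martingale hc h0 (hM n) hst
    (fun ω => (min_le_left _ _).trans (min_le_left _ _))
  have h2 := setIntegral_of_stopped_martingale (Z := fun t ω => X t ω ^ 2 - c * t)
    (fun ω => by have := hc ω; fun_prop) (by simp [h0]) (hG n) hst
    (fun ω => (min_le_left _ _).trans (min_le_right _ _))
  refine ⟨hst, fun t => ?_, h1.2, h2.2⟩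
  rw [memLp_two_iff_integrable_sq (h1.1 t).1]
  have hb : Integrable (fun ω => c * ((tmin t (min ((min τ₁ τ₂) n ω) (σ ω)) : ℝ≥0) : ℝ)) P := by
    refine Integrable.const_mul (Integrable.of_bound (C := t) ?_ (ae_of_all _ fun ω => ?_)) c
    · exact (((measurable_tmin hst t).mono (𝓕.le t) le_rfl).coe_nnreal_real).aestronglyMeasurable
    · rw [Real.norm_of_nonneg (NNReal.coe_nonneg _)]
      exact_mod_cast tmin_le t _
  refine ((h2.1 t).add hb).congr (ae_of_all _ fun ω => ?_)
  simp

lemma integral_mul_eq_zero {m : MeasurableSpace Ω} (hm : m ≤ mΩ) {D : Ω → ℝ} (hD : Integrable D P)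
    (h : ∀ A, MeasurableSet[m] A → ∫ ω in A, D ω ∂P = 0) {Z : Ω → ℂ} (hZ : StronglyMeasurable[m] Z)
    (hZD : Integrable (fun ω => Z ω * D ω) P) : ∫ ω, Z ω * D ω ∂P = 0 := by
  have h0 : (0 : Ω → ℝ) =ᵐ[P] P[D | m] :=
    ae_eq_condExp_of_forall_setIntegral_eq hm hD (fun s _ _ => integrableOn_zero)
      (fun s hs _ => by simp [h s hs]) stronglyMeasurable_zero.aestronglyMeasurable
  let B : ℂ →L[ℝ] ℝ →L[ℝ] ℂ := (ContinuousLinearMap.lsmul ℝ ℝ).flip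
  have hB : ∀ z d, B z d = z * d := fun z d => by
    simp [B, mul_comm]
  have hZD' : Integrable (fun ω => B (Z ω) (D ω)) P := by simpa only [hB] using hZD
  have h1 := condExp_bilin_of_stronglyMeasurable_left (B := B) hZ hZD' hD
  calc ∫ ω, Z ω * D ω ∂P = ∫ ω, B (Z ω) (D ω) ∂P := by simp only [hB]
    _ = ∫ ω, (P[fun ω => B (Z ω) (D ω) | m]) ω ∂P := (integral_condExp hm).symm
    _ = ∫ ω, B (Z ω) ((P[D | m]) ω) ∂P := integral_congr_ae h1
    _ = 0 := by
        rw [integral_congr_ae (g := fun _ => (0 : ℂ))]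
        · simp
        · filter_upwards [h0] with ω hω
          simp [hB, ← hω]

lemma norm_exp_taylor_le {l k u a ε : ℝ} (hk : 0 ≤ k) (hε1 : ε ≤ 1) (hL : (|l| + k) * ε ≤ 1)
    (hu : |u| ≤ ε) (ha0 : 0 ≤ a) (ha : a ≤ ε) :
    ‖Complex.exp (Complex.I * (l * u) + k * a) - 1 - Complex.I * (l * u) + l ^ 2 / 2 * u ^ 2 - k * a‖ ≤
      (2 * (|l| + k) ^ 3 + (|l| + k) ^ 2) * ε * (u ^ 2 + a) := by
  set z : ℂ := Complex.I * (l * u) + k * a with hz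
  set L := |l| + k with hLdef
  have hL0 : 0 ≤ L := by positivity
  have hε0 : 0 ≤ ε := (abs_nonneg u).trans hu
  have hlL : |l| ≤ L := by simp [hLdef, hk]
  have hkL : k ≤ L := by simp [hLdef]
  have hz1 : ‖z‖ ≤ |l| * |u| + k * a := by
    refine (norm_add_le _ _).trans (le_of_eq ?_)
    simp [abs_of_nonneg hk, abs_of_nonneg ha0]
  have hz2 : ‖z‖ ≤ L * ε := by
    refine hz1.trans ?_
    rw [hLdef, add_mul]
    gcongr
  have h3 : ‖Complex.exp z - 1 - z - z ^ 2 / 2‖ ≤ ‖z‖ ^ 3 := by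
    have := Complex.exp_bound (hz2.trans hL) (n := 3) (by norm_num)
    simp only [Finset.sum_range_succ, Finset.sum_range_zero, Nat.factorial] at this
    have h4 : ‖z‖ ^ 3 * (((3 : ℕ).succ : ℝ) * (((2 + 1) * ((1 + 1) * ((0 + 1) * 1)) : ℕ) * (3 : ℕ) : ℝ)⁻¹) ≤
        ‖z‖ ^ 3 := by
      refine mul_le_of_le_one_right (by positivity) ?_
      norm_num
    refine le_trans (le_of_eq ?_) (this.trans h4)
    congr 1
    norm_num
    ring
  have h5 : ‖z‖ ^ 3 ≤ 2 * L ^ 3 * ε * (u ^ 2 + a) := by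
    have hsq : ‖z‖ ^ 2 ≤ 2 * L ^ 2 * (u ^ 2 + a) := by
      have h6 : ‖z‖ ^ 2 ≤ (|l| * |u| + k * a) ^ 2 := by gcongr
      have h7 : (|l| * |u| + k * a) ^ 2 ≤ 2 * ((|l| * |u|) ^ 2 + (k * a) ^ 2) := by
        nlinarith [sq_nonneg (|l| * |u| - k * a)]
      have h8 : (|l| * |u|) ^ 2 ≤ L ^ 2 * u ^ 2 := by
        rw [mul_pow, sq_abs u]
        gcongr
      have h9 : (k * a) ^ 2 ≤ L ^ 2 * a := by
        rw [mul_pow]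
        have : a ^ 2 ≤ a := by nlinarith
        gcongr
      linarith
    calc ‖z‖ ^ 3 = ‖z‖ * ‖z‖ ^ 2 := by ring
      _ ≤ (L * ε) * (2 * L ^ 2 * (u ^ 2 + a)) := by gcongr
      _ = _ := by ring
  have h10 : ‖z ^ 2 / 2 + l ^ 2 / 2 * u ^ 2‖ ≤ L ^ 2 * ε * (u ^ 2 + a) := by
    have : z ^ 2 / 2 + l ^ 2 / 2 * u ^ 2 = Complex.I * ((l * u * k * a : ℝ) : ℂ) +
        ((k ^ 2 * a ^ 2 / 2 : ℝ) : ℂ) := by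
      rw [hz]
      push_cast
      ring_nf
      rw [Complex.I_sq]
      ring
    rw [this]
    refine (norm_add_le _ _).trans ?_
    rw [norm_mul, Complex.norm_I, one_mul, Complex.norm_real, Complex.norm_real, Real.norm_eq_abs,
      Real.norm_eq_abs, abs_mul, abs_mul, abs_mul, abs_of_nonneg ha0, abs_of_nonneg hk,
      abs_of_nonneg (by positivity : 0 ≤ k ^ 2 * a ^ 2 / 2)]
    have e1 : |l| * |u| * k * a ≤ |l| * ε * k * a := by gcongr
    have e2 : k ^ 2 * a ^ 2 / 2 ≤ k ^ 2 * (ε * a) := by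
      have : a ^ 2 ≤ ε * a := by nlinarith
      nlinarith [sq_nonneg k, mul_le_mul_of_nonneg_left this (sq_nonneg k), mul_nonneg hε0 ha0,
        mul_nonneg (sq_nonneg k) (sq_nonneg a)]
    have e3 : |l| * k + k ^ 2 ≤ L ^ 2 := by
      rw [hLdef]; nlinarith [abs_nonneg l, sq_nonneg |l|, mul_nonneg (abs_nonneg l) hk]
    have e4 : 0 ≤ ε * a := by positivity
    have e5 : 0 ≤ L ^ 2 * ε * u ^ 2 := by positivity
    nlinarith [mul_le_mul_of_nonneg_right e3 e4]
  calc ‖Complex.exp z - 1 - Complex.I * (l * u) + l ^ 2 / 2 * u ^ 2 - k * a‖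
      = ‖(Complex.exp z - 1 - z - z ^ 2 / 2) + (z ^ 2 / 2 + l ^ 2 / 2 * u ^ 2)‖ := by
        congr 1; rw [hz]; ring
    _ ≤ _ := (norm_add_le _ _).trans (add_le_add (h3.trans h5) h10)
    _ = _ := by ring

end QuadMart

section Levy

variable {Ω : Type*} [mΩ : MeasurableSpace Ω] {P : Measure Ω} [IsProbabilityMeasure P]
  {𝓕 : Filtration ℝ≥0 mΩ} {X : ℝ≥0 → Ω → ℝ} {c : ℝ} {σ : Ω → WithTop ℝ≥0}

/-- The expected elapsed time before `σ`. -/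
def meanTime (P : Measure Ω) (σ : Ω → WithTop ℝ≥0) (t : ℝ≥0) : ℝ :=
  ∫ ω, ((tmin t (σ ω) : ℝ≥0) : ℝ) ∂P

lemma integrable_tmin (hσ : IsStoppingTime 𝓕 σ) (t : ℝ≥0) :
    Integrable (fun ω => ((tmin t (σ ω) : ℝ≥0) : ℝ)) P := by
  refine Integrable.of_bound (C := t) ?_ (ae_of_all _ fun ω => ?_)
  · exact (((measurable_tmin hσ t).mono (𝓕.le t) le_rfl).coe_nnreal_real).aestronglyMeasurable
  · rw [Real.norm_of_nonneg (NNReal.coe_nonneg _)]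
    exact_mod_cast tmin_le t _

lemma IsQuadMart.integral_increment (hQ : IsQuadMart X c 𝓕 P σ)
    (hX : ∀ t, StronglyMeasurable[𝓕 t] (fun ω => X (tmin t (σ ω)) ω)) {s t : ℝ≥0} (hst : s ≤ t)
    {Y : Ω → ℂ} (hY : StronglyMeasurable[𝓕 s] Y) {B : ℝ} (hB : ∀ ω, ‖Y ω‖ ≤ B) :
    ∫ ω, Y ω * ((X (tmin t (σ ω)) ω - X (tmin s (σ ω)) ω : ℝ) : ℂ) ∂P = 0 ∧
    ∫ ω, Y ω * (((X (tmin t (σ ω)) ω - X (tmin s (σ ω)) ω) ^ 2 -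
      c * ((tmin t (σ ω) : ℝ≥0) - (tmin s (σ ω) : ℝ≥0)) : ℝ) : ℂ) ∂P = 0 := by
  have hXt := hQ.memLp t
  have hXs := hQ.memLp s
  have hD := hXt.sub hXs
  have hDi : Integrable (fun ω => X (tmin t (σ ω)) ω - X (tmin s (σ ω)) ω) P :=
    hD.integrable (by norm_num)
  have hYm : AEStronglyMeasurable Y P := (hY.mono (𝓕.le s)).aestronglyMeasurable
  have hDm : ∀ A, MeasurableSet[𝓕 s] A →
      ∫ ω in A, (X (tmin t (σ ω)) ω - X (tmin s (σ ω)) ω) ∂P = 0 := fun A hA => by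
    rw [integral_sub (hXt.integrable (by norm_num)).integrableOn
      (hXs.integrable (by norm_num)).integrableOn, hQ.mart s t hst A hA, sub_self]
  refine ⟨integral_mul_eq_zero (𝓕.le s) hDi hDm hY (hDi.ofReal.bdd_mul hYm (ae_of_all _ hB)), ?_⟩
  have hti := integrable_tmin (P := P) hQ.stopping t
  have hsi := integrable_tmin (P := P) hQ.stopping s
  have hQt : Integrable (fun ω => X (tmin t (σ ω)) ω ^ 2 - c * (tmin t (σ ω) : ℝ≥0)) P :=
    hXt.integrable_sq.sub (hti.const_mul c)
  have hQs : Integrable (fun ω => X (tmin s (σ ω)) ω ^ 2 - c * (tmin s (σ ω) : ℝ≥0)) P :=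
    hXs.integrable_sq.sub (hsi.const_mul c)
  have h1 := integral_mul_eq_zero (𝓕.le s) (hQt.sub hQs) (fun A hA => by
    rw [Pi.sub_def, integral_sub hQt.integrableOn hQs.integrableOn, hQ.quad s t hst A hA, sub_self])
    hY ((hQt.sub hQs).ofReal.bdd_mul hYm (ae_of_all _ hB))
  have hprod : Integrable (fun ω => X (tmin s (σ ω)) ω * (X (tmin t (σ ω)) ω - X (tmin s (σ ω)) ω)) P :=
    hXs.integrable_mul hD
  have hYX : StronglyMeasurable[𝓕 s] fun ω => Y ω * ((2 * X (tmin s (σ ω)) ω : ℝ) : ℂ) :=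
    hY.mul (Complex.continuous_ofReal.comp_stronglyMeasurable ((hX s).const_mul 2))
  have hint2 : Integrable (fun ω => Y ω * ((2 * X (tmin s (σ ω)) ω : ℝ) : ℂ) *
      ((X (tmin t (σ ω)) ω - X (tmin s (σ ω)) ω : ℝ) : ℂ)) P := by
    have hp2 : Integrable (fun ω => ((2 * (X (tmin s (σ ω)) ω *
      (X (tmin t (σ ω)) ω - X (tmin s (σ ω)) ω)) : ℝ) : ℂ)) P := (hprod.const_mul 2).ofReal
    refine (hp2.bdd_mul hYm (ae_of_all _ hB)).congr (ae_of_all _ fun ω => ?_)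
    push_cast
    ring
  have h2 := integral_mul_eq_zero (𝓕.le s) hDi hDm hYX hint2
  have h1i : Integrable (fun ω => Y ω *
      (((X (tmin t (σ ω)) ω ^ 2 - c * (tmin t (σ ω) : ℝ≥0)) -
        (X (tmin s (σ ω)) ω ^ 2 - c * (tmin s (σ ω) : ℝ≥0)) : ℝ) : ℂ)) P :=
    (hQt.sub hQs).ofReal.bdd_mul hYm (ae_of_all _ hB)
  calc _ = ∫ ω, (Y ω * (((X (tmin t (σ ω)) ω ^ 2 - c * (tmin t (σ ω) : ℝ≥0)) -
        (X (tmin s (σ ω)) ω ^ 2 - c * (tmin s (σ ω) : ℝ≥0)) : ℝ) : ℂ) -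
        Y ω * ((2 * X (tmin s (σ ω)) ω : ℝ) : ℂ) *
          ((X (tmin t (σ ω)) ω - X (tmin s (σ ω)) ω : ℝ) : ℂ)) ∂P := by
        refine integral_congr_ae (ae_of_all _ fun ω => ?_)
        push_cast
        ring
    _ = 0 := by
        rw [integral_sub h1i hint2, h2, sub_zero]
        exact h1

/-- The exponential process `exp (i l X + k t)` stopped at `σ`. -/
def expStop (X : ℝ≥0 → Ω → ℝ) (l k : ℝ) (σ : Ω → WithTop ℝ≥0) (t : ℝ≥0) (ω : Ω) : ℂ :=
  Complex.exp (Complex.I * (l * X (tmin t (σ ω)) ω) + k * (tmin t (σ ω) : ℝ≥0))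

lemma norm_expStop_le {Ω : Type*} {X : ℝ≥0 → Ω → ℝ} {σ : Ω → WithTop ℝ≥0} {k : ℝ} (hk : 0 ≤ k) (l : ℝ) (t : ℝ≥0) (ω : Ω) :
    ‖expStop X l k σ t ω‖ ≤ Real.exp (k * t) := by
  rw [expStop, Complex.norm_exp]
  refine Real.exp_le_exp.2 ?_
  have h : ((tmin t (σ ω) : ℝ≥0) : ℝ) ≤ t := by exact_mod_cast tmin_le t (σ ω)
  simpa using mul_le_mul_of_nonneg_left h hk

lemma stronglyMeasurable_expStop (hσ : IsStoppingTime 𝓕 σ)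
    (hX : ∀ t, StronglyMeasurable[𝓕 t] (fun ω => X (tmin t (σ ω)) ω)) (l k : ℝ) (t : ℝ≥0) :
    StronglyMeasurable[𝓕 t] (expStop X l k σ t) := by
  have h1 : StronglyMeasurable[𝓕 t] fun ω => ((tmin t (σ ω) : ℝ≥0) : ℝ) :=
    (measurable_tmin hσ t).coe_nnreal_real.stronglyMeasurable
  have hc : Continuous fun p : ℝ × ℝ => Complex.exp (Complex.I * (l * p.1) + k * p.2) := by fun_prop
  exact hc.comp_stronglyMeasurable ((hX t).prodMk h1)

lemma IsQuadMart.norm_integral_expStop_step (hQ : IsQuadMart X c 𝓕 P σ) (hc : 0 ≤ c)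
    (hX : ∀ t, StronglyMeasurable[𝓕 t] (fun ω => X (tmin t (σ ω)) ω)) {s t T : ℝ≥0} (hst : s ≤ t)
    (hsT : s ≤ T)
    {l ε : ℝ} (hε1 : ε ≤ 1) (hL : (|l| + l ^ 2 * c / 2) * ε ≤ 1)
    (hosc : ∀ ω, |X (tmin t (σ ω)) ω - X (tmin s (σ ω)) ω| ≤ ε) (hts : (t : ℝ) - s ≤ ε)
    {Y : Ω → ℂ} (hY : StronglyMeasurable[𝓕 s] Y) {B : ℝ} (hB : ∀ ω, ‖Y ω‖ ≤ B) :
    ‖(∫ ω, Y ω * expStop X l (l ^ 2 * c / 2) σ t ω ∂P) -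
        ∫ ω, Y ω * expStop X l (l ^ 2 * c / 2) σ s ω ∂P‖ ≤
      B * Real.exp (l ^ 2 * c / 2 * T) *
        ((2 * (|l| + l ^ 2 * c / 2) ^ 3 + (|l| + l ^ 2 * c / 2) ^ 2) * ε) * (c + 1) *
          (meanTime P σ t - meanTime P σ s) := by
  set k := l ^ 2 * c / 2 with hkdef
  have hk : 0 ≤ k := by positivity
  have hε0 : 0 ≤ ε := by
    obtain ⟨ω⟩ : Nonempty Ω := nonempty_of_isProbabilityMeasure P
    exact (abs_nonneg _).trans (hosc ω)
  have hB0 : 0 ≤ B := by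
    obtain ⟨ω⟩ : Nonempty Ω := nonempty_of_isProbabilityMeasure P
    exact (norm_nonneg _).trans (hB ω)
  set C := (2 * (|l| + k) ^ 3 + (|l| + k) ^ 2) * ε with hC
  set D : Ω → ℝ := fun ω => X (tmin t (σ ω)) ω - X (tmin s (σ ω)) ω with hDdef
  set A : Ω → ℝ := fun ω => ((tmin t (σ ω) : ℝ≥0) : ℝ) - (tmin s (σ ω) : ℝ≥0) with hAdef
  have hA0 : ∀ ω, 0 ≤ A ω := fun ω => sub_nonneg.2 (by exact_mod_cast tmin_mono hst (σ ω))
  have hAε : ∀ ω, A ω ≤ ε := fun ω => (tmin_sub_le hst _).trans hts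
  have hAi : Integrable A P := (integrable_tmin hQ.stopping t).sub (integrable_tmin hQ.stopping s)
  have hD2 : Integrable (fun ω => D ω ^ 2) P := ((hQ.memLp t).sub (hQ.memLp s)).integrable_sq
  set W : Ω → ℂ := fun ω => Y ω * expStop X l k σ s ω with hW
  have hWm : StronglyMeasurable[𝓕 s] W := hY.mul (stronglyMeasurable_expStop hQ.stopping hX l k s)
  have hWB : ∀ ω, ‖W ω‖ ≤ B * Real.exp (k * T) := fun ω => by
    rw [hW, norm_mul]
    refine mul_le_mul (hB ω) ((norm_expStop_le hk l s ω).trans ?_) (norm_nonneg _) hB0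
    gcongr
  have hYm : ∀ r, AEStronglyMeasurable (fun ω => Y ω * expStop X l k σ r ω) P := fun r =>
    ((hY.mono (𝓕.le s)).mul ((stronglyMeasurable_expStop hQ.stopping hX l k r).mono
      (𝓕.le r))).aestronglyMeasurable
  have hYi : ∀ r, Integrable (fun ω => Y ω * expStop X l k σ r ω) P := fun r =>
    Integrable.of_bound (hYm r) (B * Real.exp (k * r)) (ae_of_all _ fun ω => by
      rw [norm_mul]
      exact mul_le_mul (hB ω) (norm_expStop_le hk l r ω) (norm_nonneg _) hB0)
  obtain ⟨hz1, hz2⟩ := hQ.integral_increment hX hst hWm hWB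
  obtain ⟨-, hz3⟩ := hQ.integral_increment hX hst (Y := fun _ => (1 : ℂ)) stronglyMeasurable_const
    (B := 1) (by simp)
  have hWm' : AEStronglyMeasurable W P := (hWm.mono (𝓕.le s)).aestronglyMeasurable
  have hi1 : Integrable (fun ω => W ω * ((D ω : ℝ) : ℂ)) P :=
    (((hQ.memLp t).sub (hQ.memLp s)).integrable (by norm_num)).ofReal.bdd_mul hWm'
      (ae_of_all _ hWB)
  have hi2 : Integrable (fun ω => W ω * ((D ω ^ 2 - c * A ω : ℝ) : ℂ)) P :=
    (hD2.sub (hAi.const_mul c)).ofReal.bdd_mul hWm' (ae_of_all _ hWB)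
  have hED : ∫ ω, D ω ^ 2 ∂P = c * ∫ ω, A ω ∂P := by
    have : ∫ ω, (D ω ^ 2 - c * A ω) ∂P = 0 := by
      have h := hz3
      simp only [one_mul] at h
      rw [integral_complex_ofReal] at h
      exact_mod_cast h
    rw [integral_sub hD2 (hAi.const_mul c), integral_const_mul] at this
    linarith
  have hEA : ∫ ω, A ω ∂P = meanTime P σ t - meanTime P σ s :=
    integral_sub (integrable_tmin hQ.stopping t) (integrable_tmin hQ.stopping s)
  have hpt : ∀ ω, ‖Y ω * expStop X l k σ t ω - Y ω * expStop X l k σ s ω -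
      Complex.I * l * (W ω * ((D ω : ℝ) : ℂ)) +
      l ^ 2 / 2 * (W ω * ((D ω ^ 2 - c * A ω : ℝ) : ℂ))‖ ≤
      B * Real.exp (k * T) * (C * (D ω ^ 2 + A ω)) := fun ω => by
    have h1 := norm_exp_taylor_le (l := l) hk hε1 hL (hosc ω) (hA0 ω) (hAε ω)
    have h2 : expStop X l k σ t ω = expStop X l k σ s ω *
        Complex.exp (Complex.I * (l * (D ω : ℝ)) + k * (A ω : ℝ)) := by
      rw [expStop, expStop, ← Complex.exp_add]
      congr 1
      simp only [hDdef, hAdef]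
      push_cast
      ring
    have h3 : Y ω * expStop X l k σ t ω - Y ω * expStop X l k σ s ω -
      Complex.I * l * (W ω * ((D ω : ℝ) : ℂ)) +
      l ^ 2 / 2 * (W ω * ((D ω ^ 2 - c * A ω : ℝ) : ℂ)) = W ω *
      (Complex.exp (Complex.I * (l * (D ω : ℝ)) + k * (A ω : ℝ)) - 1 - Complex.I * (l * (D ω : ℝ)) +
        l ^ 2 / 2 * (D ω : ℝ) ^ 2 - k * (A ω : ℝ)) := by
      rw [h2, hW, hkdef]
      push_cast
      ring
    rw [h3, norm_mul]
    exact mul_le_mul (hWB ω) h1 (norm_nonneg _) (by positivity)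
  calc _ = ‖∫ ω, (Y ω * expStop X l k σ t ω - Y ω * expStop X l k σ s ω -
      Complex.I * l * (W ω * ((D ω : ℝ) : ℂ)) +
      l ^ 2 / 2 * (W ω * ((D ω ^ 2 - c * A ω : ℝ) : ℂ))) ∂P‖ := by
        have hi12 : Integrable (fun ω => Y ω * expStop X l k σ t ω - Y ω * expStop X l k σ s ω -
            Complex.I * l * (W ω * ((D ω : ℝ) : ℂ))) P := ((hYi t).sub (hYi s)).sub (hi1.const_mul (Complex.I * l))
        have e1 : ∫ ω, W ω * ((D ω : ℝ) : ℂ) ∂P = 0 := hz1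
        have e2 : ∫ ω, W ω * ((D ω ^ 2 - c * A ω : ℝ) : ℂ) ∂P = 0 := hz2
        have hi0 : Integrable (fun ω => Y ω * expStop X l k σ t ω - Y ω * expStop X l k σ s ω) P :=
          (hYi t).sub (hYi s)
        rw [integral_add hi12 (hi2.const_mul _), integral_sub hi0 (hi1.const_mul (Complex.I * l)),
          integral_sub (hYi t) (hYi s), integral_const_mul, integral_const_mul, e1, e2, mul_zero,
          sub_zero, mul_zero, add_zero]
    _ ≤ ∫ ω, B * Real.exp (k * T) * (C * (D ω ^ 2 + A ω)) ∂P :=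
        norm_integral_le_of_norm_le (((hD2.add hAi).const_mul C).const_mul _) (ae_of_all _ hpt)
    _ = _ := by
        rw [integral_const_mul, integral_const_mul, integral_add hD2 hAi, hED, hEA]
        ring

lemma norm_sub_le_of_forall_step {E : Type*} [SeminormedAddCommGroup E] {g : ℕ → E} {α : ℕ → ℝ}
    {K : ℝ} {N : ℕ} (h : ∀ i < N, ‖g (i + 1) - g i‖ ≤ K * (α (i + 1) - α i)) :
    ‖g N - g 0‖ ≤ K * (α N - α 0) := by
  induction N with
  | zero => simp
  | succ n ih =>
    calc ‖g (n + 1) - g 0‖ = ‖(g (n + 1) - g n) + (g n - g 0)‖ := by congr 1; abel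
      _ ≤ K * (α (n + 1) - α n) + K * (α n - α 0) :=
        (norm_add_le _ _).trans (add_le_add (h n (Nat.lt_succ_self n))
          (ih fun i hi => h i (hi.trans (Nat.lt_succ_self n))))
      _ = _ := by ring

lemma IsQuadMart.norm_integral_expStop (hQ : IsQuadMart X c 𝓕 P σ) (hc : 0 ≤ c)
    (hX : ∀ t, StronglyMeasurable[𝓕 t] (fun ω => X (tmin t (σ ω)) ω)) {s t : ℝ≥0} (hst : s ≤ t)
    {l ε : ℝ} {δ : ℝ≥0} (hδ : 0 < δ) (hε : 0 < ε) (hε1 : ε ≤ 1) (hL : (|l| + l ^ 2 * c / 2) * ε ≤ 1)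
    (hosc : ∀ ω, ∀ a b : ℝ≥0, a ≤ b + δ → b ≤ a + δ →
      |X (tmin a (σ ω)) ω - X (tmin b (σ ω)) ω| ≤ ε)
    {Y : Ω → ℂ} (hY : StronglyMeasurable[𝓕 s] Y) {B : ℝ} (hB : ∀ ω, ‖Y ω‖ ≤ B) :
    ‖(∫ ω, Y ω * expStop X l (l ^ 2 * c / 2) σ t ω ∂P) -
        ∫ ω, Y ω * expStop X l (l ^ 2 * c / 2) σ s ω ∂P‖ ≤
      B * Real.exp (l ^ 2 * c / 2 * t) *
        ((2 * (|l| + l ^ 2 * c / 2) ^ 3 + (|l| + l ^ 2 * c / 2) ^ 2) * ε) * (c + 1) * t := by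
  obtain ⟨N, hN0, hN⟩ : ∃ N : ℕ, 0 < N ∧ (t - s) / (N : ℝ≥0) ≤ min δ ε.toNNReal := by
    have h0 : 0 < min δ ε.toNNReal := lt_min hδ (Real.toNNReal_pos.2 hε)
    obtain ⟨N, hN⟩ := exists_nat_gt ((t - s) / min δ ε.toNNReal)
    have hN0 : 0 < N := Nat.pos_of_ne_zero fun h => by simp [h] at hN
    refine ⟨N, hN0, ?_⟩
    rw [div_le_iff₀ (by exact_mod_cast hN0), mul_comm]
    exact ((div_lt_iff₀ h0).1 hN).le
  set h : ℝ≥0 := (t - s) / (N : ℝ≥0) with hh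
  have hNh : (N : ℝ≥0) * h = t - s := by
    rw [hh, mul_div_cancel₀]
    exact_mod_cast hN0.ne'
  have hB0 : 0 ≤ B := by
    obtain ⟨ω⟩ : Nonempty Ω := nonempty_of_isProbabilityMeasure P
    exact (norm_nonneg _).trans (hB ω)
  set K := B * Real.exp (l ^ 2 * c / 2 * t) *
        ((2 * (|l| + l ^ 2 * c / 2) ^ 3 + (|l| + l ^ 2 * c / 2) ^ 2) * ε) * (c + 1) with hK
  have hK0 : 0 ≤ K := by positivity
  have hrN : s + (N : ℝ≥0) * h = t := by rw [hNh, add_tsub_cancel_of_le hst]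
  have hstep : ∀ i : ℕ, s + ((i + 1 : ℕ) : ℝ≥0) * h = (s + i * h) + h := fun i => by
    push_cast; ring
  have hle : ∀ i < N, s + ((i : ℕ) : ℝ≥0) * h ≤ t := fun i hi => by
    rw [← hrN]
    gcongr
  have main := norm_sub_le_of_forall_step (N := N) (K := K)
    (g := fun i => ∫ ω, Y ω * expStop X l (l ^ 2 * c / 2) σ (s + i * h) ω ∂P)
    (α := fun i => meanTime P σ (s + i * h)) (fun i hi => by
      rw [hstep]
      refine hQ.norm_integral_expStop_step hc hX (le_self_add) (hle i hi) hε1 hL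
        (fun ω => hosc ω _ _ ?_ ?_) ?_ (hY.mono (𝓕.mono le_self_add)) hB
      · gcongr
        exact hN.trans (min_le_left _ _)
      · exact le_self_add.trans le_self_add
      · push_cast
        have : (h : ℝ) ≤ ε := by
          have := NNReal.coe_le_coe.2 (hN.trans (min_le_right _ _))
          rwa [Real.coe_toNNReal _ hε.le] at this
        linarith)
  simp only [hrN, Nat.cast_zero, zero_mul, add_zero] at main
  refine main.trans (mul_le_mul_of_nonneg_left ?_ hK0)
  have h1 : meanTime P σ t ≤ t := by
    have : meanTime P σ t ≤ ∫ _, (t : ℝ) ∂P :=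
      integral_mono (integrable_tmin hQ.stopping t) (integrable_const _)
        fun ω => by exact_mod_cast tmin_le t (σ ω)
    simpa using this
  have h2 : 0 ≤ meanTime P σ s := integral_nonneg fun ω => NNReal.coe_nonneg _
  linarith

end Levy

section LevyTheorem

variable {Ω : Type*} [mΩ : MeasurableSpace Ω]

/-- A continuous local martingale started at `0` whose bracket is `c t`. -/
structure IsScaledBrownian (X : ℝ≥0 → Ω → ℝ) (c : ℝ) (𝓕 : Filtration ℝ≥0 mΩ) (P : Measure Ω) :
    Prop where
  adapted : ∀ t, Measurable[𝓕 t] (X t)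
  cont : ∀ ω, Continuous (X · ω)
  zero : ∀ ω, X 0 ω = 0
  localMart : IsLocalMartingale X 𝓕 P
  quad : IsLocalMartingale (fun t ω => X t ω ^ 2 - c * t) 𝓕 P

variable {P : Measure Ω} [IsProbabilityMeasure P]
  {𝓕 : Filtration ℝ≥0 mΩ} {X : ℝ≥0 → Ω → ℝ} {c : ℝ} {σ : Ω → WithTop ℝ≥0}

lemma stronglyMeasurable_stopped (hX : ∀ t, Measurable[𝓕 t] (X t)) (hc : ∀ ω, Continuous (X · ω))
    (hσ : IsStoppingTime 𝓕 σ) (t : ℝ≥0) :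
    StronglyMeasurable[𝓕 t] (fun ω => X (tmin t (σ ω)) ω) :=
  StronglyAdapted.stoppedProcess (f := 𝓕) (u := X) (fun t => (hX t).stronglyMeasurable) hc hσ t

/-- Times at distance at most `δ`. -/
def nearPairs (δ : ℝ≥0) : Set (ℝ≥0 × ℝ≥0) := {p | p.1 ≤ p.2 + δ ∧ p.2 ≤ p.1 + δ}

lemma isClosed_nearPairs (δ : ℝ≥0) : IsClosed (nearPairs δ) :=
  (isClosed_le (by fun_prop) (by fun_prop)).inter (isClosed_le (by fun_prop) (by fun_prop))

lemma min_mem_nearPairs {δ : ℝ≥0} {p : ℝ≥0 × ℝ≥0} (hp : p ∈ nearPairs δ) (s : ℝ≥0) :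
    (min p.1 s, min p.2 s) ∈ nearPairs δ := by
  obtain ⟨h1, h2⟩ := hp
  constructor
  · rw [← min_add_add_right]
    exact le_min ((min_le_left _ _).trans h1) ((min_le_right _ _).trans le_self_add)
  · rw [← min_add_add_right]
    exact le_min ((min_le_left _ _).trans h2) ((min_le_right _ _).trans le_self_add)

lemma eventually_lt_exitTime_nearPairs {x : ℝ≥0 → ℝ} (hx : Continuous x) {ε : ℝ} (hε : 0 < ε)
    (t : ℝ≥0) : ∀ᶠ n : ℕ in atTop, ¬ HasExit (nearPairs (1 / (n + 1))) ε x t := by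
  have huc := (isCompact_Icc (a := (0 : ℝ≥0)) (b := t)).uniformContinuousOn_of_continuous
    hx.continuousOn
  obtain ⟨δ, hδ, h⟩ := Metric.uniformContinuousOn_iff.1 huc ε hε
  obtain ⟨N, hN⟩ := exists_nat_one_div_lt hδ
  filter_upwards [eventually_ge_atTop N] with n hn
  rintro ⟨p, ⟨hp1, hp2⟩, h1, h2, h3⟩
  have hd : dist p.1 p.2 < δ := by
    have e1 := NNReal.coe_le_coe.2 hp1
    have e2 := NNReal.coe_le_coe.2 hp2
    push_cast at e1 e2
    have e3 : 1 / ((n : ℝ) + 1) ≤ 1 / (N + 1) := by gcongr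
    rw [NNReal.dist_eq, abs_lt]
    constructor <;> linarith
  have := h p.1 ⟨zero_le, h1⟩ p.2 ⟨zero_le, h2⟩ hd
  rw [Real.dist_eq] at this
  linarith

/-- Lévy's characterization, for the exponential martingale. -/
lemma IsScaledBrownian.integral_exp_eq (hB : IsScaledBrownian X c 𝓕 P) (hc : 0 ≤ c) {s t : ℝ≥0}
    (hst : s ≤ t) (l : ℝ) {Y : Ω → ℂ} (hY : StronglyMeasurable[𝓕 s] Y) {B : ℝ}
    (hYB : ∀ ω, ‖Y ω‖ ≤ B) :
    ∫ ω, Y ω * expStop X l (l ^ 2 * c / 2) (fun _ => ⊤) t ω ∂P =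
      ∫ ω, Y ω * expStop X l (l ^ 2 * c / 2) (fun _ => ⊤) s ω ∂P := by
  set k := l ^ 2 * c / 2 with hkdef
  have hk : 0 ≤ k := by positivity
  have hB0 : 0 ≤ B := by
    obtain ⟨ω⟩ : Nonempty Ω := nonempty_of_isProbabilityMeasure P
    exact (norm_nonneg _).trans (hYB ω)
  obtain ⟨τ, hτ, hQ⟩ := exists_localizing_quadMart hB.cont hB.zero hB.localMart hB.quad
  set K := B * Real.exp (k * t) * (2 * (|l| + k) ^ 3 + (|l| + k) ^ 2) * (c + 1) * t with hK
  have key : ∀ ε : ℝ, 0 < ε → ε ≤ 1 → (|l| + k) * ε ≤ 1 →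
      ‖(∫ ω, Y ω * expStop X l k (fun _ => ⊤) t ω ∂P) -
        ∫ ω, Y ω * expStop X l k (fun _ => ⊤) s ω ∂P‖ ≤ K * ε := by
    intro ε hε hε1 hL
    set κ : ℕ → Ω → WithTop ℝ≥0 := fun n => exitTime (nearPairs (1 / (n + 1))) ε X with hκ
    have hκst : ∀ n, IsStoppingTime 𝓕 (κ n) := fun n =>
      isStoppingTime_exitTime (isClosed_nearPairs _) ε hB.adapted hB.cont
    set σ : ℕ → Ω → WithTop ℝ≥0 := fun n ω => min (τ n ω) (κ n ω) with hσ
    have hQn : ∀ n, IsQuadMart X c 𝓕 P (σ n) := fun n => hQ n (κ n) (hκst n)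
    have hbound : ∀ n, ‖(∫ ω, Y ω * expStop X l k (σ n) t ω ∂P) -
        ∫ ω, Y ω * expStop X l k (σ n) s ω ∂P‖ ≤ K * ε := fun n => by
      refine ((hQn n).norm_integral_expStop hc
        (stronglyMeasurable_stopped hB.adapted hB.cont (hQn n).stopping) hst
        (δ := 1 / (n + 1)) (by positivity) hε hε1 hL (fun ω a b hab hba =>
          abs_sub_le_of_exitTime (isClosed_nearPairs _) hε
            (fun p hp s => min_mem_nearPairs hp s) (hB.cont ω) (min_le_right _ _)
            (p := (a, b)) ⟨hab, hba⟩) hY hYB).trans (le_of_eq ?_)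
      rw [hK]
      ring
    have hconv : ∀ r ≤ t, Tendsto (fun n => ∫ ω, Y ω * expStop X l k (σ n) r ω ∂P) atTop
        (𝓝 (∫ ω, Y ω * expStop X l k (fun _ => ⊤) r ω ∂P)) := by
      intro r hr
      refine tendsto_integral_of_dominated_convergence (fun _ => B * Real.exp (k * r))
        (fun n => ?_) (integrable_const _) (fun n => ae_of_all _ fun ω => ?_) ?_
      · exact ((hY.mono (𝓕.le s)).mul ((stronglyMeasurable_expStop (hQn n).stopping
          (stronglyMeasurable_stopped hB.adapted hB.cont (hQn n).stopping) l k r).mono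
          (𝓕.le r))).aestronglyMeasurable
      · rw [norm_mul]
        exact mul_le_mul (hYB ω) (norm_expStop_le hk l r ω) (norm_nonneg _) hB0
      · filter_upwards [hτ] with ω hω
        have h1 : ∀ᶠ n in atTop, (r : WithTop ℝ≥0) < τ n ω :=
          hω.eventually_const_lt (WithTop.coe_lt_top r)
        have h2 := eventually_lt_exitTime_nearPairs (hB.cont ω) hε r
        refine tendsto_const_nhds.congr' ?_
        filter_upwards [h1, h2] with n hn1 hn2
        have h3 : (r : WithTop ℝ≥0) < κ n ω := not_le.1 fun h =>
          hn2 ((exitTime_le_iff (isClosed_nearPairs _) ε (hB.cont ω) r).1 h)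
        have h4 : tmin r (σ n ω) = r := tmin_of_le (le_min hn1.le h3.le)
        rw [expStop, expStop, h4, tmin_top]
    exact le_of_tendsto ((hconv t le_rfl).sub (hconv s hst)).norm (Eventually.of_forall hbound)
  have hlim : Tendsto (fun ε : ℝ => K * ε) (𝓝[>] 0) (𝓝 0) := by
    have : Tendsto (fun ε : ℝ => K * ε) (𝓝 0) (𝓝 (K * 0)) := (continuous_const_mul K).tendsto 0
    rw [mul_zero] at this
    exact this.mono_left nhdsWithin_le_nhds
  have h0 : ‖(∫ ω, Y ω * expStop X l k (fun _ => ⊤) t ω ∂P) -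
        ∫ ω, Y ω * expStop X l k (fun _ => ⊤) s ω ∂P‖ ≤ 0 := by
    refine ge_of_tendsto hlim ?_
    have hL : Tendsto (fun ε : ℝ => (|l| + k) * ε) (𝓝[>] 0) (𝓝 0) := by
      have : Tendsto (fun ε : ℝ => (|l| + k) * ε) (𝓝 0) (𝓝 ((|l| + k) * 0)) :=
        (continuous_const_mul _).tendsto 0
      rw [mul_zero] at this
      exact this.mono_left nhdsWithin_le_nhds
    filter_upwards [self_mem_nhdsWithin, hL.eventually_le_const zero_lt_one,
      nhdsWithin_le_nhds (eventually_le_nhds zero_lt_one)] with ε h1 h2 h3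
    exact key ε h1 h3 h2
  exact sub_eq_zero.1 (norm_le_zero_iff.1 h0)

/-- Lévy's characterization: increments are Gaussian and independent of the past. -/
theorem IsScaledBrownian.integral_exp_increment (hB : IsScaledBrownian X c 𝓕 P) (hc : 0 ≤ c)
    {s t : ℝ≥0} (hst : s ≤ t) (l : ℝ) {Y : Ω → ℂ} (hY : StronglyMeasurable[𝓕 s] Y) {B : ℝ}
    (hYB : ∀ ω, ‖Y ω‖ ≤ B) :
    ∫ ω, Y ω * Complex.exp (Complex.I * (l * (X t ω - X s ω))) ∂P =
      Complex.exp (-(l ^ 2 * c / 2 * (t - s))) * ∫ ω, Y ω ∂P := by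
  set k := l ^ 2 * c / 2 with hkdef
  have hXs : StronglyMeasurable[𝓕 s] fun ω => Complex.exp (-(Complex.I * (l * X s ω) + k * s)) := by
    have hcont : Continuous fun x : ℝ => Complex.exp (-(Complex.I * (l * x) + k * s)) := by fun_prop
    exact hcont.comp_stronglyMeasurable (hB.adapted s).stronglyMeasurable
  have hnorm : ∀ ω, ‖Y ω * Complex.exp (-(Complex.I * (l * X s ω) + k * s))‖ ≤
      B * Real.exp (-(k * s)) := fun ω => by
    rw [norm_mul, Complex.norm_exp]
    have : (-(Complex.I * (l * X s ω) + k * s) : ℂ).re = -(k * s) := by simp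
    rw [this]
    exact mul_le_mul_of_nonneg_right (hYB ω) (Real.exp_pos _).le
  have h := hB.integral_exp_eq hc hst l (hY.mul hXs) hnorm
  have h1 : ∀ ω, Y ω * Complex.exp (-(Complex.I * (l * X s ω) + k * s)) *
      expStop X l k (fun _ => ⊤) s ω = Y ω := fun ω => by
    rw [expStop, tmin_top, mul_assoc, ← Complex.exp_add]
    simp
  have h2 : ∀ ω, Y ω * Complex.exp (-(Complex.I * (l * X s ω) + k * s)) *
      expStop X l k (fun _ => ⊤) t ω = Complex.exp (k * (t - s)) *
        (Y ω * Complex.exp (Complex.I * (l * (X t ω - X s ω)))) := fun ω => by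
    rw [expStop, tmin_top, mul_assoc, ← Complex.exp_add, mul_left_comm (Complex.exp (k * (t - s))), ← Complex.exp_add]
    congr 2
    ring
  simp only [Pi.mul_apply, ← hkdef, h1, h2] at h
  rw [integral_const_mul] at h
  rw [← h, ← mul_assoc, ← Complex.exp_add, hkdef]
  push_cast
  simp

/-- Doob's inequality for a process with bracket `c t`. -/
lemma IsScaledBrownian.measure_exists_ge_le (hB : IsScaledBrownian X c 𝓕 P) (hc : 0 ≤ c) {ε : ℝ}
    (hε : 0 < ε) (t : ℝ≥0) :
    P {ω | ∃ r ≤ t, ε ≤ |X r ω|} ≤ ENNReal.ofReal (c * t / ε ^ 2) := by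
  obtain ⟨τ, hτ, hQ⟩ := exists_localizing_quadMart hB.cont hB.zero hB.localMart hB.quad
  set K : Set (ℝ≥0 × ℝ≥0) := {p | p.2 = 0}
  have hK : IsClosed K := isClosed_eq continuous_snd continuous_const
  set κ := exitTime K ε X with hκ
  have hκst : IsStoppingTime 𝓕 κ := isStoppingTime_exitTime hK ε hB.adapted hB.cont
  have hexit : ∀ ω r, HasExit K ε (X · ω) r ↔ ∃ q ≤ r, ε ≤ |X q ω| := fun ω r => by
    constructor
    · rintro ⟨p, hp, h1, -, h3⟩
      have hp2 : p.2 = 0 := hp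
      exact ⟨p.1, h1, by simpa [hp2, hB.zero] using h3⟩
    · rintro ⟨q, hq, h⟩
      exact ⟨(q, 0), rfl, hq, zero_le, by simpa [hB.zero] using h⟩
  have hval : ∀ ω, κ ω ≤ t → ε ≤ |X (tmin t (κ ω)) ω| := fun ω h => by
    obtain ⟨a, ha⟩ := WithTop.ne_top_iff_exists.1 (h.trans_lt (WithTop.coe_lt_top t)).ne
    rw [← ha] at h
    rw [← ha, tmin_coe, min_eq_right (WithTop.coe_le_coe.1 h)]
    obtain ⟨q, hq, hq'⟩ := (hexit ω a).1 ((exitTime_le_iff hK ε (hB.cont ω) a).1 ha.ge)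
    have : a ≤ q := WithTop.coe_le_coe.1 (ha.trans_le
      ((exitTime_le_iff hK ε (hB.cont ω) q).2 ((hexit ω q).2 ⟨q, le_rfl, hq'⟩)))
    rwa [le_antisymm this hq]
  have hbound : ∀ n, P {ω | κ ω ≤ t ∧ (t : WithTop ℝ≥0) ≤ τ n ω} ≤ ENNReal.ofReal (c * t / ε ^ 2) := by
    intro n
    have hq := hQ n κ hκst
    set σ : Ω → WithTop ℝ≥0 := fun ω => min (τ n ω) (κ ω) with hσ
    have hsq := (hq.memLp t).integrable_sq
    have hti := integrable_tmin (P := P) hq.stopping t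
    have hE : ∫ ω, X (tmin t (σ ω)) ω ^ 2 ∂P ≤ c * t := by
      have h1 := hq.quad 0 t zero_le Set.univ MeasurableSet.univ
      have h2 : ∀ ω, tmin 0 (σ ω) = 0 := fun ω => le_antisymm (tmin_le _ _) zero_le
      simp only [Measure.restrict_univ, h2, hB.zero] at h1
      rw [integral_sub hsq (hti.const_mul c), integral_const_mul] at h1
      have h3 : ∫ ω, ((tmin t (σ ω) : ℝ≥0) : ℝ) ∂P ≤ t := by
        have : ∫ ω, ((tmin t (σ ω) : ℝ≥0) : ℝ) ∂P ≤ ∫ _, (t : ℝ) ∂P :=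
          integral_mono hti (integrable_const _) fun ω => by exact_mod_cast tmin_le t (σ ω)
        simpa using this
      have h4 := mul_le_mul_of_nonneg_left h3 hc
      simp at h1
      linarith
    have hsub : {ω | κ ω ≤ t ∧ (t : WithTop ℝ≥0) ≤ τ n ω} ⊆
        {ω | ε ^ 2 ≤ X (tmin t (σ ω)) ω ^ 2} := by
      rintro ω ⟨h1, h2⟩
      have h3 : σ ω = κ ω := min_eq_right (h1.trans h2)
      have h4 := hval ω h1
      rw [Set.mem_ofPred_eq, h3, ← sq_abs (X _ ω)]
      gcongr
    have hmk := mul_meas_ge_le_integral_of_nonneg (ae_of_all _ fun ω => sq_nonneg _) hsq (ε ^ 2)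
    have hreal : P.real {ω | ε ^ 2 ≤ X (tmin t (σ ω)) ω ^ 2} ≤ c * t / ε ^ 2 := by
      rw [le_div_iff₀ (by positivity), mul_comm]
      exact hmk.trans hE
    refine (measure_mono hsub).trans ?_
    rw [← ofReal_measureReal]
    exact ENNReal.ofReal_le_ofReal hreal
  set f : ℕ → Set Ω := fun n => {ω | κ ω ≤ t ∧ (t : WithTop ℝ≥0) ≤ τ n ω} with hf
  have hsub : {ω | ∃ r ≤ t, ε ≤ |X r ω|} ≤ᵐ[P] (⋃ n, ⋂ m ≥ n, f m : Set Ω) := by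
    filter_upwards [hτ] with ω hω h
    have h1 : ∀ᶠ n in atTop, (t : WithTop ℝ≥0) < τ n ω :=
      hω.eventually_const_lt (WithTop.coe_lt_top t)
    have h2 : κ ω ≤ t := (exitTime_le_iff hK ε (hB.cont ω) t).2 ((hexit ω t).2 h)
    obtain ⟨N, hN⟩ := eventually_atTop.1 h1
    exact Set.mem_iUnion.2 ⟨N, Set.mem_iInter₂.2 fun m hm => ⟨h2, (hN m hm).le⟩⟩
  have hmono : Monotone fun n => ⋂ m ≥ n, f m := fun a b hab =>
    Set.biInter_mono (fun m hm => hab.trans hm) fun _ _ => subset_rfl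
  refine (measure_mono_ae hsub).trans ?_
  rw [hmono.measure_iUnion]
  exact iSup_le fun n => (measure_mono (Set.iInter₂_subset n le_rfl)).trans (hbound n)

end LevyTheorem

namespace TestFn

open scoped ContDiff

@[ext] lemma ext {φ ψ : TestFn} (h : ∀ x, φ x = ψ x) : φ = ψ := Subtype.ext (funext h)

@[simp] lemma add_apply (φ ψ : TestFn) (x : Plane) : (φ + ψ) x = φ x + ψ x := rfl
@[simp] lemma smul_apply (c : ℝ) (φ : TestFn) (x : Plane) : (c • φ) x = c * φ x := rfl
/-- Evaluation at a point. -/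
def evalₗ (x : Plane) : TestFn →ₗ[ℝ] ℝ where
  toFun φ := φ x
  map_add' _ _ := rfl
  map_smul' _ _ := rfl

@[simp] lemma sum_apply {ι : Type*} (s : Finset ι) (f : ι → TestFn) (x : Plane) :
    (∑ i ∈ s, f i : TestFn) x = ∑ i ∈ s, f i x := map_sum (evalₗ x) f s

lemma differentiable (φ : TestFn) : Differentiable ℝ φ := φ.smooth.differentiable (by simp)

lemma continuous (φ : TestFn) : Continuous φ := φ.smooth.continuous

/-- The derivative in direction `v`. -/
def deriv (v : Plane) : TestFn →ₗ[ℝ] TestFn where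
  toFun φ := ⟨fun x => fderiv ℝ φ x v,
    (φ.smooth.fderiv_right (m := ∞) (by exact_mod_cast le_top)).clm_apply contDiff_const,
    fun k x => by simp only [φ.periodic.fderiv k x]⟩
  map_add' φ ψ := by
    ext x
    change fderiv ℝ (φ.toFun + ψ.toFun) x v = fderiv ℝ φ x v + fderiv ℝ ψ x v
    rw [fderiv_add (φ.differentiable x) (ψ.differentiable x)]
    rfl
  map_smul' c φ := by
    ext x
    change fderiv ℝ (c • φ.toFun) x v = c * fderiv ℝ φ x v
    rw [fderiv_const_smul (φ.differentiable x)]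
    rfl

lemma deriv_apply (v : Plane) (φ : TestFn) (x : Plane) : deriv v φ x = fderiv ℝ φ x v := rfl

/-- Coordinate vectors. -/
abbrev e (i : Fin 2) : Plane := EuclideanSpace.basisFun (Fin 2) ℝ i

lemma fderiv_deriv (v : Plane) (φ : TestFn) (x w : Plane) :
    fderiv ℝ (deriv v φ) x w = fderiv ℝ (fderiv ℝ φ) x w v := by
  have h : DifferentiableAt ℝ (fderiv ℝ φ) x :=
    ((φ.smooth.fderiv_right (m := ∞) (by exact_mod_cast le_top)).differentiable (by simp)) x
  have h2 : HasFDerivAt (fun y => fderiv ℝ φ y v)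
      ((ContinuousLinearMap.apply ℝ ℝ v).comp (fderiv ℝ (fderiv ℝ φ) x)) x :=
    (ContinuousLinearMap.apply ℝ ℝ v).hasFDerivAt.comp x h.hasFDerivAt
  have h3 : fderiv ℝ (deriv v φ) x = _ := h2.fderiv
  rw [h3]
  rfl

lemma deriv_comm (v w : Plane) (φ : TestFn) : deriv v (deriv w φ) = deriv w (deriv v φ) := by
  ext x
  rw [deriv_apply, deriv_apply, fderiv_deriv, fderiv_deriv]
  refine (φ.smooth.contDiffAt (x := x)).isSymmSndFDerivAt ?_ v w
  rw [minSmoothness_of_isRCLikeNormedField]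
  exact WithTop.coe_le_coe.2 (le_top : (2 : ℕ∞) ≤ ⊤)

lemma laplacian_eq (φ : TestFn) : φ.laplacian = ∑ i, deriv (e i) (deriv (e i) φ) := by
  ext x
  rw [sum_apply]
  change Laplacian.laplacian φ.toFun x = _
  rw [InnerProductSpace.laplacian_eq_iteratedFDeriv_orthonormalBasis φ.toFun
      (EuclideanSpace.basisFun (Fin 2) ℝ)]
  refine Finset.sum_congr rfl fun i _ => ?_
  rw [iteratedFDeriv_two_apply, deriv_apply, fderiv_deriv]
  rfl

/-- The Laplacian as a linear map. -/
def lap : TestFn →ₗ[ℝ] TestFn := ∑ i, (deriv (e i)).comp (deriv (e i))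

lemma laplacian_eq_lap (φ : TestFn) : φ.laplacian = lap φ := by
  rw [laplacian_eq, lap, LinearMap.sum_apply]
  rfl

lemma deriv_lap (v : Plane) (φ : TestFn) : deriv v (lap φ) = lap (deriv v φ) := by
  simp only [lap, LinearMap.sum_apply, map_sum, LinearMap.comp_apply, deriv_comm v]

lemma withSeminorms : WithSeminorms TestFn.seminormFamily := ⟨rfl⟩

instance : IsTopologicalAddGroup TestFn := withSeminorms.topologicalAddGroup
instance : ContinuousSMul ℝ TestFn := withSeminorms.continuousSMul

lemma norm_iteratedFDeriv_le (n : ℕ) (φ : TestFn) (x : Plane) :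
    ‖iteratedFDeriv ℝ n φ x‖ ≤ seminormFamily n φ := le_ciSup (φ.bddAbove n) x

lemma abs_apply_le (φ : TestFn) (x : Plane) : |φ x| ≤ seminormFamily 0 φ := by
  have := norm_iteratedFDeriv_le 0 φ x
  rwa [norm_iteratedFDeriv_zero] at this

lemma seminorm_le (n : ℕ) (φ : TestFn) {C : ℝ} (h : ∀ x, ‖iteratedFDeriv ℝ n φ x‖ ≤ C) :
    seminormFamily n φ ≤ C := ciSup_le h

lemma seminorm_zero_le (φ : TestFn) {C : ℝ} (h : ∀ x, |φ x| ≤ C) : seminormFamily 0 φ ≤ C :=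
  seminorm_le 0 φ fun x => by rw [norm_iteratedFDeriv_zero]; exact h x

lemma seminorm_succ_le (n : ℕ) (φ : TestFn) :
    seminormFamily (n + 1) φ ≤ ∑ i, seminormFamily n (deriv (e i) φ) := by
  refine seminorm_le _ φ fun x => ?_
  have hsum : fderiv ℝ φ = fun y => ∑ i, (ContinuousLinearMap.smulRightL ℝ Plane ℝ
      (innerSL ℝ (e i))) (deriv (e i) φ y) := by
    funext y
    ext v
    rw [_root_.sum_apply]
    conv_lhs => rw [← (EuclideanSpace.basisFun (Fin 2) ℝ).sum_repr' v]
    rw [map_sum]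
    refine Finset.sum_congr rfl fun i _ => ?_
    simp [deriv_apply]
  have hnorm : ∀ i : Fin 2, ‖ContinuousLinearMap.smulRightL ℝ Plane ℝ (innerSL ℝ (e i))‖ ≤ 1 := by
    intro i
    refine ContinuousLinearMap.opNorm_le_bound _ zero_le_one fun r => ?_
    change ‖(innerSL ℝ (e i)).smulRight r‖ ≤ _
    rw [ContinuousLinearMap.norm_smulRight_apply,
      innerSL_apply_norm, (EuclideanSpace.basisFun (Fin 2) ℝ).norm_eq_one]
  have hsm : ∀ i, ContDiff ℝ n (fun y => (ContinuousLinearMap.smulRightL ℝ Plane ℝ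
      (innerSL ℝ (e i))) (deriv (e i) φ y)) := fun i =>
    (ContinuousLinearMap.contDiff _).comp ((deriv (e i) φ).smooth.of_le (by exact_mod_cast le_top))
  rw [← norm_iteratedFDeriv_fderiv, hsum, iteratedFDeriv_fun_sum_apply
    (fun i _ => (hsm i).contDiffAt)]
  refine (norm_sum_le _ _).trans (Finset.sum_le_sum fun i _ => ?_)
  have h1 := ContinuousLinearMap.norm_iteratedFDeriv_comp_left
    (ContinuousLinearMap.smulRightL ℝ Plane ℝ (innerSL ℝ (e i)))
    (((deriv (e i) φ).smooth.of_le (m := n) (by exact_mod_cast le_top)).contDiffAt (x := x)) le_rfl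
  refine h1.trans ?_
  calc _ ≤ 1 * ‖iteratedFDeriv ℝ n (deriv (e i) φ) x‖ := by gcongr; exact hnorm i
    _ ≤ _ := by rw [one_mul]; exact norm_iteratedFDeriv_le n _ x

/-- Operators commuting with derivatives inherit their sup-norm bounds in every seminorm. -/
lemma seminorm_le_of_commute {α : Type*} (T : α → TestFn → TestFn) (ε : α → ℝ)
    (hT : ∀ a i φ, deriv (e i) (T a φ) = T a (deriv (e i) φ))
    (h0 : ∀ φ, ∃ C, ∀ a x, |T a φ x| ≤ C * ε a) (n : ℕ) :
    ∀ φ, ∃ C, ∀ a, seminormFamily n (T a φ) ≤ C * ε a := by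
  induction n with
  | zero =>
    intro φ
    obtain ⟨C, hC⟩ := h0 φ
    exact ⟨C, fun a => seminorm_zero_le _ (hC a)⟩
  | succ n ih =>
    intro φ
    choose C hC using fun i => ih (deriv (e i) φ)
    refine ⟨∑ i, C i, fun a => (seminorm_succ_le n _).trans ?_⟩
    rw [Finset.sum_mul]
    refine Finset.sum_le_sum fun i _ => ?_
    rw [hT]
    exact hC i a

/-- A distribution is bounded by finitely many seminorms. -/
lemma exists_bound_distr (z : Distr) : ∃ (s : Finset ℕ) (C : ℝ≥0), ∀ φ : TestFn,
    |z φ| ≤ C * ∑ n ∈ s, seminormFamily n φ := by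
  obtain ⟨s, C, -, hC⟩ := Seminorm.bound_of_continuous withSeminorms
    ((normSeminorm ℝ ℝ).comp (z : TestFn →L[ℝ] ℝ).toLinearMap)
    (by
      change Continuous fun φ => ‖z φ‖
      exact (ContinuousLinearMap.continuous (z : TestFn →L[ℝ] ℝ)).norm)
  refine ⟨s, C, fun φ => (hC φ).trans ?_⟩
  change (C : ℝ) * (s.sup seminormFamily) φ ≤ _
  gcongr
  refine Seminorm.finset_sup_apply_le (Finset.sum_nonneg fun n _ => apply_nonneg _ _) fun n hn => ?_
  exact Finset.single_le_sum (f := fun n => seminormFamily n φ) (fun n _ => apply_nonneg _ _) hn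

lemma distr_le_of_commute {α : Type*} (T : α → TestFn → TestFn) (ε : α → ℝ)
    (hT : ∀ a i φ, deriv (e i) (T a φ) = T a (deriv (e i) φ))
    (h0 : ∀ φ, ∃ C, ∀ a x, |T a φ x| ≤ C * ε a) (z : Distr) (φ : TestFn) :
    ∃ C, ∀ a, |z (T a φ)| ≤ C * ε a := by
  obtain ⟨s, C, hC⟩ := exists_bound_distr z
  choose K hK using fun n => seminorm_le_of_commute T ε hT h0 n φ
  refine ⟨C * ∑ n ∈ s, K n, fun a => (hC _).trans ?_⟩
  rw [mul_assoc, Finset.sum_mul]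
  gcongr with n hn
  exact hK n a

/-! ### The heat semigroup -/

lemma heat_apply (t : ℝ≥0) (φ : TestFn) (x : Plane) :
    heat t φ x = ∫ y, φ (x + Real.sqrt (2 * t) • y) ∂(stdGaussian Plane) := rfl

lemma integrable_comp_translate {α : Type*} [MeasurableSpace α] {μ : Measure α} [IsFiniteMeasure μ]
    (φ : TestFn) {f : α → Plane} (hf : Measurable f) : Integrable (fun y => φ (f y)) μ :=
  Integrable.of_bound ((φ.continuous.measurable.comp hf).aestronglyMeasurable) _
    (ae_of_all _ fun y => abs_apply_le φ (f y))

/-- The heat semigroup as a family of linear maps. -/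
def heatₗ (t : ℝ≥0) : TestFn →ₗ[ℝ] TestFn where
  toFun := heat t
  map_add' φ ψ := by
    ext x
    exact integral_add (φ.integrable_comp_translate (by fun_prop))
      (ψ.integrable_comp_translate (by fun_prop))
  map_smul' c φ := by
    ext x
    exact integral_const_mul _ _

lemma heat_eq (t : ℝ≥0) (φ : TestFn) : heat t φ = heatₗ t φ := rfl

lemma heat_zero (φ : TestFn) : heat 0 φ = φ := by
  ext x
  simp [heat_apply]

lemma abs_heat_le {φ : TestFn} {C : ℝ} (h : ∀ x, |φ x| ≤ C) (t : ℝ≥0) (x : Plane) :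
    |heat t φ x| ≤ C := by
  have := norm_integral_le_of_norm_le_const (μ := stdGaussian Plane)
    (f := fun y => φ (x + Real.sqrt (2 * t) • y)) (ae_of_all _ fun y => h _)
  rw [heat_apply]
  simpa only [Real.norm_eq_abs, probReal_univ, mul_one] using this

lemma heat_deriv (t : ℝ≥0) (v : Plane) (φ : TestFn) : deriv v (heat t φ) = heat t (deriv v φ) := by
  ext x
  obtain ⟨C₀, hC₀⟩ := φ.periodic.exists_bound φ.continuous
  have hf' : ContDiff ℝ ∞ (fderiv ℝ φ) := φ.smooth.fderiv_right (by exact_mod_cast le_top)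
  obtain ⟨C, hC⟩ := φ.periodic.fderiv.exists_bound hf'.continuous
  have hd : HasFDerivAt (fun x => ∫ y, φ (x + Real.sqrt (2 * t) • y) ∂(stdGaussian Plane))
      (∫ y, fderiv ℝ φ (x + Real.sqrt (2 * t) • y) ∂(stdGaussian Plane)) x := by
    refine hasFDerivAt_integral_of_dominated_of_fderiv_le (bound := fun _ => C)
      (F' := fun x y => fderiv ℝ φ (x + Real.sqrt (2 * t) • y)) Filter.univ_mem ?_ ?_ ?_ ?_
      (integrable_const _) ?_
    · exact Eventually.of_forall fun x =>
        (φ.continuous.comp (by fun_prop)).aestronglyMeasurable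
    · exact φ.integrable_comp_translate (by fun_prop)
    · exact (hf'.continuous.comp (by fun_prop)).aestronglyMeasurable
    · exact ae_of_all _ fun y x _ => hC _
    · exact ae_of_all _ fun y x _ =>
        (hasFDerivAt_comp_add_right _).2 (φ.differentiable _).hasFDerivAt
  have hint : Integrable (fun y => fderiv ℝ φ (x + Real.sqrt (2 * t) • y)) (stdGaussian Plane) :=
    Integrable.of_bound (hf'.continuous.comp (by fun_prop)).aestronglyMeasurable C
      (ae_of_all _ fun y => hC _)
  rw [deriv_apply, heat_apply]
  have : fderiv ℝ (heat t φ) x = _ := hd.fderiv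
  rw [this, ContinuousLinearMap.integral_apply hint]
  rfl

lemma heat_lap (t : ℝ≥0) (φ : TestFn) : lap (heat t φ) = heat t (lap φ) := by
  simp only [heat_eq, lap, LinearMap.sum_apply, map_sum, LinearMap.comp_apply]
  simp only [← heat_eq, heat_deriv]

lemma conv_scaled_stdGaussian (a b : ℝ≥0) :
    ((stdGaussian Plane).map (Real.sqrt (2 * a) • ·)) ∗ ((stdGaussian Plane).map (Real.sqrt (2 * b) • ·))
      = (stdGaussian Plane).map (Real.sqrt (2 * (a + b : ℝ≥0)) • ·) := by
  have h : ∀ c : ℝ, IsProbabilityMeasure ((stdGaussian Plane).map (c • ·)) := fun c =>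
    Measure.isProbabilityMeasure_map (by fun_prop)
  refine Measure.ext_of_charFun ?_
  ext v
  rw [charFun_conv, charFun_map_smul, charFun_map_smul, charFun_map_smul, charFun_stdGaussian,
    charFun_stdGaussian, charFun_stdGaussian, ← Complex.exp_add]
  congr 1
  simp only [norm_smul, Real.norm_eq_abs, Complex.ofReal_mul, mul_pow, ← Complex.ofReal_pow, sq_abs]
  rw [Real.sq_sqrt (by positivity), Real.sq_sqrt (by positivity), Real.sq_sqrt (by positivity)]
  push_cast
  ring

lemma heat_heat (a b : ℝ≥0) (φ : TestFn) : heat a (heat b φ) = heat (a + b) φ := by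
  have h : ∀ c : ℝ, IsProbabilityMeasure ((stdGaussian Plane).map (c • ·)) := fun c =>
    Measure.isProbabilityMeasure_map (by fun_prop)
  ext x
  have hm : ∀ c : ℝ, AEMeasurable (fun y : Plane => c • y) (stdGaussian Plane) := fun c => by fun_prop
  have hx : ∀ x : Plane, Continuous fun y => φ (x + y) := fun x => φ.continuous.comp (by fun_prop)
  have hc : heat (a + b) φ x = ∫ y, φ (x + y) ∂((stdGaussian Plane).map
      (Real.sqrt (2 * (a + b : ℝ≥0)) • ·)) := by
    rw [integral_map (hm _) (hx x).aestronglyMeasurable]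
    rfl
  rw [hc, ← conv_scaled_stdGaussian, integral_conv (φ.integrable_comp_translate (by fun_prop))]
  have hi : ∀ z, ∫ y, φ (x + (z + y)) ∂((stdGaussian Plane).map (Real.sqrt (2 * b) • ·))
      = heat b φ (x + z) := fun z => by
    have hc : Continuous fun y : Plane => φ (x + (z + y)) := φ.continuous.comp (by fun_prop)
    rw [integral_map (hm _) hc.aestronglyMeasurable, heat_apply]
    simp only [add_assoc]
  simp_rw [hi]
  have hc2 : Continuous fun y : Plane => heat b φ (x + y) :=
    (heat b φ).continuous.comp (by fun_prop)
  rw [integral_map (hm _) hc2.aestronglyMeasurable]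
  rfl

/-! ### Taylor expansions -/

lemma hasDerivAt_line (φ : TestFn) (x v : Plane) (s : ℝ) :
    HasDerivAt (fun s : ℝ => φ (x + s • v)) (deriv v φ (x + s • v)) s := by
  have h1 : HasDerivAt (fun s : ℝ => x + s • v) v s := by
    simpa using ((hasDerivAt_id s).smul_const v).const_add x
  exact (φ.differentiable (x + s • v)).hasFDerivAt.comp_hasDerivAt s h1

lemma abs_image_sub_le {f f' : ℝ → ℝ} {C : ℝ} (hf : ∀ s, HasDerivAt f (f' s) s)
    (hC : ∀ s ∈ Set.Icc (0 : ℝ) 1, |f' s| ≤ C) : |f 1 - f 0| ≤ C := by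
  have := norm_image_sub_le_of_norm_deriv_le_segment' (f := f) (f' := f') (a := 0) (b := 1) (C := C)
    (fun s _ => (hf s).hasDerivWithinAt) (fun s hs => hC s ⟨hs.1, hs.2.le⟩) 1 (by simp)
  simpa using this

lemma abs_sub_le_of_deriv (φ : TestFn) (v : Plane) {C : ℝ} (h : ∀ x, |deriv v φ x| ≤ C)
    (x : Plane) : |φ (x + v) - φ x| ≤ C := by
  have := abs_image_sub_le (φ.hasDerivAt_line x v) (fun s _ => h _)
  simpa using this

lemma deriv_smul (c : ℝ) (v : Plane) (φ : TestFn) : deriv (c • v) φ = c • deriv v φ := by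
  ext x
  simp [deriv_apply]

lemma abs_taylor_one_le (φ : TestFn) (v : Plane) {C : ℝ} (h : ∀ x, |deriv v (deriv v φ) x| ≤ C)
    (x : Plane) : |φ (x + v) - φ x - deriv v φ x| ≤ C := by
  have hC : 0 ≤ C := (abs_nonneg _).trans (h x)
  have := abs_image_sub_le (f := fun s => φ (x + s • v) - s * deriv v φ x)
    (f' := fun s => deriv v φ (x + s • v) - 1 * deriv v φ x) (C := C)
    (fun s => (φ.hasDerivAt_line x v s).sub ((hasDerivAt_id s).mul_const _)) (fun s hs => by
      rw [one_mul]
      refine abs_sub_le_of_deriv (deriv v φ) (s • v) (fun y => ?_) x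
      rw [deriv_smul, smul_apply, abs_mul, abs_of_nonneg hs.1]
      exact (mul_le_mul hs.2 (h y) (abs_nonneg _) zero_le_one).trans (by rw [one_mul]))
  have h2 : φ (x + v) - φ x - deriv v φ x
    = φ (x + (1 : ℝ) • v) - 1 * deriv v φ x - (φ (x + (0 : ℝ) • v) - 0 * deriv v φ x) := by
    simp; ring
  rw [h2]
  exact this

lemma abs_taylor_two_le (φ : TestFn) (v : Plane) {C : ℝ}
    (h : ∀ x, |deriv v (deriv v (deriv v φ)) x| ≤ C) (x : Plane) :
    |φ (x + v) - φ x - deriv v φ x - deriv v (deriv v φ) x / 2| ≤ C := by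
  have hC : 0 ≤ C := (abs_nonneg _).trans (h x)
  have := abs_image_sub_le
    (f := fun s => φ (x + s • v) - s * deriv v φ x - s ^ 2 / 2 * deriv v (deriv v φ) x)
    (f' := fun s => deriv v φ (x + s • v) - deriv v φ x - s * deriv v (deriv v φ) x) (C := C)
    (fun s => by
      have h3 : HasDerivAt (fun s : ℝ => s ^ 2 / 2) s s := by
        simpa using ((hasDerivAt_id s).pow 2).div_const 2
      have := ((φ.hasDerivAt_line x v s).sub ((hasDerivAt_id s).mul_const (deriv v φ x))).sub
        (h3.mul_const (deriv v (deriv v φ) x))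
      rw [one_mul] at this
      exact this) (fun s hs => by
      have := abs_taylor_one_le (deriv v φ) (s • v) (C := C) (fun y => by
        rw [deriv_smul, deriv_smul, map_smul, smul_apply, smul_apply, ← mul_assoc, abs_mul, abs_of_nonneg (by nlinarith [hs.1])]
        calc _ ≤ 1 * C := mul_le_mul (by nlinarith [hs.1, hs.2]) (h y) (abs_nonneg _) zero_le_one
          _ = C := one_mul _) x
      rwa [deriv_smul, smul_apply] at this)
  have h2 : φ (x + v) - φ x - deriv v φ x - deriv v (deriv v φ) x / 2
    = φ (x + (1 : ℝ) • v) - 1 * deriv v φ x - 1 ^ 2 / 2 * deriv v (deriv v φ) x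
      - (φ (x + (0 : ℝ) • v) - 0 * deriv v φ x - 0 ^ 2 / 2 * deriv v (deriv v φ) x) := by
    simp; ring
  rw [h2]
  exact this

lemma deriv_eq_sum (v : Plane) (φ : TestFn) : deriv v φ = ∑ i, v i • deriv (e i) φ := by
  ext x
  rw [sum_apply, deriv_apply]
  conv_lhs => rw [← (EuclideanSpace.basisFun (Fin 2) ℝ).sum_repr v]
  rw [map_sum]
  refine Finset.sum_congr rfl fun i _ => ?_
  simp [deriv_apply]

lemma exists_bound_deriv_iterate (n : ℕ) : ∀ φ : TestFn, ∃ C, 0 ≤ C ∧ ∀ v x,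
    |(deriv v)^[n] φ x| ≤ C * ‖v‖ ^ n := by
  induction n with
  | zero =>
    intro φ
    exact ⟨seminormFamily 0 φ, apply_nonneg _ _, fun v x => by simpa using abs_apply_le φ x⟩
  | succ n ih =>
    intro φ
    choose C h0 hC using fun i => ih (deriv (e i) φ)
    refine ⟨∑ i, C i, Finset.sum_nonneg fun i _ => h0 i, fun v x => ?_⟩
    rw [Function.iterate_succ_apply, deriv_eq_sum v φ, ← Module.End.pow_apply, map_sum, sum_apply,
      Finset.sum_mul]
    refine (Finset.abs_sum_le_sum_abs _ _).trans (Finset.sum_le_sum fun i _ => ?_)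
    rw [map_smul, smul_apply, abs_mul, Module.End.pow_apply, pow_succ, ← mul_assoc, mul_comm]
    refine mul_le_mul (hC i v x) (PiLp.norm_apply_le v i) (abs_nonneg _) ?_
    exact mul_nonneg (h0 i) (by positivity)

/-! ### Time regularity of the heat semigroup -/

lemma integrable_norm_pow (n : ℕ) : Integrable (fun y : Plane => ‖y‖ ^ n) (stdGaussian Plane) := by
  have h := (IsGaussian.memLp_id (stdGaussian Plane) (n : ℝ≥0∞) (by simp)).integrable_norm_pow'
  simpa using h

lemma exists_abs_heat_sub_le (φ : TestFn) : ∃ C, ∀ (p : ℝ≥0 × ℝ≥0) (x : Plane),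
    |heat p.1 φ x - heat p.2 φ x| ≤ C * |Real.sqrt (2 * p.1) - Real.sqrt (2 * p.2)| := by
  obtain ⟨C, h0, hC⟩ := exists_bound_deriv_iterate 1 φ
  refine ⟨C * ∫ y, ‖y‖ ^ 1 ∂(stdGaussian Plane), fun p x => ?_⟩
  rw [heat_apply, heat_apply, ← integral_sub (φ.integrable_comp_translate (by fun_prop))
    (φ.integrable_comp_translate (by fun_prop)), mul_right_comm, ← integral_const_mul]
  rw [← Real.norm_eq_abs]
  refine norm_integral_le_of_norm_le ((integrable_norm_pow 1).const_mul _) (ae_of_all _ fun y => ?_)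
  set a := Real.sqrt (2 * p.1)
  set b := Real.sqrt (2 * p.2)
  have := abs_sub_le_of_deriv φ ((a - b) • y) (hC _) (x + b • y)
  rw [add_assoc, ← add_smul, add_sub_cancel] at this
  refine this.trans (le_of_eq ?_)
  rw [norm_smul, Real.norm_eq_abs]
  ring

lemma integral_coord (i : Fin 2) : ∫ y : Plane, y i ∂(stdGaussian Plane) = 0 :=
  integral_strongDual_stdGaussian (EuclideanSpace.proj i)

lemma integral_coord_mul (i j : Fin 2) :
    ∫ y : Plane, y i * y j ∂(stdGaussian Plane) = if i = j then 1 else 0 := by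
  have h := covarianceBilin_apply (IsGaussian.memLp_two_id (μ := stdGaussian Plane)) (e i) (e j)
  rw [covarianceBilin_stdGaussian] at h
  simp only [id, integral_id_stdGaussian, sub_zero] at h
  have hin : ∀ (i : Fin 2) (y : Plane), inner ℝ (e i) y = y i := fun i y =>
    EuclideanSpace.basisFun_inner _ _ y i
  simp only [hin] at h
  rw [← h]
  change inner ℝ (e i) (e j) = _
  exact (EuclideanSpace.basisFun (Fin 2) ℝ).inner_eq_ite i j

lemma integrable_coord (i : Fin 2) : Integrable (fun y : Plane => y i) (stdGaussian Plane) :=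
  (integrable_norm_pow 1).mono' (by fun_prop) (ae_of_all _ fun y => by
    simpa using PiLp.norm_apply_le y i)

lemma integrable_coord_mul (i j : Fin 2) :
    Integrable (fun y : Plane => y i * y j) (stdGaussian Plane) :=
  (integrable_norm_pow 2).mono' (by fun_prop) (ae_of_all _ fun y => by
    rw [norm_mul, sq]
    exact mul_le_mul (PiLp.norm_apply_le y i) (PiLp.norm_apply_le y j) (norm_nonneg _)
      (norm_nonneg _))

lemma exists_abs_heat_taylor_le (φ : TestFn) : ∃ C, ∀ (h : ℝ≥0) (x : Plane),
    |heat h φ x - φ x - h * lap φ x| ≤ C * Real.sqrt (2 * h) ^ 3 := by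
  obtain ⟨C, h0, hC⟩ := exists_bound_deriv_iterate 3 φ
  refine ⟨C * ∫ y, ‖y‖ ^ 3 ∂(stdGaussian Plane), fun h x => ?_⟩
  set c := Real.sqrt (2 * h) with hc
  have hcc : c ^ 2 = 2 * h := Real.sq_sqrt (by positivity)
  have hd1 : ∀ y : Plane, deriv (c • y) φ x = ∑ i, y i * (c * deriv (e i) φ x) := fun y => by
    rw [deriv_eq_sum, sum_apply]
    refine Finset.sum_congr rfl fun i _ => ?_
    simp; ring
  have hd2 : ∀ y : Plane, deriv (c • y) (deriv (c • y) φ) x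
      = ∑ i, ∑ j, (y i * y j) * (2 * h * deriv (e i) (deriv (e j) φ) x) := fun y => by
    rw [deriv_eq_sum, sum_apply]
    refine Finset.sum_congr rfl fun i _ => ?_
    rw [deriv_eq_sum _ φ, map_sum, smul_apply, sum_apply, Finset.mul_sum]
    refine Finset.sum_congr rfl fun j _ => ?_
    simp [← hcc]; ring
  have i1 : Integrable (fun y : Plane => deriv (c • y) φ x) (stdGaussian Plane) := by
    simp_rw [hd1]
    exact integrable_finsetSum _ fun i _ => (integrable_coord i).mul_const _
  have i2 : Integrable (fun y : Plane => deriv (c • y) (deriv (c • y) φ) x) (stdGaussian Plane) := by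
    simp_rw [hd2]
    exact integrable_finsetSum _ fun i _ => integrable_finsetSum _ fun j _ =>
      (integrable_coord_mul i j).mul_const _
  have e1 : ∫ y : Plane, deriv (c • y) φ x ∂(stdGaussian Plane) = 0 := by
    simp_rw [hd1]
    rw [integral_finsetSum _ fun i _ => (integrable_coord i).mul_const _]
    simp_rw [integral_mul_const, integral_coord]
    simp
  have e2 : ∫ y : Plane, deriv (c • y) (deriv (c • y) φ) x ∂(stdGaussian Plane)
      = 2 * h * lap φ x := by
    simp_rw [hd2]
    rw [integral_finsetSum _ fun i _ => integrable_finsetSum _ fun j _ =>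
      (integrable_coord_mul i j).mul_const _]
    simp_rw [fun i => integral_finsetSum Finset.univ fun j _ =>
      (integrable_coord_mul i j).mul_const (2 * h * deriv (e i) (deriv (e j) φ) x),
      integral_mul_const, integral_coord_mul]
    simp [lap]
    ring
  have hi : Integrable (fun y => φ (x + c • y)) (stdGaussian Plane) :=
    φ.integrable_comp_translate (by fun_prop)
  have key : heat h φ x - φ x - h * lap φ x = ∫ y : Plane, (φ (x + c • y) - φ x - deriv (c • y) φ x
      - deriv (c • y) (deriv (c • y) φ) x / 2) ∂(stdGaussian Plane) := by
    have h1 : Integrable (fun y => φ (x + c • y) - φ x) (stdGaussian Plane) :=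
      hi.sub (integrable_const _)
    have h2 : Integrable (fun y => φ (x + c • y) - φ x - deriv (c • y) φ x) (stdGaussian Plane) :=
      h1.sub i1
    rw [integral_sub h2 (i2.div_const _), integral_sub h1 i1, integral_sub hi (integrable_const _),
      integral_div, e1, e2]
    have h3 : heat h φ x = ∫ y, φ (x + c • y) ∂(stdGaussian Plane) := rfl
    rw [h3, integral_const, probReal_univ, one_smul]
    ring
  rw [key, mul_right_comm, ← integral_const_mul]
  rw [← Real.norm_eq_abs]
  refine norm_integral_le_of_norm_le ((integrable_norm_pow 3).const_mul _) (ae_of_all _ fun y => ?_)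
  refine (abs_taylor_two_le φ (c • y) (hC _) x).trans (le_of_eq ?_)
  rw [norm_smul, Real.norm_eq_abs, abs_of_nonneg (Real.sqrt_nonneg _), mul_pow]
  ring

/-! ### Distributions tested against the heat flow -/

lemma continuous_distr_heat (z : Distr) (φ : TestFn) : Continuous fun r : ℝ≥0 => z (heat r φ) := by
  obtain ⟨C, hC⟩ := distr_le_of_commute (fun p : ℝ≥0 × ℝ≥0 => fun φ => heat p.1 φ - heat p.2 φ)
    (fun p => |Real.sqrt (2 * p.1) - Real.sqrt (2 * p.2)|)
    (fun p i φ => by rw [map_sub, heat_deriv, heat_deriv])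
    (fun φ => exists_abs_heat_sub_le φ) z φ
  refine continuous_iff_continuousAt.2 fun r => ?_
  refine tendsto_iff_norm_sub_tendsto_zero.2 ?_
  have h : Tendsto (fun q : ℝ≥0 => C * |Real.sqrt (2 * q) - Real.sqrt (2 * r)|) (𝓝 r) (𝓝 0) := by
    have : Continuous fun q : ℝ≥0 => C * |Real.sqrt (2 * q) - Real.sqrt (2 * r)| := by fun_prop
    simpa using this.tendsto r
  refine squeeze_zero (fun _ => norm_nonneg _) (fun q => ?_) h
  have := hC (q, r)
  rwa [map_sub] at this

lemma exists_distr_taylor (z : Distr) (φ : TestFn) : ∃ C, ∀ h : ℝ≥0,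
    |z (heat h φ) - z φ - h * z (lap φ)| ≤ C * Real.sqrt (2 * h) ^ 3 := by
  obtain ⟨C, hC⟩ := distr_le_of_commute (fun h : ℝ≥0 => fun φ => heat h φ - φ - (h : ℝ) • lap φ)
    (fun h => Real.sqrt (2 * h) ^ 3)
    (fun p i φ => by rw [map_sub, map_sub, map_smul, heat_deriv, deriv_lap])
    (fun φ => exists_abs_heat_taylor_le φ) z φ
  refine ⟨C, fun h => ?_⟩
  have := hC h
  rwa [map_sub, map_sub, map_smul, smul_eq_mul] at this

lemma hasDerivWithinAt_distr_heat (z : Distr) (φ : TestFn) (r : ℝ≥0) :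
    HasDerivWithinAt (fun q : ℝ => z (heat q.toNNReal φ)) (z (heat r (lap φ))) (Set.Ici r) r := by
  obtain ⟨C, hC⟩ := exists_distr_taylor z (heat r φ)
  rw [hasDerivWithinAt_iff_isLittleO]
  have hlim : Tendsto (fun q : ℝ => C * (2 * Real.sqrt (2 * (q - r)))) (𝓝[≥] (r : ℝ)) (𝓝 0) := by
    have : Continuous fun q : ℝ => C * (2 * Real.sqrt (2 * (q - r))) := by fun_prop
    have h2 := this.tendsto r
    simp only [sub_self, mul_zero, Real.sqrt_zero] at h2
    exact h2.mono_left nhdsWithin_le_nhds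
  refine Asymptotics.isLittleO_iff.2 fun c hc => ?_
  filter_upwards [self_mem_nhdsWithin, hlim.eventually_le_const hc] with q hq hqc
  have hq' : (r : ℝ) ≤ q := hq
  set h := (q - r).toNNReal with hh
  have hc : (h : ℝ) = q - r := Real.coe_toNNReal _ (sub_nonneg.2 hq')
  have hqe : q.toNNReal = h + r := by
    apply NNReal.coe_injective
    rw [Real.coe_toNNReal _ (r.2.trans hq'), NNReal.coe_add, hc]
    ring
  have h1 := hC h
  rw [heat_heat, heat_lap, hc] at h1
  rw [hqe, Real.toNNReal_coe, Real.norm_eq_abs, Real.norm_eq_abs, smul_eq_mul]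
  refine h1.trans ?_
  have : Real.sqrt (2 * (q - r)) ^ 3 = 2 * (q - r) * Real.sqrt (2 * (q - r)) := by
    rw [pow_succ, Real.sq_sqrt (by linarith)]
  rw [this, abs_of_nonneg (sub_nonneg.2 hq')]
  calc _ = C * (2 * Real.sqrt (2 * (q - r))) * (q - r) := by ring
    _ ≤ _ := mul_le_mul_of_nonneg_right hqc (sub_nonneg.2 hq')

lemma distr_heat_sub (z : Distr) (φ : TestFn) {a b : ℝ≥0} (hab : a ≤ b) :
    z (heat b φ) - z (heat a φ) = ∫ r in (a : ℝ)..b, z (heat r.toNNReal (lap φ)) := by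
  have hcont : ∀ φ, Continuous fun q : ℝ => z (heat q.toNNReal φ) := fun φ =>
    (continuous_distr_heat z φ).comp continuous_real_toNNReal
  have := intervalIntegral.integral_eq_sub_of_hasDeriv_right (a := (a : ℝ)) (b := b)
    (f := fun q : ℝ => z (heat q.toNNReal φ)) (f' := fun q : ℝ => z (heat q.toNNReal (lap φ)))
    (hcont φ).continuousOn (fun q hq => by
      have hq0 : 0 ≤ q := by
        have := hq.1.le
        rw [min_eq_left (by exact_mod_cast hab)] at this
        exact a.2.trans this
      have h := hasDerivWithinAt_distr_heat z φ q.toNNReal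
      rw [Real.coe_toNNReal _ hq0] at h
      exact h.mono Set.Ioi_subset_Ici_self) ((hcont _).intervalIntegrable _ _)
  rw [this, Real.toNNReal_coe, Real.toNNReal_coe]

lemma distr_heat_sub_reverse (z : Distr) (φ : TestFn) {a b t : ℝ≥0} (hab : a ≤ b) (hbt : b ≤ t) :
    z (heat (t - a) φ) - z (heat (t - b) φ)
      = ∫ s in (a : ℝ)..b, z (heat (t - s.toNNReal) (lap φ)) := by
  rw [distr_heat_sub z φ (tsub_le_tsub_left hab t), NNReal.coe_sub hbt,
    NNReal.coe_sub (hab.trans hbt)]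
  rw [← intervalIntegral.integral_comp_sub_left (fun r : ℝ => z (heat r.toNNReal (lap φ))) (t : ℝ)]
  refine intervalIntegral.integral_congr fun s hs => ?_
  rw [Set.uIcc_of_le (by exact_mod_cast hab)] at hs
  rw [NNReal.sub_def, Real.coe_toNNReal _ (a.2.trans hs.1)]

/-! ### Uniform boundedness -/

section Combination

variable {κ : Type*} (ψ : κ → TestFn)

lemma exists_combination (hψ : ∀ n, ∃ C, ∀ k, seminormFamily n (ψ k) ≤ C)
    (a : lp (fun _ : κ => ℝ) 1) : ∃ χ : TestFn,
    (∀ x, χ x = ∑' k, a k * ψ k x) ∧ ∀ n C, (∀ k, seminormFamily n (ψ k) ≤ C) → seminormFamily n χ ≤ C * ‖a‖ := by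
  have hs : Summable fun k => |a k| := by
    have := (lp.memℓp a).summable (by norm_num)
    simpa using this
  have hn : ‖a‖ = ∑' k, |a k| := by
    have := lp.norm_eq_tsum_rpow (p := 1) (by norm_num) a
    simpa using this
  choose C hC using hψ
  have hsm : ∀ k, ContDiff ℝ ∞ (fun x => a k * ψ k x) := fun k => contDiff_const.mul (ψ k).smooth
  have hb : ∀ n C', (∀ k, seminormFamily n (ψ k) ≤ C') → ∀ k x,
      ‖iteratedFDeriv ℝ n (fun x => a k * ψ k x) x‖ ≤ |a k| * C' := by
    intro n C' hC' k x
    have := (norm_iteratedFDeriv_le n (a k • ψ k) x)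
    rw [map_smul_eq_mul] at this
    exact this.trans (mul_le_mul_of_nonneg_left (hC' k) (abs_nonneg _))
  have hv : ∀ n : ℕ, (n : ℕ∞) ≤ ⊤ → Summable fun k => |a k| * C n := fun n _ => hs.mul_right _
  have hbd : ∀ (n : ℕ) (k : κ) (x : Plane), (n : ℕ∞) ≤ ⊤ →
      ‖iteratedFDeriv ℝ n (fun x => a k * ψ k x) x‖ ≤ |a k| * C n := fun n k x _ =>
    hb n (C n) (hC n) k x
  refine ⟨⟨fun x => ∑' k, a k * ψ k x, contDiff_tsum hsm hv hbd, fun l x => ?_⟩, fun x => rfl, ?_⟩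
  · simp only [(ψ _).periodic l x]
  · intro n C' hC'
    refine seminorm_le n _ fun x => ?_
    have h1 : iteratedFDeriv ℝ n (fun x => ∑' k, a k * ψ k x)
        = fun x => ∑' k, iteratedFDeriv ℝ n (fun x => a k * ψ k x) x :=
      iteratedFDeriv_tsum hsm hv hbd (by exact_mod_cast le_top)
    change ‖iteratedFDeriv ℝ n (fun x => ∑' k, a k * ψ k x) x‖ ≤ _
    rw [h1, hn, mul_comm, ← tsum_mul_right]
    exact tsum_of_norm_bounded ((hs.mul_right C').hasSum) fun k => hb n C' hC' k x

/-- A pointwise bounded family of distributions is uniformly bounded on bounded sets. -/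
lemma exists_bound_family {ι : Type*} (z : ι → Distr) (hz : ∀ φ, ∃ C, ∀ i, |z i φ| ≤ C)
    (hψ : ∀ n, ∃ C, ∀ k, seminormFamily n (ψ k) ≤ C) : ∃ K, ∀ i k, |z i (ψ k)| ≤ K := by
  classical
  choose χ hχ hχn using exists_combination ψ hψ
  have hsum : ∀ (a : lp (fun _ : κ => ℝ) 1) x, Summable fun k => a k * ψ k x := by
    intro a x
    have hs : Summable fun k => |a k| := by
      have := (lp.memℓp a).summable (by norm_num)
      simpa using this
    obtain ⟨C, hC⟩ := hψ 0
    refine Summable.of_norm_bounded (hs.mul_right C) fun k => ?_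
    rw [norm_mul]
    exact mul_le_mul_of_nonneg_left ((abs_apply_le _ x).trans (hC k)) (abs_nonneg _)
  let T : lp (fun _ : κ => ℝ) 1 →ₗ[ℝ] TestFn :=
    { toFun := χ
      map_add' := fun a b => by
        ext x
        rw [add_apply, hχ, hχ, hχ, ← (hsum a x).tsum_add (hsum b x)]
        simp [add_mul]
      map_smul' := fun c a => by
        ext x
        rw [RingHom.id_apply, smul_apply, hχ, hχ, ← tsum_mul_left]
        simp [mul_assoc] }
  have hbound : ∀ i, ∃ C : ℝ, ∀ a, ‖((z i : TestFn →L[ℝ] ℝ).toLinearMap.comp T) a‖ ≤ C * ‖a‖ := by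
    intro i
    obtain ⟨s, C, hC⟩ := exists_bound_distr (z i)
    choose K hK using hψ
    refine ⟨C * ∑ n ∈ s, K n, fun a => (hC (χ a)).trans ?_⟩
    rw [mul_assoc, Finset.sum_mul]
    gcongr with n hn
    exact hχn a n (K n) (hK n)
  choose C hC using hbound
  obtain ⟨K, hK⟩ := banach_steinhaus
    (g := fun i => ((z i : TestFn →L[ℝ] ℝ).toLinearMap.comp T).mkContinuous (C i) (hC i))
    (fun a => hz (T a))
  refine ⟨K, fun i k => ?_⟩
  have h1 := (((z i : TestFn →L[ℝ] ℝ).toLinearMap.comp T).mkContinuous (C i) (hC i)).le_of_opNorm_le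
    (hK i) (lp.single 1 k (1 : ℝ))
  have h2 : T (lp.single 1 k (1 : ℝ)) = ψ k := by
    ext x
    change χ _ x = _
    rw [hχ, tsum_eq_single k]
    · simp
    · intro j hj
      simp [hj]
  rw [LinearMap.mkContinuous_apply, LinearMap.comp_apply, h2, lp.norm_single (by norm_num)] at h1
  rw [norm_one, mul_one] at h1
  exact h1

end Combination

lemma exists_seminorm_heat_le (φ : TestFn) (n : ℕ) : ∃ C, ∀ r : ℝ≥0, seminormFamily n (heat r φ) ≤ C := by
  obtain ⟨C, hC⟩ := seminorm_le_of_commute heat (fun _ => 1) (fun t i φ => heat_deriv t _ φ)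
    (fun φ => ⟨seminormFamily 0 φ, fun t x => by
      rw [mul_one]; exact abs_heat_le (fun x => abs_apply_le φ x) t x⟩) n φ
  exact ⟨C, fun r => by simpa using hC r⟩

end TestFn

open TestFn

/-! ### Uniform grids -/

/-- The uniform grid of `m + 1` intervals on `[0, t]`, constant after its last point. -/
def grid (t : ℝ≥0) (m i : ℕ) : ℝ≥0 := t * (min i (m + 1) : ℕ) / (m + 1)

lemma grid_zero (t : ℝ≥0) (m : ℕ) : grid t m 0 = 0 := by simp [grid]

lemma grid_last (t : ℝ≥0) (m : ℕ) : grid t m (m + 1) = t := by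
  have : ((m : ℝ≥0) + 1) ≠ 0 := by positivity
  simp [grid, this]

lemma monotone_grid (t : ℝ≥0) (m : ℕ) : Monotone (grid t m) := by
  intro i j hij
  unfold grid
  gcongr

lemma grid_le (t : ℝ≥0) (m i : ℕ) : grid t m i ≤ t := by
  rcases le_total i (m + 1) with h | h
  · exact (monotone_grid t m h).trans (grid_last t m).le
  · have : grid t m i = grid t m (m + 1) := by simp [grid, h]
    exact (this.trans (grid_last t m)).le

lemma grid_succ_le (t : ℝ≥0) (m i : ℕ) : (grid t m (i + 1) : ℝ) ≤ grid t m i + t * (1 / (m + 1)) := by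
  have h : ((min (i + 1) (m + 1) : ℕ) : ℝ) ≤ (min i (m + 1) : ℕ) + 1 := by
    exact_mod_cast (by omega : min (i + 1) (m + 1) ≤ min i (m + 1) + 1)
  have hm : (0 : ℝ) < (m : ℝ) + 1 := by positivity
  simp only [grid, NNReal.coe_div, NNReal.coe_mul, NNReal.coe_natCast, NNReal.coe_add,
    NNReal.coe_one]
  rw [mul_one_div, ← add_div]
  gcongr
  nlinarith [t.2, mul_le_mul_of_nonneg_left h t.2]

lemma exists_mem_Ioc_of_monotone {α : Type*} [LinearOrder α] (τ : ℕ → α) {n : ℕ} {s : α}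
    (h0 : τ 0 < s) (hn : s ≤ τ n) : ∃ i < n, s ∈ Set.Ioc (τ i) (τ (i + 1)) := by
  induction n with
  | zero => exact absurd hn (not_le.2 h0)
  | succ n ih =>
    by_cases h : s ≤ τ n
    · obtain ⟨i, hi, his⟩ := ih h
      exact ⟨i, hi.trans (Nat.lt_succ_self n), his⟩
    · exact ⟨n, Nat.lt_succ_self n, not_le.1 h, hn⟩

lemma sum_indicator_Ioc_eq {α M : Type*} [LinearOrder α] [AddCommMonoid M] {τ : ℕ → α}
    (hτ : Monotone τ) {n i : ℕ} (hi : i < n) {s : α} (hs : s ∈ Set.Ioc (τ i) (τ (i + 1)))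
    (f : ℕ → α → M) :
    ∑ j ∈ Finset.range n, (Set.Ioc (τ j) (τ (j + 1))).indicator (f j) s = f i s := by
  rw [Finset.sum_eq_single_of_mem i (Finset.mem_range.2 hi), Set.indicator_of_mem hs]
  intro j _ hj
  refine Set.indicator_of_notMem (fun hjs => ?_) _
  exact Set.disjoint_left.1 (hτ.pairwise_disjoint_on_Ioc_succ hj) hjs hs

lemma exists_grid_index (t : ℝ≥0) {s : ℝ≥0} (h0 : 0 < s) (hs : s ≤ t) : ∃ i : ℕ → ℕ,
    (∀ m, i m < m + 1 ∧ s ∈ Set.Ioc (grid t m (i m)) (grid t m (i m + 1))) ∧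
    Tendsto (fun m => grid t m (i m)) atTop (𝓝 s) ∧
    Tendsto (fun m => grid t m (i m + 1)) atTop (𝓝 s) := by
  choose i hi his using fun m => exists_mem_Ioc_of_monotone (grid t m) (n := m + 1) (s := s)
    (by rwa [grid_zero]) (by rwa [grid_last])
  have hlim : Tendsto (fun m : ℕ => (t : ℝ) * (1 / (m + 1))) atTop (𝓝 0) := by
    simpa using tendsto_one_div_add_atTop_nhds_zero_nat.const_mul (t : ℝ)
  refine ⟨i, fun m => ⟨hi m, his m⟩, ?_, ?_⟩
  · rw [← NNReal.tendsto_coe]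
    have hl : Tendsto (fun m : ℕ => (s : ℝ) - t * (1 / (m + 1))) atTop (𝓝 s) := by
      simpa using hlim.const_sub (s : ℝ)
    refine tendsto_of_tendsto_of_tendsto_of_le_of_le hl tendsto_const_nhds (fun m => ?_) fun m => ?_
    · have h1 : (s : ℝ) ≤ grid t m (i m + 1) := by exact_mod_cast (his m).2
      linarith [grid_succ_le t m (i m)]
    · exact_mod_cast (his m).1.le
  · rw [← NNReal.tendsto_coe]
    have hl : Tendsto (fun m : ℕ => (s : ℝ) + t * (1 / (m + 1))) atTop (𝓝 s) := by
      simpa using hlim.const_add (s : ℝ)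
    refine tendsto_of_tendsto_of_tendsto_of_le_of_le tendsto_const_nhds hl (fun m => ?_) fun m => ?_
    · exact_mod_cast (his m).2
    · have h1 : (grid t m (i m) : ℝ) ≤ s := by exact_mod_cast (his m).1.le
      linarith [grid_succ_le t m (i m)]

/-! ### The processes `M_φ` -/

lemma continuous_path_apply (z : Path) (φ : TestFn) : Continuous fun t => z t φ :=
  (WeakDual.eval_continuous φ).comp z.continuous

lemma continuous_path_toNNReal (z : Path) (φ : TestFn) : Continuous fun s : ℝ => z s.toNNReal φ :=
  (continuous_path_apply z φ).comp continuous_real_toNNReal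

section MartM

variable {Ω : Type*} [mΩ : MeasurableSpace Ω] (Z : Ω → Path)

/-- `M_φ(t, ω)` as a linear map in `φ`. -/
def martMₗ (t : ℝ≥0) (ω : Ω) : TestFn →ₗ[ℝ] ℝ where
  toFun φ := martM Z φ t ω
  map_add' φ ψ := by
    simp only [martM, laplacian_eq_lap, map_add]
    rw [intervalIntegral.integral_add ((continuous_path_toNNReal _ _).intervalIntegrable _ _)
      ((continuous_path_toNNReal _ _).intervalIntegrable _ _)]
    ring
  map_smul' c φ := by
    simp only [martM, laplacian_eq_lap, map_smul, smul_eq_mul, RingHom.id_apply]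
    rw [intervalIntegral.integral_const_mul]
    ring

lemma martM_eq (φ : TestFn) (t : ℝ≥0) (ω : Ω) : martM Z φ t ω = martMₗ Z t ω φ := rfl

lemma martM_zero (φ : TestFn) (ω : Ω) : martM Z φ 0 ω = 0 := by simp [martM]

lemma continuous_martM (φ : TestFn) (ω : Ω) : Continuous fun t => martM Z φ t ω := by
  have h := intervalIntegral.continuous_primitive (μ := volume)
    (fun a b => (continuous_path_toNNReal (Z ω) φ.laplacian).intervalIntegrable a b) 0
  exact ((continuous_path_apply (Z ω) φ).sub continuous_const).sub
    (h.comp NNReal.continuous_coe)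

lemma measurable_distr_apply (φ : TestFn) : Measurable fun z : Distr => z φ :=
  Measurable.of_comap_le (le_iSup (fun φ : TestFn =>
    MeasurableSpace.comap (fun z : Distr => z φ) inferInstance) φ)

lemma measurable_path_apply (t : ℝ≥0) : Measurable fun z : Path => z t :=
  Measurable.of_comap_le (le_iSup (fun t : ℝ≥0 =>
    MeasurableSpace.comap (fun z : Path => z t) inferInstance) t)

lemma measurable_integral_of_continuous {α : Type*} {m : MeasurableSpace α} {μ : Measure ℝ} [SFinite μ]
    {u : ℝ → α → ℝ} (hc : ∀ a, Continuous fun s => u s a) (hu : ∀ s, Measurable (u s)) :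
    Measurable fun a => ∫ s, u s a ∂μ :=
  (StronglyMeasurable.integral_prod_left
    (measurable_uncurry_of_continuous_of_measurable hc hu).stronglyMeasurable).measurable

lemma measurable_martM (𝓕 : Filtration ℝ≥0 mΩ) (hZ : ∀ t : ℝ≥0, Measurable[𝓕 t] fun ω => Z ω t)
    (φ : TestFn) (t : ℝ≥0) : Measurable[𝓕 t] (martM Z φ t) := by
  have hm : ∀ φ, ∀ s ≤ t, Measurable[𝓕 t] fun ω => Z ω s φ := fun φ s hs =>
    ((measurable_distr_apply φ).comp (hZ s)).mono (𝓕.mono hs) le_rfl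
  have hint : Measurable[𝓕 t] fun ω => ∫ s in (0 : ℝ)..t, Z ω s.toNNReal φ.laplacian := by
    have h1 : (fun ω => ∫ s in (0 : ℝ)..t, Z ω s.toNNReal φ.laplacian)
        = fun ω => ∫ s, Z ω (min s.toNNReal t) φ.laplacian ∂(volume.restrict (Set.Ioc (0 : ℝ) t)) := by
      funext ω
      rw [intervalIntegral.integral_of_le (NNReal.coe_nonneg t)]
      refine setIntegral_congr_fun measurableSet_Ioc fun s hs => ?_
      rw [min_eq_left (Real.toNNReal_le_iff_le_coe.2 hs.2)]
    rw [h1]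
    exact measurable_integral_of_continuous (m := 𝓕 t)
      (fun ω => (continuous_path_apply (Z ω) _).comp
        (continuous_real_toNNReal.min continuous_const)) fun s => hm _ _ (min_le_right _ _)
  exact ((hm φ t le_rfl).sub (hm φ 0 (zero_le))).sub hint

end MartM

/-! ### Duhamel's formula along a path -/

lemma sum_intervalIntegral_eq {τ : ℕ → ℝ≥0} (hτ : Monotone τ) (n : ℕ) (g : ℕ → ℝ → ℝ)
    (hg : ∀ i, Continuous (g i)) :
    ∑ i ∈ Finset.range n, ∫ s in (τ i : ℝ)..τ (i + 1), g i s
      = ∫ s in Set.Ioc (0 : ℝ) (τ n), ∑ i ∈ Finset.range n,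
          (Set.Ioc (τ i : ℝ) (τ (i + 1))).indicator (g i) s := by
  have hint : ∀ i, IntegrableOn (g i) (Set.Ioc (τ i : ℝ) (τ (i + 1))) := fun i =>
    ((hg i).integrableOn_Icc).mono_set Set.Ioc_subset_Icc_self
  rw [integral_finsetSum _ fun i _ => ((integrable_indicator_iff measurableSet_Ioc).2
    (hint i)).integrableOn]
  refine Finset.sum_congr rfl fun i hi => ?_
  rw [setIntegral_indicator measurableSet_Ioc, intervalIntegral.integral_of_le
    (by exact_mod_cast hτ i.le_succ), Set.inter_eq_self_of_subset_right]
  refine Set.Ioc_subset_Ioc (τ i).2 ?_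
  exact_mod_cast hτ (Finset.mem_range.1 hi)

section

variable {Ω : Type*} [mΩ : MeasurableSpace Ω]

lemma sum_martM_sub_eq (Z : Ω → Path) (ω : Ω) (φ : TestFn) (t : ℝ≥0) (m : ℕ) :
    ∑ i ∈ Finset.range (m + 1), (martM Z (heat (t - grid t m i) φ) (grid t m (i + 1)) ω
        - martM Z (heat (t - grid t m i) φ) (grid t m i) ω)
      = Z ω t φ - Z ω 0 (heat t φ) + ∫ s in Set.Ioc (0 : ℝ) t, ∑ i ∈ Finset.range (m + 1),
          (Set.Ioc (grid t m i : ℝ) (grid t m (i + 1))).indicator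
            (fun s => Z ω (grid t m (i + 1)) (heat (t - s.toNNReal) (lap φ))
              - Z ω s.toNNReal (heat (t - grid t m i) (lap φ))) s := by
  set τ := grid t m with hτ
  have hc1 : ∀ u, Continuous fun s : ℝ => Z ω u (heat (t - s.toNNReal) (lap φ)) := fun u =>
    (continuous_distr_heat _ _).comp (continuous_const.sub continuous_real_toNNReal)
  have hc2 : ∀ ψ, Continuous fun s : ℝ => Z ω s.toNNReal ψ := fun ψ => continuous_path_toNNReal _ _
  have hsum := sum_intervalIntegral_eq (monotone_grid t m) (m + 1)
    (fun i s => Z ω (τ (i + 1)) (heat (t - s.toNNReal) (lap φ))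
      - Z ω s.toNNReal (heat (t - τ i) (lap φ))) (fun i => (hc1 _).sub (hc2 _))
  rw [grid_last] at hsum
  rw [← hsum]
  have htel := Finset.sum_range_sub (fun i => Z ω (τ i) (heat (t - τ i) φ)) (m + 1)
  have e1 : τ (m + 1) = t := grid_last t m
  have e0 : τ 0 = 0 := grid_zero t m
  simp only [e1, e0, tsub_self, tsub_zero, heat_zero] at htel
  rw [← htel, ← Finset.sum_add_distrib]
  refine Finset.sum_congr rfl fun i _ => ?_
  have hle : τ i ≤ τ (i + 1) := monotone_grid t m i.le_succ
  rw [intervalIntegral.integral_sub ((hc1 _).intervalIntegrable _ _)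
    ((hc2 _).intervalIntegrable _ _), ← distr_heat_sub_reverse _ _ hle (grid_le t m _)]
  have hadj := intervalIntegral.integral_add_adjacent_intervals (μ := volume)
    ((hc2 (heat (t - τ i) (lap φ))).intervalIntegrable 0 (τ i))
    ((hc2 (heat (t - τ i) (lap φ))).intervalIntegrable (τ i) (τ (i + 1)))
  simp only [martM, laplacian_eq_lap, heat_lap]
  linarith

theorem tendsto_sum_martM (Z : Ω → Path) (ω : Ω) (φ : TestFn) (t : ℝ≥0) :
    Tendsto (fun m => ∑ i ∈ Finset.range (m + 1),
      (martM Z (heat (t - grid t m i) φ) (grid t m (i + 1)) ω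
        - martM Z (heat (t - grid t m i) φ) (grid t m i) ω)) atTop
      (𝓝 (Z ω t φ - Z ω 0 (heat t φ))) := by
  simp_rw [sum_martM_sub_eq]
  set χ := lap φ
  obtain ⟨K, hK⟩ := exists_bound_family (κ := ℝ≥0) (ι := Set.Iic t) (fun r => heat r χ)
    (fun u => Z ω u) (fun ψ => by
      obtain ⟨C, hC⟩ := (isCompact_Icc (a := (0 : ℝ≥0)) (b := t)).exists_bound_of_continuousOn
        (continuous_path_apply (Z ω) ψ).continuousOn
      exact ⟨C, fun u => hC u ⟨zero_le, u.2⟩⟩) (fun n => exists_seminorm_heat_le χ n)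
  have hK0 : 0 ≤ K := (abs_nonneg _).trans (hK ⟨t, Set.self_mem_Iic⟩ 0)
  have hc1 : ∀ u, Continuous fun s : ℝ≥0 => Z ω u (heat (t - s) χ) := fun u =>
    (continuous_distr_heat _ _).comp (continuous_const.sub continuous_id)
  have hconv : Tendsto (fun m => ∫ s in Set.Ioc (0 : ℝ) t, ∑ i ∈ Finset.range (m + 1),
      (Set.Ioc (grid t m i : ℝ) (grid t m (i + 1))).indicator
        (fun s => Z ω (grid t m (i + 1)) (heat (t - s.toNNReal) χ)
          - Z ω s.toNNReal (heat (t - grid t m i) χ)) s) atTop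
      (𝓝 (∫ s in Set.Ioc (0 : ℝ) t, (0 : ℝ))) := by
    refine tendsto_integral_of_dominated_convergence (fun _ => 2 * K) (fun m => ?_)
      (integrable_const _) (fun m => ?_) ?_
    · refine Measurable.aestronglyMeasurable (Finset.measurable_sum _ fun i _ => ?_)
      refine Measurable.indicator (Continuous.measurable ?_) measurableSet_Ioc
      exact ((hc1 _).comp continuous_real_toNNReal).sub (continuous_path_toNNReal _ _)
    · refine (ae_restrict_iff' measurableSet_Ioc).2 (ae_of_all _ fun s hs => ?_)
      obtain ⟨i, hi, his⟩ := exists_mem_Ioc_of_monotone (fun i => (grid t m i : ℝ)) (n := m + 1)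
        (s := s) (by simpa [grid_zero] using hs.1) (by simpa [grid_last] using hs.2)
      rw [sum_indicator_Ioc_eq (τ := fun i => (grid t m i : ℝ))
        (fun a b hab => by exact_mod_cast monotone_grid t m hab) hi his]
      have h1 := hK ⟨grid t m (i + 1), grid_le t m _⟩ (t - s.toNNReal)
      have h2 := hK ⟨s.toNNReal, Real.toNNReal_le_iff_le_coe.2 hs.2⟩ (t - grid t m i)
      refine (norm_sub_le _ _).trans ?_
      rw [two_mul]
      exact add_le_add h1 h2
    · refine (ae_restrict_iff' measurableSet_Ioc).2 (ae_of_all _ fun s hs => ?_)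
      have hs0 : 0 < s.toNNReal := Real.toNNReal_pos.2 hs.1
      obtain ⟨i, hi, hl, hr⟩ := exists_grid_index t hs0 (Real.toNNReal_le_iff_le_coe.2 hs.2)
      have heq : ∀ m, ∑ j ∈ Finset.range (m + 1),
          (Set.Ioc (grid t m j : ℝ) (grid t m (j + 1))).indicator
            (fun s => Z ω (grid t m (j + 1)) (heat (t - s.toNNReal) χ)
              - Z ω s.toNNReal (heat (t - grid t m j) χ)) s
          = Z ω (grid t m (i m + 1)) (heat (t - s.toNNReal) χ)
              - Z ω s.toNNReal (heat (t - grid t m (i m)) χ) := fun m => by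
        refine sum_indicator_Ioc_eq (τ := fun i => (grid t m i : ℝ))
          (fun a b hab => by exact_mod_cast monotone_grid t m hab) (hi m).1 ?_ _
        have h := (hi m).2
        rw [← Real.coe_toNNReal s hs.1.le]
        exact ⟨by exact_mod_cast h.1, by exact_mod_cast h.2⟩
      simp_rw [heq]
      have h1 := ((continuous_path_apply (Z ω) (heat (t - s.toNNReal) χ)).tendsto _).comp hr
      have h2 := ((hc1 s.toNNReal).tendsto _).comp hl
      simpa using h1.sub h2
  simpa using hconv.const_add (Z ω t φ - Z ω 0 (heat t φ))

end

/-! ### The joint law of the processes `M_φ` -/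

/-- The class in `L²` as a linear map. -/
def TestFn.toL2ₗ : TestFn →ₗ[ℝ] L2 where
  toFun := toL2
  map_add' φ ψ := MemLp.toLp_add φ.memLp ψ.memLp
  map_smul' c φ := MemLp.toLp_const_smul c φ.memLp

lemma TestFn.toL2_eq (φ : TestFn) : φ.toL2 = toL2ₗ φ := rfl

lemma TestFn.norm_toL2_sq (φ : TestFn) : ‖φ.toL2‖ ^ 2 = ∫ x, φ x ^ 2 ∂torusVol := by
  rw [← real_inner_self_eq_norm_sq, L2.inner_def]
  refine integral_congr_ae ?_
  filter_upwards [φ.memLp.coeFn_toLp] with x hx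
  have : (toL2 φ : Plane → ℝ) x = φ x := hx
  simp [this, sq]

section

variable {Ω : Type*} [mΩ : MeasurableSpace Ω]

/-- The covariance of the increments after time `s` of the finite family `M_{φ_j}(t_j)`. -/
def incrCov {ι : Type*} (S : Finset ι) (t : ι → ℝ≥0) (f : ι → L2) (s : ℝ≥0) : ℝ :=
  ∑ j ∈ S, ∑ k ∈ S, ((min (t j) (t k) : ℝ≥0) - s : ℝ) * inner ℝ (f j) (f k)

lemma incrCov_insert {ι : Type*} [DecidableEq ι] (S : Finset ι) (t : ι → ℝ≥0) (f : ι → L2)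
    (s : ℝ≥0) {a : ι} (ha : a ∉ S) (hmin : ∀ j ∈ S, t a ≤ t j) :
    incrCov (insert a S) t f s
      = incrCov S t f (t a) + (t a - s) * ‖∑ j ∈ insert a S, f j‖ ^ 2 := by
  have h1 : ‖∑ j ∈ insert a S, f j‖ ^ 2
      = ∑ j ∈ insert a S, ∑ k ∈ insert a S, (inner ℝ (f j) (f k) : ℝ) := by
    rw [← real_inner_self_eq_norm_sq, sum_inner]
    simp_rw [inner_sum]
  have h2 : incrCov (insert a S) t f (t a) = incrCov S t f (t a) := by
    unfold incrCov
    rw [Finset.sum_insert ha, Finset.sum_insert ha]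
    have e1 : ∑ k ∈ S, ((min (t a) (t k) : ℝ≥0) - t a : ℝ) * inner ℝ (f a) (f k) = 0 :=
      Finset.sum_eq_zero fun k hk => by rw [min_eq_left (hmin k hk)]; simp
    rw [e1, min_self, sub_self, zero_mul, zero_add, zero_add]
    refine Finset.sum_congr rfl fun j hj => ?_
    rw [Finset.sum_insert ha, min_eq_right (hmin j hj), sub_self, zero_mul, zero_add]
  rw [← h2, h1]
  unfold incrCov
  rw [Finset.mul_sum, ← Finset.sum_add_distrib]
  refine Finset.sum_congr rfl fun j _ => ?_
  rw [Finset.mul_sum, ← Finset.sum_add_distrib]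
  exact Finset.sum_congr rfl fun k _ => by ring

variable {P : Measure Ω} [IsProbabilityMeasure P] {𝓕 : Filtration ℝ≥0 mΩ} {Z : Ω → Path}

lemma isScaledBrownian_martM (hZ : ∀ t : ℝ≥0, Measurable[𝓕 t] fun ω => Z ω t)
    (hM : ∀ φ, IsLocalMartingale (martM Z φ) 𝓕 P) (hΓ : ∀ φ, IsLocalMartingale (martG Z φ) 𝓕 P)
    (φ : TestFn) : IsScaledBrownian (martM Z φ) (2 * ‖φ.toL2‖ ^ 2) 𝓕 P where
  adapted := measurable_martM Z 𝓕 hZ φ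
  cont := continuous_martM Z φ
  zero := martM_zero Z φ
  localMart := hM φ
  quad := by
    have : (fun t ω => martM Z φ t ω ^ 2 - 2 * ‖φ.toL2‖ ^ 2 * t) = martG Z φ := by
      funext t ω
      rw [martG, norm_toL2_sq]
      ring
    rw [this]
    exact hΓ φ

theorem integral_exp_martM (hB : ∀ φ, IsScaledBrownian (martM Z φ) (2 * ‖φ.toL2‖ ^ 2) 𝓕 P)
    {ι : Type*} (t : ι → ℝ≥0) (φ : ι → TestFn) (S : Finset ι) :
    ∀ (s : ℝ≥0) (Y : Ω → ℂ) (B : ℝ), (∀ j ∈ S, s ≤ t j) → StronglyMeasurable[𝓕 s] Y →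
      (∀ ω, ‖Y ω‖ ≤ B) →
      ∫ ω, Y ω * Complex.exp (Complex.I *
        ((∑ j ∈ S, (martM Z (φ j) (t j) ω - martM Z (φ j) s ω) : ℝ) : ℂ)) ∂P
      = Complex.exp (-(incrCov S t (fun j => (φ j).toL2) s : ℝ)) * ∫ ω, Y ω ∂P := by
  classical
  induction S using Finset.induction_on_min_value t with
  | empty =>
    intro s Y B _ _ _
    simp [incrCov]
  | insert a S ha hmin ih =>
    intro s Y B hs hY hYB
    have hsa : s ≤ t a := hs a (Finset.mem_insert_self a S)
    set Φ := ∑ j ∈ insert a S, φ j with hΦ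
    have hdec : ∀ ω, ∑ j ∈ insert a S, (martM Z (φ j) (t j) ω - martM Z (φ j) s ω)
        = (martM Z Φ (t a) ω - martM Z Φ s ω)
          + ∑ j ∈ S, (martM Z (φ j) (t j) ω - martM Z (φ j) (t a) ω) := by
      intro ω
      have hl : ∀ r, martM Z Φ r ω = ∑ j ∈ insert a S, martM Z (φ j) r ω := fun r => by
        simp only [martM_eq, hΦ, map_sum]
      rw [hl, hl, Finset.sum_insert ha, Finset.sum_insert ha, Finset.sum_insert ha,
        Finset.sum_sub_distrib, Finset.sum_sub_distrib]
      ring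
    set Y' : Ω → ℂ := fun ω => Y ω * Complex.exp (Complex.I *
      (((1 : ℝ) : ℂ) * ((martM Z Φ (t a) ω : ℂ) - martM Z Φ s ω))) with hY'
    have hm : StronglyMeasurable[𝓕 (t a)] Y' := by
      refine (hY.mono (𝓕.mono hsa)).mul ?_
      have h1 : Measurable[𝓕 (t a)] fun ω => martM Z Φ (t a) ω - martM Z Φ s ω :=
        ((hB Φ).adapted (t a)).sub (((hB Φ).adapted s).mono (𝓕.mono hsa) le_rfl)
      have h2 : Continuous fun x : ℝ => Complex.exp (Complex.I * (((1 : ℝ) : ℂ) * (x : ℂ))) := by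
        fun_prop
      have h3 := (h2.measurable.comp h1).stronglyMeasurable
      simp only [Function.comp_def, Complex.ofReal_sub] at h3
      exact h3
    have hb : ∀ ω, ‖Y' ω‖ ≤ B := by
      intro ω
      rw [hY', norm_mul, ← Complex.ofReal_sub, ← Complex.ofReal_mul, mul_comm Complex.I,
        Complex.norm_exp_ofReal_mul_I, mul_one]
      exact hYB ω
    have h1 := ih (t a) Y' B hmin hm hb
    have h2 := (hB Φ).integral_exp_increment (by positivity) hsa 1 hY hYB
    have e1 : ∀ ω, Y ω * Complex.exp (Complex.I *
        ((∑ j ∈ insert a S, (martM Z (φ j) (t j) ω - martM Z (φ j) s ω) : ℝ) : ℂ))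
        = Y' ω * Complex.exp (Complex.I *
          ((∑ j ∈ S, (martM Z (φ j) (t j) ω - martM Z (φ j) (t a) ω) : ℝ) : ℂ)) := by
      intro ω
      rw [hdec, hY', mul_assoc, ← Complex.exp_add]
      congr 2
      push_cast
      ring
    simp_rw [e1]
    rw [h1, hY', h2]
    have hΦn : Φ.toL2 = ∑ j ∈ insert a S, (φ j).toL2 := by
      simp only [toL2_eq, hΦ, map_sum]
    rw [incrCov_insert S t _ s ha hmin, ← hΦn]
    rw [← mul_assoc, ← Complex.exp_add]
    congr 2
    push_cast
    ring

end

namespace TestFn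

open scoped ContDiff Manifold

/-! ### Density of the test functions in `L²` -/

/-- The open cube `(-1,1)²`. -/
def openCube : Set Plane := {x | ∀ i, x i ∈ Set.Ioo (-1 : ℝ) 1}

lemma isOpen_openCube : IsOpen openCube := by
  have : openCube = ⋂ i, (fun x : Plane => x i) ⁻¹' Set.Ioo (-1 : ℝ) 1 := by
    ext x
    simp [openCube]
  rw [this]
  exact isOpen_iInter_of_finite fun i => isOpen_Ioo.preimage (by fun_prop)

lemma ae_mem_openCube : ∀ᵐ x ∂torusVol, x ∈ openCube := by
  have h : ∀ (i : Fin 2) (c : ℝ), ∀ᵐ x ∂torusVol, x i ≠ c := by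
    intro i c
    refine ae_restrict_of_ae ?_
    have h1 : volume {f : Fin 2 → ℝ | f i = c} = 0 := by
      rw [volume_pi]
      exact Measure.pi_hyperplane (α := fun _ => ℝ) (fun _ => volume) i c
    have h2 : MeasurableSet {f : Fin 2 → ℝ | f i = c} := measurableSet_eq_fun (by fun_prop) (by fun_prop)
    have h3 := (PiLp.volume_preserving_ofLp (Fin 2)).measure_preimage h2.nullMeasurableSet
    rw [h1] at h3
    exact measure_eq_zero_iff_ae_notMem.1 h3
  have hcube : ∀ᵐ x ∂torusVol, x ∈ cube := ae_restrict_mem isCompact_cube.isClosed.measurableSet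
  filter_upwards [hcube, ae_all_iff.2 fun i => h i 1, ae_all_iff.2 fun i => h i (-1)] with x hx h1 h2 i
  exact ⟨lt_of_le_of_ne (hx i).1 (h2 i).symm, lt_of_le_of_ne (hx i).2 (h1 i)⟩

lemma lattice_apply (k : Fin 2 → ℤ) (i : Fin 2) : lattice k i = 2 * (k i : ℝ) := rfl

lemma lattice_add (k l : Fin 2 → ℤ) : lattice (k + l) = lattice k + lattice l := by
  ext i
  simp [lattice_apply, mul_add]

lemma exists_periodization {h : Plane → ℝ} (hs : ContDiff ℝ ∞ h) (hsupp : Function.support h ⊆ openCube) :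
    ∃ φ : TestFn, ∀ x ∈ cube, φ x = h x := by
  have hfin : LocallyFinite fun k : Fin 2 → ℤ => Function.support fun x => h (x + lattice k) := by
    intro x₀
    refine ⟨Metric.ball x₀ 1, Metric.ball_mem_nhds _ one_pos, ?_⟩
    obtain ⟨N, hN⟩ := exists_nat_gt (‖x₀‖ + 2)
    refine (Set.finite_Icc (fun _ => -(N : ℤ)) fun _ => (N : ℤ)).subset ?_
    rintro k ⟨x, hx, hxb⟩
    have hkx : ∀ i, |(k i : ℝ)| ≤ N := by
      intro i
      have h1 := hsupp hx i
      rw [PiLp.add_apply, lattice_apply] at h1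
      have h2 : |x i| ≤ ‖x₀‖ + 1 := by
        have h3 : ‖x i‖ ≤ ‖x‖ := PiLp.norm_apply_le x i
        have h4 : ‖x‖ ≤ ‖x₀‖ + ‖x - x₀‖ := by
          simpa using norm_add_le x₀ (x - x₀)
        rw [Metric.mem_ball, dist_eq_norm] at hxb
        rw [Real.norm_eq_abs] at h3
        linarith
      rw [abs_le] at h2 ⊢
      constructor <;> linarith [h1.1, h1.2, norm_nonneg x₀]
    have hk : ∀ i, |k i| ≤ (N : ℤ) := fun i => by exact_mod_cast hkx i
    exact ⟨fun i => (abs_le.1 (hk i)).1, fun i => (abs_le.1 (hk i)).2⟩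
  have hsm : ContDiff ℝ ∞ fun x => ∑ᶠ k : Fin 2 → ℤ, h (x + lattice k) := by
    rw [← contMDiff_iff_contDiff]
    exact contMDiff_finsum (fun k => (hs.comp (contDiff_id.add contDiff_const)).contMDiff) hfin
  refine ⟨⟨_, hsm, fun l x => ?_⟩, fun x hx => ?_⟩
  · have := finsum_comp_equiv (Equiv.addLeft l) (f := fun k : Fin 2 → ℤ => h (x + lattice k))
    rw [← this]
    simp only [Equiv.coe_addLeft, lattice_add, add_assoc]
  · change ∑ᶠ k : Fin 2 → ℤ, h (x + lattice k) = h x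
    rw [finsum_eq_single _ 0]
    · congr 1
      ext i
      simp [lattice_apply]
    · intro k hk
      by_contra hne
      obtain ⟨i, hi⟩ := Function.ne_iff.1 hk
      have h1 := hsupp (show x + lattice k ∈ Function.support h from hne) i
      rw [PiLp.add_apply, lattice_apply] at h1
      have h2 := hx i
      have h3 : -1 < (k i : ℝ) := by linarith [h1.1, h2.2]
      have h4 : (k i : ℝ) < 1 := by linarith [h1.2, h2.1]
      have h5 : -1 < k i := by exact_mod_cast h3
      have h6 : k i < 1 := by exact_mod_cast h4
      exact hi (by simp; omega)

theorem topologicalClosure_range_toL2 : (LinearMap.range toL2ₗ).topologicalClosure = ⊤ := by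
  have : IsFiniteMeasure torusVol := ⟨by simpa using isCompact_cube.measure_lt_top⟩
  rw [Submodule.topologicalClosure_eq_top_iff, Submodule.eq_bot_iff]
  intro g hg
  rw [Submodule.mem_orthogonal] at hg
  have hae : ∀ᵐ x ∂torusVol, x ∈ openCube → g x = 0 := by
    refine isOpen_openCube.ae_eq_zero_of_integral_contDiff_smul_eq_zero ?_ fun h hh _ hsupp => ?_
    · exact ((Lp.memLp g).integrable (by norm_num)).locallyIntegrable.locallyIntegrableOn _
    · obtain ⟨φ, hφ⟩ := exists_periodization hh ((subset_tsupport h).trans hsupp)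
      have h1 := hg (toL2 φ) ⟨φ, rfl⟩
      rw [L2.inner_def] at h1
      rw [← h1]
      refine integral_congr_ae ?_
      filter_upwards [φ.memLp.coeFn_toLp, ae_restrict_mem isCompact_cube.isClosed.measurableSet]
        with x hx hxc
      have : (toL2 φ : Plane → ℝ) x = φ x := hx
      rw [this, ← hφ x hxc]
      simp [mul_comm]
  refine (Lp.eq_zero_iff_ae_eq_zero).2 ?_
  filter_upwards [hae, ae_mem_openCube] with x h1 h2 using h1 h2

/-- A test function at distance at most `8⁻ⁿ` from `f` in `L²`. -/
lemma exists_approx (f : L2) (n : ℕ) : ∃ φ : TestFn, ‖φ.toL2 - f‖ ≤ (1 / 8 : ℝ) ^ n := by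
  have h : f ∈ closure (LinearMap.range toL2ₗ : Set L2) := by
    rw [← Submodule.topologicalClosure_coe, topologicalClosure_range_toL2]
    trivial
  obtain ⟨_, ⟨φ, rfl⟩, hφ⟩ := Metric.mem_closure_iff.1 h ((1 / 8 : ℝ) ^ n) (by positivity)
  refine ⟨φ, ?_⟩
  rw [dist_comm, dist_eq_norm] at hφ
  exact hφ.le

end TestFn

/-! ### The cylindrical Wiener process extending the processes `M_φ / √2` -/

lemma exists_continuous_limit {u : ℕ → ℝ≥0 → ℝ} (hc : ∀ n, Continuous (u n))
    (h : ∀ᶠ n : ℕ in atTop, ∀ r ≤ (n : ℝ≥0), |u (n + 1) r - u n r| < (1 / 2 : ℝ) ^ n) :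
    ∃ v : ℝ≥0 → ℝ, Continuous v ∧ ∀ r, Tendsto (fun n => u n r) atTop (𝓝 (v r)) := by
  obtain ⟨N₀, hN₀⟩ := eventually_atTop.1 h
  have hgeo : ∀ (N : ℕ), N₀ ≤ N → ∀ r ≤ (N : ℝ≥0), ∀ n,
      dist (u (n + N) r) (u (n + 1 + N) r) ≤ 1 * (1 / 2 : ℝ) ^ n := by
    intro N hN r hr n
    have h1 := hN₀ (n + N) (by omega) r (hr.trans (by exact_mod_cast Nat.le_add_left N n))
    rw [dist_comm, Real.dist_eq, one_mul, show n + 1 + N = n + N + 1 by ring]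
    refine h1.le.trans ?_
    rw [pow_add]
    exact mul_le_of_le_one_right (by positivity) (pow_le_one₀ (by norm_num) (by norm_num))
  have hlim : ∀ r, ∃ x, Tendsto (fun n => u n r) atTop (𝓝 x) := by
    intro r
    obtain ⟨N, hN⟩ := exists_nat_ge r
    have h1 : CauchySeq fun n => u (n + max N₀ N) r := by
      refine cauchySeq_of_le_geometric (1 / 2) 1 (by norm_num)
        (hgeo (max N₀ N) (le_max_left _ _) r (hN.trans ?_))
      exact_mod_cast le_max_right _ _
    obtain ⟨x, hx⟩ := cauchySeq_tendsto_of_complete h1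
    exact ⟨x, (tendsto_add_atTop_iff_nat _).1 hx⟩
  choose v hv using hlim
  refine ⟨v, continuous_iff_continuousAt.2 fun r => ?_, hv⟩
  obtain ⟨N, hN⟩ := exists_nat_gt r
  have hcont : ContinuousOn v (Set.Iic (N : ℝ≥0)) := by
    have hu : TendstoUniformlyOn (fun n r => u (n + max N₀ N) r) v atTop (Set.Iic (N : ℝ≥0)) := by
      rw [Metric.tendstoUniformlyOn_iff]
      intro ε hε
      have h2 : Tendsto (fun n : ℕ => 1 * (1 / 2 : ℝ) ^ n / (1 - 1 / 2)) atTop (𝓝 0) := by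
        simpa using ((tendsto_pow_atTop_nhds_zero_of_lt_one (r := (1 / 2 : ℝ)) (by norm_num)
          (by norm_num)).const_mul 1).div_const (1 - 1 / 2)
      filter_upwards [h2.eventually_lt_const hε] with n hn r hr
      rw [dist_comm]
      refine lt_of_le_of_lt ?_ hn
      refine dist_le_of_le_geometric_of_tendsto (1 / 2) 1 (by norm_num)
        (hgeo (max N₀ N) (le_max_left _ _) r (le_trans (Set.mem_Iic.1 hr) ?_))
        ((tendsto_add_atTop_iff_nat _).2 (hv r)) n
      exact_mod_cast le_max_right _ _
    exact hu.continuousOn (Frequently.of_forall fun n => (hc _).continuousOn)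
  exact hcont.continuousAt (Iic_mem_nhds hN)

/-- An approximating sequence of test functions. -/
def approx (f : L2) (n : ℕ) : TestFn := (exists_approx f n).choose

lemma norm_approx_sub_le (f : L2) (n : ℕ) : ‖(approx f n).toL2 - f‖ ≤ (1 / 8 : ℝ) ^ n :=
  (exists_approx f n).choose_spec

lemma tendsto_approx (f : L2) : Tendsto (fun n => (approx f n).toL2) atTop (𝓝 f) := by
  rw [tendsto_iff_norm_sub_tendsto_zero]
  exact squeeze_zero (fun _ => norm_nonneg _) (norm_approx_sub_le f)
    (tendsto_pow_atTop_nhds_zero_of_lt_one (by norm_num) (by norm_num))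

section

variable {Ω : Type*} [mΩ : MeasurableSpace Ω]

/-- The limit of `M_{φ_n} / √2` along an approximating sequence. -/
def cylW (Z : Ω → Path) (t : ℝ≥0) (f : L2) (ω : Ω) : ℝ :=
  limsup (fun n => martM Z (approx f n) t ω / Real.sqrt 2) atTop

variable {P : Measure Ω} [IsProbabilityMeasure P] {𝓕 : Filtration ℝ≥0 mΩ} {Z : Ω → Path}

lemma ae_eventually_martM_lt (hB : ∀ φ, IsScaledBrownian (martM Z φ) (2 * ‖φ.toL2‖ ^ 2) 𝓕 P)
    (χ : ℕ → TestFn) (hχ : ∀ n, ‖(χ n).toL2‖ ≤ 2 * (1 / 8 : ℝ) ^ n) :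
    ∀ᵐ ω ∂P, ∀ᶠ n : ℕ in atTop, ∀ r ≤ (n : ℝ≥0), |martM Z (χ n) r ω| < (1 / 2 : ℝ) ^ n := by
  have hle : ∀ n : ℕ, P {ω | ∃ r ≤ (n : ℝ≥0), (1 / 2 : ℝ) ^ n ≤ |martM Z (χ n) r ω|}
      ≤ ENNReal.ofReal (8 * (1 / 8 : ℝ) ^ n) := by
    intro n
    refine ((hB (χ n)).measure_exists_ge_le (by positivity) (by positivity) n).trans
      (ENNReal.ofReal_le_ofReal ?_)
    rw [div_le_iff₀ (by positivity)]
    have h1 : ‖(χ n).toL2‖ ^ 2 ≤ (2 * (1 / 8 : ℝ) ^ n) ^ 2 := by gcongr; exact hχ n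
    have h2 : (n : ℝ) ≤ 2 ^ n := by exact_mod_cast Nat.lt_two_pow_self.le
    calc 2 * ‖(χ n).toL2‖ ^ 2 * (n : ℝ≥0) ≤ 2 * (2 * (1 / 8 : ℝ) ^ n) ^ 2 * 2 ^ n := by
          rw [NNReal.coe_natCast]
          gcongr
      _ = 8 * (1 / 8 : ℝ) ^ n * ((1 / 8 : ℝ) ^ n * 2 ^ n) := by ring
      _ = 8 * (1 / 8 : ℝ) ^ n * ((1 / 2 : ℝ) ^ n) ^ 2 := by
          rw [← mul_pow, ← pow_mul, mul_comm n 2, pow_mul]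
          norm_num
  have hsum : ∑' n : ℕ, P {ω | ∃ r ≤ (n : ℝ≥0), (1 / 2 : ℝ) ^ n ≤ |martM Z (χ n) r ω|} ≠ ∞ := by
    refine ne_top_of_le_ne_top ?_ (ENNReal.tsum_le_tsum hle)
    exact ((summable_geometric_of_lt_one (by norm_num) (by norm_num)).mul_left 8).tsum_ofReal_ne_top
  filter_upwards [ae_eventually_notMem hsum] with ω hω
  filter_upwards [hω] with n hn r hr
  by_contra hcon
  exact hn ⟨r, hr, not_lt.1 hcon⟩

lemma ae_cylW (hB : ∀ φ, IsScaledBrownian (martM Z φ) (2 * ‖φ.toL2‖ ^ 2) 𝓕 P) (f : L2) :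
    ∀ᵐ ω ∂P, (Continuous fun t => cylW Z t f ω) ∧
      ∀ t, Tendsto (fun n => martM Z (approx f n) t ω / Real.sqrt 2) atTop (𝓝 (cylW Z t f ω)) := by
  have hχ : ∀ n, ‖(approx f (n + 1) - approx f n).toL2‖ ≤ 2 * (1 / 8 : ℝ) ^ n := by
    intro n
    have h1 : (approx f (n + 1) - approx f n).toL2
        = ((approx f (n + 1)).toL2 - f) - ((approx f n).toL2 - f) := by
      simp only [toL2_eq, map_sub, sub_sub_sub_cancel_right]
    rw [h1, two_mul]
    refine (norm_sub_le _ _).trans (add_le_add ((norm_approx_sub_le f (n + 1)).trans ?_)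
      (norm_approx_sub_le f n))
    exact pow_le_pow_of_le_one (by norm_num) (by norm_num) n.le_succ
  filter_upwards [ae_eventually_martM_lt hB _ hχ] with ω hω
  obtain ⟨v, hv, hlim⟩ := exists_continuous_limit (u := fun n t => martM Z (approx f n) t ω)
    (fun n => continuous_martM Z _ ω) (by
      filter_upwards [hω] with n hn r hr
      have := hn r hr
      rwa [martM_eq, map_sub] at this)
  have h1 : ∀ t, Tendsto (fun n => martM Z (approx f n) t ω / Real.sqrt 2) atTop
      (𝓝 (v t / Real.sqrt 2)) := fun t => (hlim t).div_const _
  have h2 : ∀ t, cylW Z t f ω = v t / Real.sqrt 2 := fun t => (h1 t).limsup_eq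
  simp_rw [h2]
  exact ⟨hv.div_const _, h1⟩

lemma ae_cylW_toL2 (hB : ∀ φ, IsScaledBrownian (martM Z φ) (2 * ‖φ.toL2‖ ^ 2) 𝓕 P) (φ : TestFn) :
    ∀ᵐ ω ∂P, ∀ t, cylW Z t φ.toL2 ω = martM Z φ t ω / Real.sqrt 2 := by
  have hχ : ∀ n, ‖(approx φ.toL2 n - φ).toL2‖ ≤ 2 * (1 / 8 : ℝ) ^ n := by
    intro n
    have h1 : (approx φ.toL2 n - φ).toL2 = (approx φ.toL2 n).toL2 - φ.toL2 := by
      simp only [toL2_eq, map_sub]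
    rw [h1]
    exact (norm_approx_sub_le _ n).trans (le_mul_of_one_le_left (by positivity) (by norm_num))
  filter_upwards [ae_eventually_martM_lt hB _ hχ, ae_cylW hB φ.toL2] with ω h1 h2 t
  have h3 : Tendsto (fun n => martM Z (approx φ.toL2 n) t ω) atTop (𝓝 (martM Z φ t ω)) := by
    rw [tendsto_iff_norm_sub_tendsto_zero]
    refine squeeze_zero' (Eventually.of_forall fun _ => norm_nonneg _) ?_
      (tendsto_pow_atTop_nhds_zero_of_lt_one (r := (1 / 2 : ℝ)) (by norm_num) (by norm_num))
    obtain ⟨N, hN⟩ := exists_nat_ge t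
    filter_upwards [h1, eventually_ge_atTop N] with n hn hNn
    have := hn t (hN.trans (by exact_mod_cast hNn))
    rw [martM_eq, map_sub] at this
    exact this.le
  exact tendsto_nhds_unique (h2.2 t) (h3.div_const _)

lemma measurable_cylW (hB : ∀ φ, IsScaledBrownian (martM Z φ) (2 * ‖φ.toL2‖ ^ 2) 𝓕 P) (t : ℝ≥0)
    (f : L2) : Measurable (cylW Z t f) :=
  Measurable.limsup fun _ => (((hB _).adapted t).mono (𝓕.le t) le_rfl).div_const _

/-- The covariance form of a cylindrical Wiener process. -/
def wienerCov {ι : Type*} (S : Finset ι) (t : ι → ℝ≥0) (f : ι → L2) (c : ι → ℝ) : ℝ :=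
  ∑ j ∈ S, ∑ k ∈ S, c j * c k * ((min (t j) (t k) : ℝ≥0) * inner ℝ (f j) (f k))

lemma incrCov_smul {ι : Type*} (S : Finset ι) (t : ι → ℝ≥0) (f : ι → L2) (c : ι → ℝ) :
    incrCov S t (fun j => (c j / Real.sqrt 2) • f j) 0 = wienerCov S t f c / 2 := by
  have h2 : Real.sqrt 2 * Real.sqrt 2 = 2 := Real.mul_self_sqrt (by norm_num)
  unfold incrCov wienerCov
  rw [Finset.sum_div]
  refine Finset.sum_congr rfl fun j _ => ?_
  rw [Finset.sum_div]
  refine Finset.sum_congr rfl fun k _ => ?_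
  rw [inner_smul_left, inner_smul_right, NNReal.coe_zero, sub_zero]
  simp only [conj_trivial]
  have h3 : c j / Real.sqrt 2 * (c k / Real.sqrt 2) = c j * c k / 2 := by
    rw [div_mul_div_comm, h2]
  linear_combination ((min (t j) (t k) : ℝ≥0) : ℝ) * inner ℝ (f j) (f k) * h3

theorem integral_exp_cylW (hB : ∀ φ, IsScaledBrownian (martM Z φ) (2 * ‖φ.toL2‖ ^ 2) 𝓕 P)
    {ι : Type*} (t : ι → ℝ≥0) (f : ι → L2) (S : Finset ι) (c : ι → ℝ) {Y : Ω → ℂ} {B : ℝ}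
    (hY : StronglyMeasurable[𝓕 0] Y) (hYB : ∀ ω, ‖Y ω‖ ≤ B) :
    ∫ ω, Y ω * Complex.exp (Complex.I * ((∑ j ∈ S, c j * cylW Z (t j) (f j) ω : ℝ) : ℂ)) ∂P
      = Complex.exp (-(wienerCov S t f c / 2 : ℝ)) * ∫ ω, Y ω ∂P := by
  have hn : ∀ n, ∫ ω, Y ω * Complex.exp (Complex.I *
      ((∑ j ∈ S, c j * (martM Z (approx (f j) n) (t j) ω / Real.sqrt 2) : ℝ) : ℂ)) ∂P
      = Complex.exp (-(incrCov S t (fun j => (c j / Real.sqrt 2) • (approx (f j) n).toL2) 0 : ℝ))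
        * ∫ ω, Y ω ∂P := by
    intro n
    have h1 := integral_exp_martM hB t (fun j => (c j / Real.sqrt 2) • approx (f j) n) S 0 Y B
      (fun _ _ => zero_le) hY hYB
    have e1 : ∀ ω, ∑ j ∈ S, (martM Z ((c j / Real.sqrt 2) • approx (f j) n) (t j) ω
        - martM Z ((c j / Real.sqrt 2) • approx (f j) n) 0 ω)
        = ∑ j ∈ S, c j * (martM Z (approx (f j) n) (t j) ω / Real.sqrt 2) := fun ω =>
      Finset.sum_congr rfl fun j _ => by
        rw [martM_zero, martM_eq, map_smul, martM_eq, smul_eq_mul]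
        ring
    have e2 : ∀ j, ((c j / Real.sqrt 2) • approx (f j) n).toL2
        = (c j / Real.sqrt 2) • (approx (f j) n).toL2 := fun j => map_smul toL2ₗ _ _
    simp_rw [e1, e2] at h1
    exact h1
  have hL : Tendsto (fun n => ∫ ω, Y ω * Complex.exp (Complex.I *
      ((∑ j ∈ S, c j * (martM Z (approx (f j) n) (t j) ω / Real.sqrt 2) : ℝ) : ℂ)) ∂P) atTop
      (𝓝 (∫ ω, Y ω * Complex.exp (Complex.I *
        ((∑ j ∈ S, c j * cylW Z (t j) (f j) ω : ℝ) : ℂ)) ∂P)) := by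
    refine tendsto_integral_of_dominated_convergence (fun _ => B) (fun n => ?_)
      (integrable_const _) (fun n => ?_) ?_
    · have hm : Measurable fun ω => ∑ j ∈ S, c j * (martM Z (approx (f j) n) (t j) ω / Real.sqrt 2) :=
        Finset.measurable_sum _ fun j _ =>
          ((((hB _).adapted (t j)).mono (𝓕.le _) le_rfl).div_const _).const_mul _
      have h2 : Continuous fun x : ℝ => Complex.exp (Complex.I * (x : ℂ)) := by fun_prop
      exact (hY.mono (𝓕.le 0)).aestronglyMeasurable.mul
        (h2.measurable.comp hm).aestronglyMeasurable
    · refine ae_of_all _ fun ω => ?_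
      rw [norm_mul, mul_comm Complex.I, Complex.norm_exp_ofReal_mul_I, mul_one]
      exact hYB ω
    · have hall : ∀ᵐ ω ∂P, ∀ j ∈ S, Tendsto (fun n => martM Z (approx (f j) n) (t j) ω / Real.sqrt 2)
          atTop (𝓝 (cylW Z (t j) (f j) ω)) :=
        (Finset.eventually_all S).2 fun j _ => (ae_cylW hB (f j)).mono fun ω hω => hω.2 (t j)
      filter_upwards [hall] with ω hω
      have h3 : Tendsto (fun n => ∑ j ∈ S, c j * (martM Z (approx (f j) n) (t j) ω / Real.sqrt 2))
          atTop (𝓝 (∑ j ∈ S, c j * cylW Z (t j) (f j) ω)) :=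
        tendsto_finsetSum _ fun j hj => (hω j hj).const_mul _
      have h2 : Continuous fun x : ℝ => Y ω * Complex.exp (Complex.I * (x : ℂ)) := by fun_prop
      exact (h2.tendsto _).comp h3
  have hR : Tendsto (fun n => Complex.exp (-(incrCov S t
      (fun j => (c j / Real.sqrt 2) • (approx (f j) n).toL2) 0 : ℝ)) * ∫ ω, Y ω ∂P) atTop
      (𝓝 (Complex.exp (-(wienerCov S t f c / 2 : ℝ)) * ∫ ω, Y ω ∂P)) := by
    rw [← incrCov_smul]
    have h1 : Tendsto (fun n => incrCov S t
        (fun j => (c j / Real.sqrt 2) • (approx (f j) n).toL2) 0) atTop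
        (𝓝 (incrCov S t (fun j => (c j / Real.sqrt 2) • f j) 0)) := by
      refine tendsto_finsetSum _ fun j _ => tendsto_finsetSum _ fun k _ => ?_
      exact (((tendsto_approx (f j)).const_smul _).inner
        ((tendsto_approx (f k)).const_smul _)).const_mul _
    have h2 : Continuous fun x : ℝ => Complex.exp (-(x : ℂ)) * ∫ ω, Y ω ∂P := by fun_prop
    have h3 := (h2.tendsto _).comp h1
    exact h3
  simp_rw [hn] at hL
  exact tendsto_nhds_unique hL hR

end

/-! ### Gaussian families from characteristic functions -/

section

variable {Ω : Type*} [mΩ : MeasurableSpace Ω] {P : Measure Ω} [IsProbabilityMeasure P]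

lemma hasLaw_gaussianReal_of_exp {X : Ω → ℝ} (hX : Measurable X) {w : ℝ}
    (h : ∀ l : ℝ, ∫ ω, Complex.exp (Complex.I * ((l * X ω : ℝ) : ℂ)) ∂P
      = Complex.exp (-(l ^ 2 * w / 2 : ℝ))) :
    0 ≤ w ∧ HasLaw X (gaussianReal 0 w.toNNReal) P := by
  have hw : 0 ≤ w := by
    have h1 := norm_integral_le_of_norm_le_const (μ := P) (C := 1)
      (f := fun ω => Complex.exp (Complex.I * ((1 * X ω : ℝ) : ℂ))) (ae_of_all _ fun ω => by
        rw [mul_comm Complex.I, Complex.norm_exp_ofReal_mul_I])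
    rw [h, ← Complex.ofReal_neg, Complex.norm_exp_ofReal, probReal_univ, one_mul, Real.exp_le_one_iff] at h1
    linarith
  refine ⟨hw, ⟨hX.aemeasurable, ?_⟩⟩
  have : IsProbabilityMeasure (P.map X) := Measure.isProbabilityMeasure_map hX.aemeasurable
  refine Measure.ext_of_charFun ?_
  ext l
  rw [charFun_apply_real, charFun_gaussianReal, integral_map hX.aemeasurable (by fun_prop)]
  have h2 := h l
  have e1 : ∀ ω, Complex.exp ((l : ℂ) * X ω * Complex.I)
      = Complex.exp (Complex.I * ((l * X ω : ℝ) : ℂ)) := fun ω => by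
    congr 1
    push_cast
    ring
  simp_rw [e1]
  rw [h2]
  congr 1
  have h3 : ((w.toNNReal : ℝ≥0) : ℂ) = ((w : ℝ) : ℂ) := by
    rw [← Real.coe_toNNReal w hw]
    simp
  rw [h3]
  push_cast
  ring

lemma exists_coeff {T : Type*} (I : Finset T) (L : StrongDual ℝ (I → ℝ)) :
    ∃ c : T → ℝ, ∀ x : T → ℝ, L (I.restrict x) = ∑ p ∈ I, c p * x p := by
  classical
  refine ⟨fun p => if h : p ∈ I then L (fun j => if (⟨p, h⟩ : I) = j then 1 else 0) else 0,
    fun x => ?_⟩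
  have h1 := LinearMap.pi_apply_eq_sum_univ (L : (I → ℝ) →ₗ[ℝ] ℝ) (I.restrict x)
  rw [← Finset.sum_coe_sort]
  refine h1.trans (Finset.sum_congr rfl fun i _ => ?_)
  simp [Finset.restrict, mul_comm]

/-- The variance of a linear combination. -/
def quadForm {T : Type*} (K : T → T → ℝ) (S : Finset T) (c : T → ℝ) : ℝ :=
  ∑ p ∈ S, ∑ q ∈ S, c p * c q * K p q

variable {T : Type*} {W : T → Ω → ℝ} {K : T → T → ℝ}

lemma hasLaw_linearCombination (hW : ∀ p, Measurable (W p))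
    (h : ∀ (S : Finset T) (c : T → ℝ),
      ∫ ω, Complex.exp (Complex.I * ((∑ p ∈ S, c p * W p ω : ℝ) : ℂ)) ∂P
        = Complex.exp (-(quadForm K S c / 2 : ℝ)))
    (S : Finset T) (c : T → ℝ) :
    0 ≤ quadForm K S c ∧
      HasLaw (fun ω => ∑ p ∈ S, c p * W p ω) (gaussianReal 0 (quadForm K S c).toNNReal) P := by
  refine hasLaw_gaussianReal_of_exp (Finset.measurable_sum _ fun p _ => (hW p).const_mul _)
    fun l => ?_
  have h1 := h S (fun p => l * c p)
  have e : quadForm K S (fun p => l * c p) = l ^ 2 * quadForm K S c := by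
    unfold quadForm
    simp_rw [Finset.mul_sum]
    exact Finset.sum_congr rfl fun p _ => Finset.sum_congr rfl fun q _ => by ring
  rw [e] at h1
  rw [← h1]
  simp_rw [Finset.mul_sum, mul_assoc]

lemma isGaussianProcess_of_exp (hW : ∀ p, Measurable (W p))
    (h : ∀ (S : Finset T) (c : T → ℝ),
      ∫ ω, Complex.exp (Complex.I * ((∑ p ∈ S, c p * W p ω : ℝ) : ℂ)) ∂P
        = Complex.exp (-(quadForm K S c / 2 : ℝ))) : IsGaussianProcess W P where
  hasGaussianLaw I := by
    have hm : Measurable fun ω => I.restrict (W · ω) := measurable_pi_lambda _ fun i => hW i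
    refine ⟨isGaussian_of_isGaussian_map fun L => ?_⟩
    obtain ⟨c, hc⟩ := exists_coeff I L
    rw [Measure.map_map L.continuous.measurable hm]
    have e : (L ∘ fun ω => I.restrict (W · ω)) = fun ω => ∑ p ∈ I, c p * W p ω :=
      funext fun ω => hc _
    rw [e, (hasLaw_linearCombination hW h I c).2.map_eq]
    infer_instance

lemma integral_eq_zero_of_exp (hW : ∀ p, Measurable (W p))
    (h : ∀ (S : Finset T) (c : T → ℝ),
      ∫ ω, Complex.exp (Complex.I * ((∑ p ∈ S, c p * W p ω : ℝ) : ℂ)) ∂P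
        = Complex.exp (-(quadForm K S c / 2 : ℝ)))
    (p : T) : ∫ ω, W p ω ∂P = 0 := by
  have h1 := (hasLaw_linearCombination hW h {p} fun _ => 1).2.integral_eq
  simpa using h1

lemma covariance_eq_of_exp (hW : ∀ p, Measurable (W p))
    (h : ∀ (S : Finset T) (c : T → ℝ),
      ∫ ω, Complex.exp (Complex.I * ((∑ p ∈ S, c p * W p ω : ℝ) : ℂ)) ∂P
        = Complex.exp (-(quadForm K S c / 2 : ℝ)))
    (hK : ∀ p q, K p q = K q p) (p q : T) : cov[W p, W q; P] = K p q := by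
  classical
  have hg := isGaussianProcess_of_exp hW h
  have hmem : ∀ p, MemLp (W p) 2 P := fun p => (hg.hasGaussianLaw_eval p).memLp_two
  have hvar : ∀ S : Finset T, Var[fun ω => ∑ p ∈ S, W p ω; P] = quadForm K S fun _ => 1 := by
    intro S
    obtain ⟨h0, h1⟩ := hasLaw_linearCombination hW h S fun _ => 1
    have h2 := h1.variance_eq
    rw [variance_id_gaussianReal, Real.coe_toNNReal _ h0] at h2
    simpa using h2
  have hone : ∀ p, Var[W p; P] = K p p := fun p => by
    have := hvar {p}
    simpa [quadForm] using this
  by_cases hpq : p = q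
  · subst hpq
    rw [covariance_self (hW p).aemeasurable, hone]
  · have h1 := hvar {p, q}
    have h2 : (fun ω => ∑ r ∈ ({p, q} : Finset T), W r ω) = W p + W q := by
      funext ω
      rw [Finset.sum_pair hpq]
      rfl
    rw [h2, variance_add (hmem p) (hmem q), hone, hone] at h1
    simp only [quadForm, Finset.sum_pair hpq, one_mul] at h1
    linarith [hK p q]

end

section

variable {Ω : Type*} [mΩ : MeasurableSpace Ω] {P : Measure Ω} [IsProbabilityMeasure P]

lemma indep_of_exp {T : Type*} {W : T → Ω → ℝ} (hW : ∀ p, Measurable (W p)) {E : Type*}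
    [MeasurableSpace E] {X : Ω → E} (hX : Measurable X)
    (h : ∀ (S : Finset T) (c : T → ℝ) (A : Set E), MeasurableSet A →
      ∫ ω, (X ⁻¹' A).indicator (fun _ => (1 : ℂ)) ω *
          Complex.exp (Complex.I * ((∑ p ∈ S, c p * W p ω : ℝ) : ℂ)) ∂P
        = (∫ ω, Complex.exp (Complex.I * ((∑ p ∈ S, c p * W p ω : ℝ) : ℂ)) ∂P)
          * ∫ ω, (X ⁻¹' A).indicator (fun _ => (1 : ℂ)) ω ∂P) :
    IndepFun X (fun ω p => W p ω) P := by
  refine IndepFun.indepFun_process hX hW fun I => ?_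
  have hm : Measurable fun ω => I.restrict (W · ω) := measurable_pi_lambda _ fun i => hW i
  rw [indepFun_iff_measure_inter_preimage_eq_mul]
  intro A B hA hB
  have hmA : MeasurableSet (X ⁻¹' A) := hX hA
  have key : (P.restrict (X ⁻¹' A)).map (fun ω => I.restrict (W · ω))
      = P (X ⁻¹' A) • P.map fun ω => I.restrict (W · ω) := by
    have hfin : IsFiniteMeasure (P (X ⁻¹' A) • P.map fun ω => I.restrict (W · ω)) :=
      Measure.smul_finite _ (measure_ne_top _ _)
    refine Measure.ext_of_charFunDual ?_
    ext L
    obtain ⟨c, hc⟩ := exists_coeff I L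
    have e : ∀ ω, Complex.exp ((L (I.restrict (W · ω)) : ℂ) * Complex.I)
        = Complex.exp (Complex.I * ((∑ p ∈ I, c p * W p ω : ℝ) : ℂ)) := fun ω => by
      rw [hc, mul_comm]
    have h1 := h I c A hA
    rw [charFunDual_apply, charFunDual_apply, integral_smul_measure,
      integral_map hm.aemeasurable (by fun_prop), integral_map hm.aemeasurable (by fun_prop)]
    simp_rw [e]
    rw [integral_indicator hmA, setIntegral_const] at h1
    rw [← integral_indicator hmA]
    have e2 : ∀ ω, (X ⁻¹' A).indicator
        (fun ω => Complex.exp (Complex.I * ((∑ p ∈ I, c p * W p ω : ℝ) : ℂ))) ω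
        = (X ⁻¹' A).indicator (fun _ => (1 : ℂ)) ω *
          Complex.exp (Complex.I * ((∑ p ∈ I, c p * W p ω : ℝ) : ℂ)) := fun ω => by
      by_cases hω : ω ∈ X ⁻¹' A <;> simp [hω]
    simp_rw [e2]
    rw [h1, mul_comm]
    simp [Measure.real]
  have h2 := congrArg (fun μ => μ B) key
  simp only [Measure.smul_apply, smul_eq_mul] at h2
  rw [Measure.map_apply hm hB, Measure.map_apply hm hB, Measure.restrict_apply (hm hB),
    Set.inter_comm] at h2
  exact h2

end

/-! ### `W` is a cylindrical Wiener process -/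

section

variable {Ω : Type*} [mΩ : MeasurableSpace Ω] {P : Measure Ω} [IsProbabilityMeasure P]
  {𝓕 : Filtration ℝ≥0 mΩ} {Z : Ω → Path}

theorem isCylindricalWiener_cylW
    (hB : ∀ φ, IsScaledBrownian (martM Z φ) (2 * ‖φ.toL2‖ ^ 2) 𝓕 P) :
    IsCylindricalWiener (cylW Z) P := by
  have hm : ∀ p : ℝ≥0 × L2, Measurable fun ω => cylW Z p.1 p.2 ω := fun p =>
    measurable_cylW hB p.1 p.2
  have hexp : ∀ (S : Finset (ℝ≥0 × L2)) (c : ℝ≥0 × L2 → ℝ),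
      ∫ ω, Complex.exp (Complex.I * ((∑ p ∈ S, c p * cylW Z p.1 p.2 ω : ℝ) : ℂ)) ∂P
      = Complex.exp (-(quadForm (fun p q : ℝ≥0 × L2 => (min p.1 q.1 : ℝ≥0) * inner ℝ p.2 q.2) S c / 2 : ℝ)) := by
    intro S c
    have := integral_exp_cylW hB (fun p : ℝ≥0 × L2 => p.1) (fun p => p.2) S c (Y := fun _ => 1)
      (B := 1) stronglyMeasurable_const (fun _ => by simp)
    simp only [one_mul, integral_const, probReal_univ, one_smul, mul_one] at this
    exact this
  exact
    { measurable := measurable_cylW hB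
      gaussian := isGaussianProcess_of_exp hm hexp
      mean_zero := fun t f => integral_eq_zero_of_exp hm hexp (t, f)
      covariance := fun s t f g => by
        have := covariance_eq_of_exp hm hexp
          (fun p q => by rw [min_comm, real_inner_comm]) (s, f) (t, g)
        simpa using this
      continuous_paths := fun f => (ae_cylW hB f).mono fun ω hω => hω.1 }

theorem indepFun_cylW (hB : ∀ φ, IsScaledBrownian (martM Z φ) (2 * ‖φ.toL2‖ ^ 2) 𝓕 P)
    (hZ : Measurable[𝓕 0] fun ω => Z ω 0) :
    IndepFun (fun ω => Z ω 0) (fun ω (p : ℝ≥0 × L2) => cylW Z p.1 p.2 ω) P := by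
  have hm : ∀ p : ℝ≥0 × L2, Measurable fun ω => cylW Z p.1 p.2 ω := fun p =>
    measurable_cylW hB p.1 p.2
  refine indep_of_exp (W := fun (p : ℝ≥0 × L2) ω => cylW Z p.1 p.2 ω) hm
    (X := fun ω => Z ω 0) (hZ.mono (𝓕.le 0) le_rfl) fun S c A hA => ?_
  have h1 := integral_exp_cylW hB (fun p : ℝ≥0 × L2 => p.1) (fun p => p.2) S c (Y := fun _ => 1)
      (B := 1) stronglyMeasurable_const (fun _ => by simp)
  have hA' : MeasurableSet[𝓕 0] ((fun ω => Z ω 0) ⁻¹' A) := hZ hA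
  have hsm : StronglyMeasurable[𝓕 0] (((fun ω => Z ω 0) ⁻¹' A).indicator fun _ => (1 : ℂ)) :=
    StronglyMeasurable.indicator stronglyMeasurable_const hA'
  have hb : ∀ ω, ‖((fun ω => Z ω 0) ⁻¹' A).indicator (fun _ => (1 : ℂ)) ω‖ ≤ 1 := fun ω =>
    (norm_indicator_le_norm_self (fun _ => (1 : ℂ)) ω).trans norm_one.le
  have h2 := integral_exp_cylW hB (fun p : ℝ≥0 × L2 => p.1) (fun p => p.2) S c hsm hb
  simp only [one_mul, integral_const, probReal_univ, one_smul, mul_one] at h1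
  rw [h2, h1]

end

/-! ### The Wiener isometry -/

lemma integral_norm_sq_eq {α E : Type*} [MeasurableSpace α] [NormedAddCommGroup E] {μ : Measure α}
    {f : α → E} (hf : MemLp f 2 μ) : ∫ x, ‖f x‖ ^ 2 ∂μ = (eLpNorm f 2 μ).toReal ^ 2 := by
  have h := hf.eLpNorm_eq_integral_rpow_norm (by norm_num) (by norm_num)
  have h0 : 0 ≤ ∫ x, ‖f x‖ ^ (2 : ℝ≥0∞).toReal ∂μ := integral_nonneg fun x => by positivity
  rw [h, ENNReal.toReal_ofReal (Real.rpow_nonneg h0 _)]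
  simp only [ENNReal.toReal_ofNat] at h0 ⊢
  rw [← Real.rpow_natCast, ← Real.rpow_mul h0]
  norm_num

/-- The indicator of `(0, t]` times `f`. -/
def timeInd (t : ℝ≥0) (f : L2) (s : ℝ) : L2 := (Set.Ioc (0 : ℝ) t).indicator (fun _ => f) s

lemma memLp_timeInd (t : ℝ≥0) (f : L2) : MemLp (timeInd t f) 2 volume :=
  memLp_indicator_const 2 measurableSet_Ioc f (Or.inr (by simp))

lemma inner_timeInd (s t : ℝ≥0) (f g : L2) (r : ℝ) :
    inner ℝ (timeInd s f r) (timeInd t g r)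
      = (Set.Ioc (0 : ℝ) (min s t : ℝ≥0)).indicator (fun _ => (inner ℝ f g : ℝ)) r := by
  rw [NNReal.coe_min]
  by_cases h1 : r ∈ Set.Ioc (0 : ℝ) s <;> by_cases h2 : r ∈ Set.Ioc (0 : ℝ) t
  · have h3 : r ∈ Set.Ioc (0 : ℝ) (min (s : ℝ) t) := ⟨h1.1, le_min h1.2 h2.2⟩
    simp [timeInd, h1, h2, h3]
  · have h3 : r ∉ Set.Ioc (0 : ℝ) (min (s : ℝ) t) := fun h => h2 ⟨h.1, h.2.trans (min_le_right _ _)⟩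
    simp [timeInd, h2, h3]
  · have h3 : r ∉ Set.Ioc (0 : ℝ) (min (s : ℝ) t) := fun h => h1 ⟨h.1, h.2.trans (min_le_left _ _)⟩
    simp [timeInd, h1, h3]
  · have h3 : r ∉ Set.Ioc (0 : ℝ) (min (s : ℝ) t) := fun h => h1 ⟨h.1, h.2.trans (min_le_left _ _)⟩
    simp [timeInd, h1, h3]

lemma integral_inner_timeInd (s t : ℝ≥0) (f g : L2) :
    ∫ r, inner ℝ (timeInd s f r) (timeInd t g r) = (min s t : ℝ≥0) * inner ℝ f g := by
  simp_rw [inner_timeInd]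
  rw [integral_indicator_const _ measurableSet_Ioc, Real.volume_real_Ioc_of_le (NNReal.coe_nonneg _),
    sub_zero, smul_eq_mul]

lemma integrable_inner_timeInd (s t : ℝ≥0) (f g : L2) :
    Integrable fun r => (inner ℝ (timeInd s f r) (timeInd t g r) : ℝ) := by
  simp_rw [inner_timeInd]
  exact (integrable_indicator_iff measurableSet_Ioc).2 (integrableOn_const (by simp))

lemma integral_norm_sq_sum_timeInd (S : Finset (ℝ≥0 × L2)) (c : ℝ≥0 × L2 → ℝ) :
    ∫ r, ‖∑ p ∈ S, c p • timeInd p.1 p.2 r‖ ^ 2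
      = quadForm (fun p q : ℝ≥0 × L2 => (min p.1 q.1 : ℝ≥0) * inner ℝ p.2 q.2) S c := by
  have h : ∀ r, ‖∑ p ∈ S, c p • timeInd p.1 p.2 r‖ ^ 2
      = ∑ p ∈ S, ∑ q ∈ S, c p * c q * inner ℝ (timeInd p.1 p.2 r) (timeInd q.1 q.2 r) := by
    intro r
    rw [← real_inner_self_eq_norm_sq, sum_inner]
    refine Finset.sum_congr rfl fun p _ => ?_
    rw [inner_sum]
    refine Finset.sum_congr rfl fun q _ => ?_
    rw [real_inner_smul_left, real_inner_smul_right, mul_assoc]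
  simp_rw [h]
  rw [integral_finsetSum _ fun p _ => integrable_finsetSum _ fun q _ =>
    (integrable_inner_timeInd _ _ _ _).const_mul _]
  refine Finset.sum_congr rfl fun p _ => ?_
  rw [integral_finsetSum _ fun q _ => (integrable_inner_timeInd _ _ _ _).const_mul _]
  refine Finset.sum_congr rfl fun q _ => ?_
  rw [integral_const_mul, integral_inner_timeInd]

section

variable {Ω : Type*} [mΩ : MeasurableSpace Ω]

/-- The graph of the Wiener integral on step integrands. -/
def wienerPairs (W : ℝ≥0 → L2 → Ω → ℝ) : Submodule ℝ ((Ω → ℝ) × (ℝ → L2)) :=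
  Submodule.span ℝ (Set.range fun p : ℝ≥0 × L2 => (W p.1 p.2, timeInd p.1 p.2))

lemma exists_sum_of_mem_wienerPairs {W : ℝ≥0 → L2 → Ω → ℝ} {x : (Ω → ℝ) × (ℝ → L2)}
    (hx : x ∈ wienerPairs W) : ∃ (S : Finset (ℝ≥0 × L2)) (c : ℝ≥0 × L2 → ℝ),
      (∀ ω, x.1 ω = ∑ p ∈ S, c p * W p.1 p.2 ω) ∧ ∀ r, x.2 r = ∑ p ∈ S, c p • timeInd p.1 p.2 r := by
  obtain ⟨c, hc⟩ := (Finsupp.mem_span_range_iff_exists_finsupp).1 hx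
  refine ⟨c.support, c, fun ω => ?_, fun r => ?_⟩
  · rw [← hc, Finsupp.sum, Prod.fst_sum]
    simp [Finset.sum_apply]
  · rw [← hc, Finsupp.sum, Prod.snd_sum]
    simp [Finset.sum_apply]

lemma memLp_snd_wienerPairs {W : ℝ≥0 → L2 → Ω → ℝ} {x : (Ω → ℝ) × (ℝ → L2)}
    (hx : x ∈ wienerPairs W) : MemLp x.2 2 volume := by
  obtain ⟨S, c, -, h2⟩ := exists_sum_of_mem_wienerPairs hx
  have : x.2 = fun r => ∑ p ∈ S, c p • timeInd p.1 p.2 r := funext h2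
  rw [this]
  exact memLp_finsetSum _ fun p _ => (memLp_timeInd p.1 p.2).const_smul (c p)

lemma exists_measurable_of_mem_wienerPairs {W : ℝ≥0 → L2 → Ω → ℝ} {x : (Ω → ℝ) × (ℝ → L2)}
    (hx : x ∈ wienerPairs W) : ∃ F : (ℝ≥0 × L2 → ℝ) → ℝ, Measurable F ∧
      ∀ ω, x.1 ω = F fun p => W p.1 p.2 ω := by
  obtain ⟨S, c, h1, -⟩ := exists_sum_of_mem_wienerPairs hx
  exact ⟨fun w => ∑ p ∈ S, c p * w p,
    Finset.measurable_sum _ fun p _ => (measurable_pi_apply p).const_mul _, h1⟩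

variable {P : Measure Ω} [IsProbabilityMeasure P] {W : ℝ≥0 → L2 → Ω → ℝ}

lemma hasLaw_wienerPairs (hW : IsCylindricalWiener W P) {x : (Ω → ℝ) × (ℝ → L2)}
    (hx : x ∈ wienerPairs W) :
    HasLaw x.1 (gaussianReal 0 ((eLpNorm x.2 2 volume).toReal ^ 2).toNNReal) P := by
  obtain ⟨S, c, h1, h2⟩ := exists_sum_of_mem_wienerPairs hx
  have hmem : ∀ p : ℝ≥0 × L2, MemLp (fun ω => W p.1 p.2 ω) 2 P := fun p =>
    (hW.gaussian.hasGaussianLaw_eval p).memLp_two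
  have e1 : x.1 = fun ω => ∑ p ∈ S, c p * W p.1 p.2 ω := funext h1
  have e2 : ∀ r, ‖x.2 r‖ ^ 2 = ‖∑ p ∈ S, c p • timeInd p.1 p.2 r‖ ^ 2 := fun r => by rw [h2]
  have hg : HasGaussianLaw x.1 P := by
    let L : (S → ℝ) →L[ℝ] ℝ := ∑ i : S, c i • ContinuousLinearMap.proj i
    have := (hW.gaussian.hasGaussianLaw S).map_fun L
    refine this.congr (ae_of_all _ fun ω => ?_)
    rw [e1]
    simp only [L, _root_.sum_apply, _root_.smul_apply, ContinuousLinearMap.proj_apply,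
      Finset.restrict, smul_eq_mul]
    exact Finset.sum_coe_sort S fun p => c p * W p.1 p.2 ω
  refine ⟨hg.aemeasurable, ?_⟩
  have hmean : ∫ ω, x.1 ω ∂P = 0 := by
    rw [e1, integral_finsetSum _ fun p _ => ((hmem p).integrable one_le_two).const_mul _]
    refine Finset.sum_eq_zero fun p _ => ?_
    rw [integral_const_mul, hW.mean_zero, mul_zero]
  have hvar : Var[x.1; P] = (eLpNorm x.2 2 volume).toReal ^ 2 := by
    rw [← integral_norm_sq_eq (memLp_snd_wienerPairs hx)]
    simp_rw [e2]
    rw [integral_norm_sq_sum_timeInd, e1, ← covariance_self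
      (Finset.aemeasurable_fun_sum _ fun p _ => ((hmem p).const_mul _).aemeasurable),
      covariance_fun_sum_fun_sum' (fun p _ => (hmem p).const_mul _) fun p _ => (hmem p).const_mul _]
    unfold quadForm
    refine Finset.sum_congr rfl fun p _ => Finset.sum_congr rfl fun q _ => ?_
    rw [covariance_const_mul_left, covariance_const_mul_right, hW.covariance]
    simp only [NNReal.coe_min]
    ring
  rw [hg.map_eq_gaussianReal, hmean, hvar]

lemma memLp_fst_wienerPairs (hW : IsCylindricalWiener W P) {x : (Ω → ℝ) × (ℝ → L2)}
    (hx : x ∈ wienerPairs W) : MemLp x.1 2 P :=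
  (hasLaw_wienerPairs hW hx).hasGaussianLaw.memLp_two

theorem eLpNorm_wienerPairs (hW : IsCylindricalWiener W P) {x : (Ω → ℝ) × (ℝ → L2)}
    (hx : x ∈ wienerPairs W) : eLpNorm x.1 2 P = eLpNorm x.2 2 volume := by
  have hl := hasLaw_wienerPairs hW hx
  have hm := memLp_fst_wienerPairs hW hx
  have h1 : Var[x.1; P] = (eLpNorm x.2 2 volume).toReal ^ 2 := by
    rw [hl.variance_eq, variance_id_gaussianReal, Real.coe_toNNReal _ (by positivity)]
  have h2 : ∫ ω, x.1 ω ∂P = 0 := by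
    rw [hl.integral_eq]
    simp
  rw [variance_of_integral_eq_zero hm.aemeasurable h2] at h1
  have h3 := integral_norm_sq_eq hm
  simp only [Real.norm_eq_abs, sq_abs] at h3
  rw [h3] at h1
  have h4 := (sq_eq_sq₀ ENNReal.toReal_nonneg ENNReal.toReal_nonneg).1 h1
  exact (ENNReal.toReal_eq_toReal_iff' hm.eLpNorm_ne_top
    (memLp_snd_wienerPairs hx).eLpNorm_ne_top).1 h4

lemma integral_exp_wienerPairs (hW : IsCylindricalWiener W P) {x : (Ω → ℝ) × (ℝ → L2)}
    (hx : x ∈ wienerPairs W) (l : ℝ) :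
    ∫ ω, Complex.exp (Complex.I * ((l * x.1 ω : ℝ) : ℂ)) ∂P
      = Complex.exp (-(l ^ 2 * (eLpNorm x.2 2 volume).toReal ^ 2 / 2 : ℝ)) := by
  have hl := hasLaw_wienerPairs hW hx
  have h1 := charFun_gaussianReal (μ := 0) (v := ((eLpNorm x.2 2 volume).toReal ^ 2).toNNReal) l
  rw [← hl.map_eq, charFun_apply_real, integral_map hl.aemeasurable (by fun_prop)] at h1
  have e : ∀ ω, Complex.exp (Complex.I * ((l * x.1 ω : ℝ) : ℂ))
      = Complex.exp ((l : ℂ) * x.1 ω * Complex.I) := fun ω => by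
    congr 1
    push_cast
    ring
  simp_rw [e]
  rw [h1]
  congr 1
  have h3 : ((((eLpNorm x.2 2 volume).toReal ^ 2).toNNReal : ℝ≥0) : ℂ)
      = (((eLpNorm x.2 2 volume).toReal ^ 2 : ℝ) : ℂ) := by
    rw [← Real.coe_toNNReal ((eLpNorm x.2 2 volume).toReal ^ 2) (by positivity)]
    simp
  rw [h3]
  push_cast
  ring

lemma indicator_Ioc_toNNReal {a b : ℝ≥0} (hab : a ≤ b) (f : L2) (s : ℝ) :
    (Set.Ioc a b).indicator (fun _ => f) s.toNNReal = timeInd b f s - timeInd a f s := by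
  have hab' : (a : ℝ) ≤ b := by exact_mod_cast hab
  by_cases h1 : a < s.toNNReal
  · have h1' : (a : ℝ) < s := Real.lt_toNNReal_iff_coe_lt.1 h1
    have ha : s ∉ Set.Ioc (0 : ℝ) a := fun h => absurd h.2 (not_le.2 h1')
    by_cases h2 : s.toNNReal ≤ b
    · have h2' : s ∈ Set.Ioc (0 : ℝ) b :=
        ⟨lt_of_le_of_lt a.2 h1', Real.toNNReal_le_iff_le_coe.1 h2⟩
      have h3 : s.toNNReal ∈ Set.Ioc a b := ⟨h1, h2⟩
      rw [timeInd, timeInd, Set.indicator_of_mem h3,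
        Set.indicator_of_mem h2', Set.indicator_of_notMem ha, sub_zero]
    · have h2' : s ∉ Set.Ioc (0 : ℝ) b := fun h => h2 (Real.toNNReal_le_iff_le_coe.2 h.2)
      rw [timeInd, timeInd, Set.indicator_of_notMem (fun h => h2 h.2),
        Set.indicator_of_notMem h2', Set.indicator_of_notMem ha, sub_zero]
  · have h1' : s ≤ a := Real.toNNReal_le_iff_le_coe.1 (not_lt.1 h1)
    rw [timeInd, timeInd, Set.indicator_of_notMem (fun h => h1 h.1)]
    by_cases h0 : 0 < s
    · have h2 : s ∈ Set.Ioc (0 : ℝ) b := ⟨h0, h1'.trans hab'⟩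
      have h3 : s ∈ Set.Ioc (0 : ℝ) a := ⟨h0, h1'⟩
      rw [Set.indicator_of_mem h2, Set.indicator_of_mem h3, sub_self]
    · rw [Set.indicator_of_notMem (fun h => h0 h.1), Set.indicator_of_notMem (fun h => h0 h.1),
        sub_self]

lemma stepIntegral_mem_wienerPairs (W : ℝ≥0 → L2 → Ω → ℝ) (n : ℕ) {τ : ℕ → ℝ≥0} (hτ : Monotone τ)
    (h : ℕ → L2) :
    (stepIntegral W n τ h, fun s : ℝ => stepFn n τ h s.toNNReal) ∈ wienerPairs W := by
  have e : (stepIntegral W n τ h, fun s : ℝ => stepFn n τ h s.toNNReal)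
      = ∑ i ∈ Finset.range n, ((W (τ (i + 1)) (h i), timeInd (τ (i + 1)) (h i))
        - (W (τ i) (h i), timeInd (τ i) (h i))) := by
    refine Prod.ext ?_ ?_
    · funext ω
      rw [Prod.fst_sum]
      simp [stepIntegral, Finset.sum_apply]
    · funext s
      rw [Prod.snd_sum]
      simp only [stepFn, Prod.snd_sub, Finset.sum_apply, Pi.sub_apply]
      exact Finset.sum_congr rfl fun i _ => indicator_Ioc_toNNReal (hτ i.le_succ) _ _
  rw [e]
  refine Submodule.sum_mem _ fun i _ => Submodule.sub_mem _ ?_ ?_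
  · exact Submodule.subset_span ⟨(τ (i + 1), h i), rfl⟩
  · exact Submodule.subset_span ⟨(τ i, h i), rfl⟩

lemma stepFn_eq_zero {n : ℕ} {τ : ℕ → ℝ≥0} {t : ℝ≥0} (ht : ∀ i, τ i ≤ t) (h : ℕ → L2) {s : ℝ}
    (hs : s ∉ Set.Icc (0 : ℝ) t) : stepFn n τ h s.toNNReal = 0 := by
  refine Finset.sum_eq_zero fun i _ => Set.indicator_of_notMem (fun hi => hs ?_) _
  have h0 : 0 < s := Real.toNNReal_pos.1 (lt_of_le_of_lt zero_le hi.1)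
  exact ⟨h0.le, Real.toNNReal_le_iff_le_coe.1 (hi.2.trans (ht _))⟩

lemma eLpNorm_stepFn_sub {n : ℕ} {τ : ℕ → ℝ≥0} {t : ℝ≥0} (ht : ∀ i, τ i ≤ t) (h : ℕ → L2)
    (f : ℝ → L2) :
    eLpNorm (fun s : ℝ => stepFn n τ h s.toNNReal - (Set.Icc (0 : ℝ) t).indicator f s) 2 volume
      = eLpNorm (fun s : ℝ => stepFn n τ h s.toNNReal - f s) 2
        (volume.restrict (Set.Icc (0 : ℝ) t)) := by
  rw [← eLpNorm_indicator_eq_eLpNorm_restrict measurableSet_Icc]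
  congr 1
  funext s
  by_cases hs : s ∈ Set.Icc (0 : ℝ) t
  · simp [hs]
  · simp [hs, stepFn_eq_zero ht h hs]

end

/-! ### The law of a solution -/

lemma tendsto_eLpNorm_sum_sub {α E ι : Type*} [MeasurableSpace α] {μ : Measure α}
    [NormedAddCommGroup E] [NormedSpace ℝ E] (S : Finset ι) (c : ι → ℝ) {u : ι → ℕ → α → E}
    {v : ι → α → E} (hm : ∀ p m, AEStronglyMeasurable (fun x => u p m x - v p x) μ)
    (h : ∀ p, Tendsto (fun m => eLpNorm (fun x => u p m x - v p x) 2 μ) atTop (𝓝 0)) :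
    Tendsto (fun m => eLpNorm (fun x => ∑ p ∈ S, c p • u p m x - ∑ p ∈ S, c p • v p x) 2 μ) atTop
      (𝓝 0) := by
  have hlim : Tendsto (fun m => ∑ p ∈ S, ‖c p‖ₑ * eLpNorm (fun x => u p m x - v p x) 2 μ) atTop
      (𝓝 0) := by
    have : Tendsto (fun m => ∑ p ∈ S, ‖c p‖ₑ * eLpNorm (fun x => u p m x - v p x) 2 μ) atTop
        (𝓝 (∑ p ∈ S, ‖c p‖ₑ * 0)) :=
      tendsto_finsetSum _ fun p _ => ENNReal.Tendsto.const_mul (h p) (Or.inr (by simp))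
    simpa using this
  refine tendsto_of_tendsto_of_tendsto_of_le_of_le tendsto_const_nhds hlim (fun _ => zero_le)
    fun m => ?_
  have e : (fun x => ∑ p ∈ S, c p • u p m x - ∑ p ∈ S, c p • v p x)
      = ∑ p ∈ S, c p • fun x => u p m x - v p x := by
    funext x
    simp [Finset.sum_apply, smul_sub]
  rw [e]
  refine (eLpNorm_sum_le (fun p _ => (hm p m).const_smul _) one_le_two).trans
    (Finset.sum_le_sum fun p _ => ?_)
  rw [eLpNorm_const_smul]

lemma tendsto_eLpNorm_of_sub {α E : Type*} [MeasurableSpace α] {μ : Measure α}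
    [NormedAddCommGroup E] {g : ℕ → α → E} {G : α → E} (hg : ∀ m, MemLp (g m) 2 μ)
    (hG : MemLp G 2 μ) (h : Tendsto (fun m => eLpNorm (fun x => g m x - G x) 2 μ) atTop (𝓝 0)) :
    Tendsto (fun m => (eLpNorm (g m) 2 μ).toReal) atTop (𝓝 (eLpNorm G 2 μ).toReal) := by
  have h1 := ((Lp.tendsto_Lp_iff_tendsto_eLpNorm'' g hg G hG).2 h).norm
  simpa only [Lp.norm_toLp] using h1

lemma tendsto_integral_mul_exp {Ω : Type*} [MeasurableSpace Ω] {P : Measure Ω}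
    [IsProbabilityMeasure P] {U : Ω → ℂ} (hU : AEStronglyMeasurable U P) (hU1 : ∀ ω, ‖U ω‖ ≤ 1)
    {X : ℕ → Ω → ℝ} {Y : Ω → ℝ} (hX : ∀ m, MemLp (X m) 2 P) (hY : MemLp Y 2 P)
    (h : Tendsto (fun m => eLpNorm (fun ω => X m ω - Y ω) 2 P) atTop (𝓝 0)) (l : ℝ) :
    Tendsto (fun m => ∫ ω, U ω * Complex.exp (Complex.I * ((l * X m ω : ℝ) : ℂ)) ∂P) atTop
      (𝓝 (∫ ω, U ω * Complex.exp (Complex.I * ((l * Y ω : ℝ) : ℂ)) ∂P)) := by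
  have hexp : Continuous fun x : ℝ => Complex.exp (Complex.I * ((l * x : ℝ) : ℂ)) := by fun_prop
  have hint : ∀ V : Ω → ℝ, AEStronglyMeasurable V P →
      Integrable (fun ω => U ω * Complex.exp (Complex.I * ((l * V ω : ℝ) : ℂ))) P := fun V hV => by
    refine Integrable.of_bound (hU.mul (hexp.comp_aestronglyMeasurable hV)) 1 (ae_of_all _ fun ω => ?_)
    rw [norm_mul, mul_comm Complex.I, Complex.norm_exp_ofReal_mul_I, mul_one]
    exact hU1 ω
  rw [tendsto_iff_edist_tendsto_0]
  have hlim : Tendsto (fun m => ‖l‖ₑ * eLpNorm (fun ω => X m ω - Y ω) 2 P) atTop (𝓝 0) := by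
    have := ENNReal.Tendsto.const_mul (a := ‖l‖ₑ) h (Or.inr (by simp))
    simpa using this
  refine tendsto_of_tendsto_of_tendsto_of_le_of_le tendsto_const_nhds hlim (fun _ => zero_le)
    fun m => ?_
  simp only
  rw [edist_eq_enorm_sub, ← integral_sub (hint _ (hX m).1) (hint _ hY.1)]
  refine (enorm_integral_le_lintegral_enorm _).trans ?_
  calc _ ≤ ∫⁻ ω, ‖l‖ₑ * ‖X m ω - Y ω‖ₑ ∂P := by
        refine lintegral_mono fun ω => ?_
        have e : U ω * Complex.exp (Complex.I * ((l * X m ω : ℝ) : ℂ))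
            - U ω * Complex.exp (Complex.I * ((l * Y ω : ℝ) : ℂ))
            = U ω * Complex.exp (((l * Y ω : ℝ) : ℂ) * Complex.I)
              * (Complex.exp (Complex.I * ((l * (X m ω - Y ω) : ℝ) : ℂ)) - 1) := by
          rw [mul_sub, mul_one, mul_assoc, ← Complex.exp_add, mul_comm Complex.I, mul_comm Complex.I,
            mul_comm Complex.I, ← add_mul, ← Complex.ofReal_add]
          congr 5
          ring_nf
        rw [e, enorm_mul, enorm_mul, ← enorm_mul l]
        have h1 : ‖U ω‖ₑ ≤ 1 := by
          rw [← ofReal_norm, ← ENNReal.ofReal_one]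
          exact ENNReal.ofReal_le_ofReal (hU1 ω)
        have h2 : ‖Complex.exp (((l * Y ω : ℝ) : ℂ) * Complex.I)‖ₑ = 1 := by
          rw [← ofReal_norm, Complex.norm_exp_ofReal_mul_I, ENNReal.ofReal_one]
        rw [h2, mul_one]
        exact (mul_le_mul' h1 Real.enorm_exp_I_mul_ofReal_sub_one_le).trans (one_mul _).le
    _ = ‖l‖ₑ * eLpNorm (fun ω => X m ω - Y ω) 1 P := by
        have h1 : AEStronglyMeasurable (fun ω => X m ω - Y ω) P := (hX m).1.sub hY.1
        rw [lintegral_const_mul'' _ h1.enorm, eLpNorm_one_eq_lintegral_enorm]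
    _ ≤ _ := by
        gcongr
        exact eLpNorm_le_eLpNorm_of_exponent_le one_le_two ((hX m).1.sub hY.1)

/-- The integrand `∑ c_p 1_{[0, t_p]}(s) P_{t_p - s} φ_p`. -/
def mildIntegrand (S : Finset (ℝ≥0 × TestFn)) (c : ℝ≥0 × TestFn → ℝ) (s : ℝ) : L2 :=
  ∑ p ∈ S, c p • (Set.Icc (0 : ℝ) p.1).indicator
    (fun s => (p.2.heat (p.1 - s.toNNReal)).toL2) s

/-- The characteristic function of the finite-dimensional marginals of a solution. -/
theorem IsSHESolution.integral_exp {Ω : Type*} [MeasurableSpace Ω] {P : Measure Ω}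
    [IsProbabilityMeasure P] {W : ℝ≥0 → L2 → Ω → ℝ} {z₀ : Ω → Distr} {Z : Ω → Path}
    (hsol : IsSHESolution P W z₀ Z) (S : Finset (ℝ≥0 × TestFn)) (c : ℝ≥0 × TestFn → ℝ) :
    ∫ ω, Complex.exp (Complex.I * ((∑ p ∈ S, c p * Z ω p.1 p.2 : ℝ) : ℂ)) ∂P
      = (∫ z, Complex.exp (Complex.I * ((z (∑ p ∈ S, c p • p.2.heat p.1) : ℝ) : ℂ)) ∂(P.map z₀))
        * Complex.exp (-((eLpNorm (mildIntegrand S c) 2 volume).toReal ^ 2 : ℝ)) := by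
  choose I hI hZ using fun p : ℝ≥0 × TestFn => hsol.mild p.1 p.2
  choose hf hIm n τ h hτ hstep hlim using hI
  set ψ := ∑ p ∈ S, c p • p.2.heat p.1 with hψ
  set X : ℕ → Ω → ℝ := fun m ω => ∑ p ∈ S, c p • stepIntegral W (n p m) (τ p m) (h p m) ω with hX
  set g : ℕ → ℝ → L2 := fun m s => ∑ p ∈ S, c p • stepFn (n p m) (τ p m) (h p m) s.toNNReal with hg
  set Y : Ω → ℝ := fun ω => ∑ p ∈ S, c p • I p ω with hY
  have hpair1 : ∀ p m, (stepIntegral W (n p m) (τ p m) (h p m),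
      fun s : ℝ => stepFn (n p m) (τ p m) (h p m) s.toNNReal) ∈ wienerPairs W := fun p m =>
    stepIntegral_mem_wienerPairs W _ (hτ p m).1 _
  have hpair : ∀ m, (X m, g m) ∈ wienerPairs W := by
    intro m
    have e : (X m, g m) = ∑ p ∈ S, c p • (stepIntegral W (n p m) (τ p m) (h p m),
        fun s : ℝ => stepFn (n p m) (τ p m) (h p m) s.toNNReal) := by
      refine Prod.ext ?_ ?_
      · rw [Prod.fst_sum]
        funext ω
        simp [hX, Finset.sum_apply]
      · rw [Prod.snd_sum]
        funext s
        simp [hg, Finset.sum_apply]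
    rw [e]
    exact Submodule.sum_mem _ fun p _ => Submodule.smul_mem _ _ (hpair1 p m)
  have hXmem : ∀ m, MemLp (X m) 2 P := fun m => memLp_fst_wienerPairs hsol.wiener (hpair m)
  have hgmem : ∀ m, MemLp (g m) 2 volume := fun m => memLp_snd_wienerPairs (hpair m)
  have hYmem : MemLp Y 2 P := memLp_finsetSum _ fun p _ => (hIm p).const_smul (c p)
  have hfmem : ∀ p : ℝ≥0 × TestFn, MemLp ((Set.Icc (0 : ℝ) p.1).indicator
      (fun s => (p.2.heat (p.1 - s.toNNReal)).toL2)) 2 volume := fun p =>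
    (memLp_indicator_iff_restrict measurableSet_Icc).2 (hf p)
  have hGmem : MemLp (mildIntegrand S c) 2 volume :=
    memLp_finsetSum _ fun p _ => (hfmem p).const_smul (c p)
  have hXY : Tendsto (fun m => eLpNorm (fun ω => X m ω - Y ω) 2 P) atTop (𝓝 0) :=
    tendsto_eLpNorm_sum_sub S c (fun p m =>
      (memLp_fst_wienerPairs hsol.wiener (hpair1 p m)).1.sub (hIm p).1) hlim
  have hgG : Tendsto (fun m => eLpNorm (fun s => g m s - mildIntegrand S c s) 2 volume) atTop
      (𝓝 0) := by
    refine tendsto_eLpNorm_sum_sub S c (fun p m =>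
      (memLp_snd_wienerPairs (hpair1 p m)).1.sub (hfmem p).1) fun p => ?_
    simp_rw [fun m => eLpNorm_stepFn_sub (n := n p m) (hτ p m).2 (h p m)
      fun s => (p.2.heat (p.1 - s.toNNReal)).toL2]
    exact hstep p
  have hev : Measurable fun z : Distr => Complex.exp (Complex.I * ((z ψ : ℝ) : ℂ)) := by
    have hc : Continuous fun x : ℝ => Complex.exp (Complex.I * (x : ℂ)) := by fun_prop
    exact hc.measurable.comp (measurable_distr_apply ψ)
  set U : Ω → ℂ := fun ω => Complex.exp (Complex.I * ((z₀ ω ψ : ℝ) : ℂ)) with hUdef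
  have hUm : Measurable U := hev.comp hsol.measurable_init
  have hU1 : ∀ ω, ‖U ω‖ ≤ 1 := fun ω => by
    simp only [hUdef]
    rw [mul_comm, Complex.norm_exp_ofReal_mul_I]
  have hWm : Measurable fun ω (p : ℝ≥0 × L2) => W p.1 p.2 ω :=
    measurable_pi_lambda _ fun p => hsol.wiener.measurable p.1 p.2
  have hfact : ∀ m, ∫ ω, U ω * Complex.exp (Complex.I * ((Real.sqrt 2 * X m ω : ℝ) : ℂ)) ∂P
      = (∫ ω, U ω ∂P) * Complex.exp (-((eLpNorm (g m) 2 volume).toReal ^ 2 : ℝ)) := by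
    intro m
    obtain ⟨F, hF, hFX⟩ := exists_measurable_of_mem_wienerPairs (hpair m)
    have hFm : Measurable fun w => Complex.exp (Complex.I * ((Real.sqrt 2 * F w : ℝ) : ℂ)) := by
      have hc : Continuous fun x : ℝ => Complex.exp (Complex.I * ((Real.sqrt 2 * x : ℝ) : ℂ)) := by
        fun_prop
      exact hc.measurable.comp hF
    have h1 := hsol.indep.integral_fun_comp_mul_comp (𝕜 := ℂ) hsol.measurable_init.aemeasurable
      hWm.aemeasurable hev.aestronglyMeasurable hFm.aestronglyMeasurable
    simp only at hFX
    simp only [← hFX] at h1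
    rw [h1]
    have h2 := integral_exp_wienerPairs hsol.wiener (hpair m) (Real.sqrt 2)
    simp only at h2
    rw [h2, Real.sq_sqrt (by norm_num)]
    congr 4
    ring
  have hL := tendsto_integral_mul_exp hUm.aestronglyMeasurable hU1 hXmem hYmem hXY (Real.sqrt 2)
  simp_rw [hfact] at hL
  have hR : Tendsto (fun m => (∫ ω, U ω ∂P)
      * Complex.exp (-((eLpNorm (g m) 2 volume).toReal ^ 2 : ℝ))) atTop
      (𝓝 ((∫ ω, U ω ∂P) * Complex.exp (-((eLpNorm (mildIntegrand S c) 2 volume).toReal ^ 2 : ℝ)))) := by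
    have hc : Continuous fun x : ℝ => (∫ ω, U ω ∂P) * Complex.exp (-((x ^ 2 : ℝ) : ℂ)) := by fun_prop
    exact (hc.tendsto _).comp (tendsto_eLpNorm_of_sub hgmem hGmem hgG)
  rw [integral_map hsol.measurable_init.aemeasurable hev.aestronglyMeasurable,
    ← tendsto_nhds_unique hL hR]
  refine integral_congr_ae ?_
  filter_upwards [(Finset.eventually_all S).2 fun p _ => hZ p] with ω hω
  rw [hUdef, ← Complex.exp_add, ← mul_add, ← Complex.ofReal_add]
  congr 3
  rw [hψ, map_sum, hY, Finset.mul_sum, ← Finset.sum_add_distrib]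
  refine Finset.sum_congr rfl fun p hp => ?_
  rw [hω p hp, map_smul, smul_eq_mul, smul_eq_mul]
  ring

/-! ### Laws on the path space -/

lemma measurable_path_iff {Ω : Type*} [MeasurableSpace Ω] {Z : Ω → Path} :
    Measurable Z ↔ ∀ t, Measurable fun ω => Z ω t := by
  refine ⟨fun h t => (measurable_path_apply t).comp h, fun h => ?_⟩
  rw [measurable_iff_comap_le]
  change MeasurableSpace.comap _ (⨆ t : ℝ≥0, _) ≤ _
  rw [MeasurableSpace.comap_iSup]
  refine iSup_le fun t => ?_
  rw [MeasurableSpace.comap_comp]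
  exact (h t).comap_le

/-- The coordinates of a path. -/
def pathCoord (z : Path) (p : ℝ≥0 × TestFn) : ℝ := z p.1 p.2

lemma comap_pathCoord : MeasurableSpace.comap pathCoord MeasurableSpace.pi
    = (inferInstance : MeasurableSpace Path) := by
  refine le_antisymm ?_ ?_
  · refine Measurable.comap_le (measurable_pi_lambda _ fun p => ?_)
    exact (measurable_distr_apply p.2).comp (measurable_path_apply p.1)
  · refine iSup_le fun t => ?_
    change MeasurableSpace.comap _ (⨆ φ : TestFn, _) ≤ _
    rw [MeasurableSpace.comap_iSup]
    refine iSup_le fun φ => ?_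
    rw [MeasurableSpace.comap_comp]
    rintro _ ⟨A, hA, rfl⟩
    exact ⟨(fun x : ℝ≥0 × TestFn → ℝ => x (t, φ)) ⁻¹' A, measurable_pi_apply _ hA, rfl⟩

lemma measurable_pathCoord : Measurable pathCoord :=
  Measurable.of_comap_le comap_pathCoord.le

/-- A law on the path space is determined by its characteristic functions. -/
theorem ext_of_exp_path {μ ν : Measure Path} [IsProbabilityMeasure μ] [IsProbabilityMeasure ν]
    (h : ∀ (S : Finset (ℝ≥0 × TestFn)) (c : ℝ≥0 × TestFn → ℝ),
      ∫ z, Complex.exp (Complex.I * ((∑ p ∈ S, c p * z p.1 p.2 : ℝ) : ℂ)) ∂μ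
        = ∫ z, Complex.exp (Complex.I * ((∑ p ∈ S, c p * z p.1 p.2 : ℝ) : ℂ)) ∂ν) : μ = ν := by
  have hmar : ∀ I : Finset (ℝ≥0 × TestFn), (ν.map pathCoord).map I.restrict
      = (μ.map pathCoord).map I.restrict := by
    intro I
    have hm : Measurable (I.restrict ∘ pathCoord) :=
      (Finset.measurable_restrict I).comp measurable_pathCoord
    rw [Measure.map_map (Finset.measurable_restrict I) measurable_pathCoord,
      Measure.map_map (Finset.measurable_restrict I) measurable_pathCoord]
    have := Measure.isFiniteMeasure_map μ (I.restrict ∘ pathCoord)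
    have := Measure.isFiniteMeasure_map ν (I.restrict ∘ pathCoord)
    refine Measure.ext_of_charFunDual ?_
    ext L
    obtain ⟨c, hc⟩ := exists_coeff I L
    have e : ∀ z : Path, Complex.exp ((L ((I.restrict ∘ pathCoord) z) : ℂ) * Complex.I)
        = Complex.exp (Complex.I * ((∑ p ∈ I, c p * z p.1 p.2 : ℝ) : ℂ)) := fun z => by
      rw [Function.comp_apply, hc, mul_comm]
      rfl
    rw [charFunDual_apply, charFunDual_apply, integral_map hm.aemeasurable (by fun_prop),
      integral_map hm.aemeasurable (by fun_prop)]
    simp_rw [e]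
    exact (h I c).symm
  have hcoord : μ.map pathCoord = ν.map pathCoord := by
    have hfin : ∀ I : Finset (ℝ≥0 × TestFn), IsFiniteMeasure ((μ.map pathCoord).map I.restrict) :=
      fun I => by
        have := Measure.isFiniteMeasure_map μ pathCoord
        exact Measure.isFiniteMeasure_map _ _
    exact IsProjectiveLimit.unique (P := fun I => (μ.map pathCoord).map I.restrict)
      (fun I => rfl) hmar
  ext A hA
  obtain ⟨B, hB, rfl⟩ : MeasurableSet[MeasurableSpace.comap pathCoord MeasurableSpace.pi] A := by
    rw [comap_pathCoord]
    exact hA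
  rw [← Measure.map_apply measurable_pathCoord hB, hcoord, Measure.map_apply measurable_pathCoord hB]

theorem IsSHESolution.law_unique {Ω : Type u} [MeasurableSpace Ω] {P : Measure Ω}
    [IsProbabilityMeasure P] {W : ℝ≥0 → L2 → Ω → ℝ} {z₀ : Ω → Distr} {Z : Ω → Path}
    (hsol : IsSHESolution P W z₀ Z) {Ω' : Type v} [MeasurableSpace Ω'] {P' : Measure Ω'}
    [IsProbabilityMeasure P'] {W' : ℝ≥0 → L2 → Ω' → ℝ} {z₀' : Ω' → Distr} {Z' : Ω' → Path}
    (hsol' : IsSHESolution P' W' z₀' Z') (hinit : P'.map z₀' = P.map z₀) :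
    P.map Z = P'.map Z' := by
  have := Measure.isProbabilityMeasure_map (μ := P) hsol.measurable.aemeasurable
  have := Measure.isProbabilityMeasure_map (μ := P') hsol'.measurable.aemeasurable
  refine ext_of_exp_path fun S c => ?_
  have hm : Measurable fun z : Path =>
      Complex.exp (Complex.I * ((∑ p ∈ S, c p * z p.1 p.2 : ℝ) : ℂ)) := by
    have hc : Continuous fun x : ℝ => Complex.exp (Complex.I * (x : ℂ)) := by fun_prop
    refine hc.measurable.comp (Finset.measurable_sum _ fun p _ => Measurable.const_mul ?_ _)
    exact (measurable_distr_apply p.2).comp (measurable_path_apply p.1)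
  rw [integral_map hsol.measurable.aemeasurable hm.aestronglyMeasurable,
    integral_map hsol'.measurable.aemeasurable hm.aestronglyMeasurable, hsol.integral_exp,
    hsol'.integral_exp, hinit]

/-! ### The process solves the stochastic heat equation -/

lemma isFiniteMeasure_torusVol : IsFiniteMeasure torusVol :=
  ⟨by simpa using isCompact_cube.measure_lt_top⟩

lemma norm_toL2_le (φ : TestFn) {C : ℝ} (hC : 0 ≤ C) (h : ∀ x, |φ x| ≤ C) :
    ‖φ.toL2‖ ≤ (torusVol Set.univ).toReal ^ (1 / 2 : ℝ) * C := by
  have := isFiniteMeasure_torusVol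
  have h1 : eLpNorm φ 2 torusVol ≤ torusVol Set.univ ^ (2 : ℝ≥0∞).toReal⁻¹ * ENNReal.ofReal C :=
    eLpNorm_le_of_ae_bound (ae_of_all _ h)
  have h2 : ‖φ.toL2‖ = (eLpNorm φ 2 torusVol).toReal := Lp.norm_toLp _ _
  rw [h2]
  have hfin : torusVol Set.univ ^ (2 : ℝ≥0∞).toReal⁻¹ ≠ ∞ :=
    ENNReal.rpow_ne_top_of_nonneg (by norm_num) (measure_ne_top _ _)
  refine (ENNReal.toReal_mono (ENNReal.mul_ne_top hfin ENNReal.ofReal_ne_top) h1).trans (le_of_eq ?_)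
  rw [ENNReal.toReal_mul, ENNReal.toReal_ofReal hC, ← ENNReal.toReal_rpow]
  norm_num

lemma exists_norm_heat_sub_le (φ : TestFn) : ∃ C, 0 ≤ C ∧ ∀ a b : ℝ≥0,
    ‖(heat a φ).toL2 - (heat b φ).toL2‖ ≤ C * |Real.sqrt (2 * a) - Real.sqrt (2 * b)| := by
  obtain ⟨C, hC⟩ := exists_abs_heat_sub_le φ
  refine ⟨(torusVol Set.univ).toReal ^ (1 / 2 : ℝ) * |C|, by positivity, fun a b => ?_⟩
  have h1 : (heat a φ).toL2 - (heat b φ).toL2 = (heat a φ - heat b φ).toL2 := by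
    simp only [toL2_eq, map_sub]
  rw [h1, mul_assoc]
  refine norm_toL2_le _ (by positivity) fun x => ((hC (a, b) x).trans ?_)
  gcongr
  exact le_abs_self C

lemma continuous_heat_toL2 (φ : TestFn) : Continuous fun r : ℝ≥0 => (heat r φ).toL2 := by
  obtain ⟨C, -, hC⟩ := exists_norm_heat_sub_le φ
  refine continuous_iff_continuousAt.2 fun r => ?_
  refine tendsto_iff_norm_sub_tendsto_zero.2 ?_
  have h : Tendsto (fun q : ℝ≥0 => C * |Real.sqrt (2 * q) - Real.sqrt (2 * r)|) (𝓝 r) (𝓝 0) := by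
    have : Continuous fun q : ℝ≥0 => C * |Real.sqrt (2 * q) - Real.sqrt (2 * r)| := by fun_prop
    simpa using this.tendsto r
  exact squeeze_zero (fun _ => norm_nonneg _) (fun q => hC q r) h

lemma sqrt_sub_sqrt_le {a b : ℝ} (ha : 0 ≤ a) (hab : a ≤ b) :
    Real.sqrt b - Real.sqrt a ≤ Real.sqrt (b - a) := by
  have h1 := Real.sqrt_nonneg a
  have h2 := Real.sqrt_nonneg (b - a)
  rw [sub_le_iff_le_add, Real.sqrt_le_left (by positivity)]
  nlinarith [Real.sq_sqrt ha, Real.sq_sqrt (sub_nonneg.2 hab)]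

lemma memLp_heat (t : ℝ≥0) (φ : TestFn) :
    MemLp (fun s : ℝ => (heat (t - s.toNNReal) φ).toL2) 2 (volume.restrict (Set.Icc 0 (t : ℝ))) := by
  have hc : Continuous fun s : ℝ => (heat (t - s.toNNReal) φ).toL2 :=
    (continuous_heat_toL2 φ).comp (continuous_const.sub continuous_real_toNNReal)
  obtain ⟨C, hC⟩ := (isCompact_Icc (a := (0 : ℝ≥0)) (b := t)).exists_bound_of_continuousOn
    (continuous_heat_toL2 φ).continuousOn
  exact MemLp.of_bound hc.aestronglyMeasurable C
    (ae_of_all _ fun s => hC _ ⟨zero_le, tsub_le_self⟩)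

/-- The step integrand approximating `s ↦ P_{t - s} φ`. -/
def gridIntegrand (t : ℝ≥0) (φ : TestFn) (m i : ℕ) : L2 := (heat (t - grid t m i) φ).toL2

lemma tendsto_stepFn_grid (t : ℝ≥0) (φ : TestFn) :
    Tendsto (fun m => eLpNorm (fun s : ℝ => stepFn (m + 1) (grid t m) (gridIntegrand t φ m) s.toNNReal
      - (heat (t - s.toNNReal) φ).toL2) 2 (volume.restrict (Set.Icc 0 (t : ℝ)))) atTop (𝓝 0) := by
  obtain ⟨C, hC0, hC⟩ := exists_norm_heat_sub_le φ
  set μ : Measure ℝ := volume.restrict (Set.Icc 0 (t : ℝ)) with hμ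
  have hbound : ∀ m : ℕ, eLpNorm (fun s : ℝ => stepFn (m + 1) (grid t m) (gridIntegrand t φ m) s.toNNReal
      - (heat (t - s.toNNReal) φ).toL2) 2 μ
      ≤ μ Set.univ ^ (2 : ℝ≥0∞).toReal⁻¹
        * ENNReal.ofReal (C * Real.sqrt (2 * (t * (1 / ((m : ℝ) + 1))))) := by
    intro m
    refine eLpNorm_le_of_ae_bound ?_
    have h0 : ∀ᵐ s ∂μ, s ≠ 0 := ae_restrict_of_ae (Measure.ae_ne volume 0)
    filter_upwards [ae_restrict_mem measurableSet_Icc, h0] with s hs hs0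
    have hpos : 0 < s := lt_of_le_of_ne hs.1 hs0.symm
    have hst : s.toNNReal ≤ t := Real.toNNReal_le_iff_le_coe.2 hs.2
    obtain ⟨i, hi, his⟩ := exists_mem_Ioc_of_monotone (grid t m) (n := m + 1) (s := s.toNNReal)
      (by rw [grid_zero]; exact Real.toNNReal_pos.2 hpos) (by rwa [grid_last])
    rw [stepFn, sum_indicator_Ioc_eq (monotone_grid t m) hi his, gridIntegrand]
    refine (hC _ _).trans (mul_le_mul_of_nonneg_left ?_ hC0)
    have h1 : (grid t m i : ℝ) ≤ (s.toNNReal : ℝ) := by exact_mod_cast his.1.le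
    have h2 : (s.toNNReal : ℝ) ≤ grid t m (i + 1) := by exact_mod_cast his.2
    have h3 := grid_succ_le t m i
    have h4 : ((s.toNNReal : ℝ≥0) : ℝ) ≤ t := by exact_mod_cast hst
    rw [NNReal.coe_sub (grid_le t m i), NNReal.coe_sub hst]
    have hle : Real.sqrt (2 * (t - s.toNNReal)) ≤ Real.sqrt (2 * (t - grid t m i)) :=
      Real.sqrt_le_sqrt (by linarith)
    rw [abs_of_nonneg (sub_nonneg.2 hle)]
    refine (sqrt_sub_sqrt_le (by linarith) (by linarith)).trans (Real.sqrt_le_sqrt ?_)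
    linarith
  have hlim : Tendsto (fun m : ℕ => μ Set.univ ^ (2 : ℝ≥0∞).toReal⁻¹
      * ENNReal.ofReal (C * Real.sqrt (2 * (t * (1 / ((m : ℝ) + 1)))))) atTop (𝓝 0) := by
    have hfin : μ Set.univ ^ (2 : ℝ≥0∞).toReal⁻¹ ≠ ∞ :=
      ENNReal.rpow_ne_top_of_nonneg (by norm_num) (measure_ne_top _ _)
    have hc : Continuous fun x : ℝ => ENNReal.ofReal (C * Real.sqrt (2 * (t * x))) :=
      ENNReal.continuous_ofReal.comp (by fun_prop)
    have h1 := (hc.tendsto 0).comp tendsto_one_div_add_atTop_nhds_zero_nat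
    have h2 := ENNReal.Tendsto.const_mul (a := μ Set.univ ^ (2 : ℝ≥0∞).toReal⁻¹) h1 (Or.inr hfin)
    simpa using h2
  exact tendsto_of_tendsto_of_tendsto_of_le_of_le tendsto_const_nhds hlim (fun _ => zero_le) hbound

lemma eLpNorm_sub_le_liminf {Ω E : Type*} [MeasurableSpace Ω] {P : Measure Ω} [NormedAddCommGroup E]
    {f : ℕ → Ω → E} (hf : ∀ n, AEStronglyMeasurable (f n) P) {g h : Ω → E}
    (hh : AEStronglyMeasurable h P)
    (hlim : ∀ᵐ ω ∂P, Tendsto (fun n => f n ω) atTop (𝓝 (g ω))) :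
    eLpNorm (fun ω => h ω - g ω) 2 P ≤ liminf (fun n => eLpNorm (fun ω => h ω - f n ω) 2 P) atTop :=
  Lp.eLpNorm_lim_le_liminf_eLpNorm (fun n => hh.sub (hf n)) _
    (hlim.mono fun _ hω => hω.const_sub _)

section

variable {Ω : Type*} [mΩ : MeasurableSpace Ω] {P : Measure Ω} [IsProbabilityMeasure P]

lemma eLpNorm_sub_of_mem_wienerPairs {W : ℝ≥0 → L2 → Ω → ℝ} (hW : IsCylindricalWiener W P)
    {X Y : Ω → ℝ} {g h : ℝ → L2} (hX : (X, g) ∈ wienerPairs W) (hY : (Y, h) ∈ wienerPairs W) :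
    eLpNorm (fun ω => X ω - Y ω) 2 P = eLpNorm (fun s => g s - h s) 2 volume := by
  have hp := eLpNorm_wienerPairs hW (sub_mem hX hY)
  rw [Prod.fst_sub, Prod.snd_sub] at hp
  exact hp

/-- Almost sure limits of integrals of convergent step integrands are Wiener integrals. -/
lemma isWienerIntegral_of_ae_tendsto {W : ℝ≥0 → L2 → Ω → ℝ} (hW : IsCylindricalWiener W P) {t : ℝ≥0}
    {f : ℝ≥0 → L2} {I : Ω → ℝ}
    (hf : MemLp (fun s : ℝ => f s.toNNReal) 2 (volume.restrict (Set.Icc 0 (t : ℝ))))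
    (hI : AEStronglyMeasurable I P) {n : ℕ → ℕ} {τ : ℕ → ℕ → ℝ≥0} {h : ℕ → ℕ → L2}
    (hτ : ∀ m, Monotone (τ m) ∧ ∀ i, τ m i ≤ t)
    (hstep : Tendsto (fun m => eLpNorm (fun s : ℝ => stepFn (n m) (τ m) (h m) s.toNNReal
      - f s.toNNReal) 2 (volume.restrict (Set.Icc 0 (t : ℝ)))) atTop (𝓝 0))
    (hlim : ∀ᵐ ω ∂P, Tendsto (fun m => stepIntegral W (n m) (τ m) (h m) ω) atTop (𝓝 (I ω))) :
    IsWienerIntegral W P t f I := by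
  set X : ℕ → Ω → ℝ := fun m => stepIntegral W (n m) (τ m) (h m) with hX
  set g : ℕ → ℝ → L2 := fun m s => stepFn (n m) (τ m) (h m) s.toNNReal with hg
  set G : ℝ → L2 := (Set.Icc (0 : ℝ) t).indicator fun s => f s.toNNReal with hG
  have hpair : ∀ m, (X m, g m) ∈ wienerPairs W := fun m =>
    stepIntegral_mem_wienerPairs W _ (hτ m).1 _
  have hXm : ∀ m, MemLp (X m) 2 P := fun m => memLp_fst_wienerPairs hW (hpair m)
  have hgm : ∀ m, MemLp (g m) 2 volume := fun m => memLp_snd_wienerPairs (hpair m)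
  have hGm : MemLp G 2 volume := (memLp_indicator_iff_restrict measurableSet_Icc).2 hf
  have hgG : Tendsto (fun m => eLpNorm (fun s => g m s - G s) 2 volume) atTop (𝓝 0) := by
    simp_rw [hg, hG, fun m => eLpNorm_stepFn_sub (n := n m) (hτ m).2 (h m) fun s => f s.toNNReal]
    exact hstep
  have hdiff : ∀ m k, eLpNorm (fun ω => X m ω - X k ω) 2 P
      ≤ eLpNorm (fun s => g m s - G s) 2 volume + eLpNorm (fun s => g k s - G s) 2 volume := by
    intro m k
    have h1 := eLpNorm_sub_of_mem_wienerPairs hW (hpair m) (hpair k)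
    have h2 : (fun s => g m s - g k s) = (fun s => g m s - G s) - fun s => g k s - G s := by
      funext s
      simp
    rw [h1, h2]
    exact eLpNorm_sub_le ((hgm m).1.sub hGm.1) ((hgm k).1.sub hGm.1) one_le_two
  have hle : ∀ m, eLpNorm (fun ω => X m ω - I ω) 2 P ≤ eLpNorm (fun s => g m s - G s) 2 volume := by
    intro m
    refine (eLpNorm_sub_le_liminf (fun k => (hXm k).1) (hXm m).1 hlim).trans ?_
    refine (liminf_le_liminf (Eventually.of_forall (hdiff m))).trans (le_of_eq ?_)
    have h3 := hgG.const_add (eLpNorm (fun s => g m s - G s) 2 volume)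
    rw [add_zero] at h3
    exact h3.liminf_eq
  have hXI : Tendsto (fun m => eLpNorm (fun ω => X m ω - I ω) 2 P) atTop (𝓝 0) :=
    tendsto_of_tendsto_of_tendsto_of_le_of_le tendsto_const_nhds hgG (fun _ => zero_le) hle
  have hIm : MemLp I 2 P := by
    have h1 : MemLp (fun ω => X 0 ω - I ω) 2 P :=
      ⟨(hXm 0).1.sub hI, (hle 0).trans_lt ((hgm 0).sub hGm).2⟩
    have h2 : I = X 0 - fun ω => X 0 ω - I ω := by
      funext ω
      simp
    rw [h2]
    exact (hXm 0).sub h1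
  exact ⟨hf, hIm, n, τ, h, hτ, hstep, hXI⟩

variable {𝓕 : Filtration ℝ≥0 mΩ} {Z : Ω → Path}

theorem isSHESolution_cylW (hZ : ∀ t : ℝ≥0, Measurable[𝓕 t] fun ω => Z ω t)
    (hB : ∀ φ, IsScaledBrownian (martM Z φ) (2 * ‖φ.toL2‖ ^ 2) 𝓕 P) :
    IsSHESolution P (cylW Z) (fun ω => Z ω 0) Z where
  wiener := isCylindricalWiener_cylW hB
  measurable_init := (hZ 0).mono (𝓕.le 0) le_rfl
  indep := indepFun_cylW hB (hZ 0)
  measurable := measurable_path_iff.2 fun t => (hZ t).mono (𝓕.le t) le_rfl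
  mild t φ := by
    have hmZ : ∀ t φ, Measurable fun ω => Z ω t φ := fun t φ =>
      (measurable_distr_apply φ).comp ((hZ t).mono (𝓕.le t) le_rfl)
    refine ⟨fun ω => (Z ω t φ - Z ω 0 (heat t φ)) / Real.sqrt 2, ?_, ae_of_all _ fun ω => ?_⟩
    · refine isWienerIntegral_of_ae_tendsto (isCylindricalWiener_cylW hB)
        (f := fun s => (heat (t - s) φ).toL2) (memLp_heat t φ)
        (((hmZ t φ).sub (hmZ 0 (heat t φ))).div_const _).aestronglyMeasurable
        (n := fun m => m + 1) (τ := grid t) (h := gridIntegrand t φ)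
        (fun m => ⟨monotone_grid t m, grid_le t m⟩) (tendsto_stepFn_grid t φ) ?_
      have hall : ∀ᵐ ω ∂P, ∀ m i r, cylW Z r (gridIntegrand t φ m i) ω
          = martM Z (heat (t - grid t m i) φ) r ω / Real.sqrt 2 :=
        ae_all_iff.2 fun m => ae_all_iff.2 fun i => ae_cylW_toL2 hB _
      filter_upwards [hall] with ω hω
      have h1 := (tendsto_sum_martM Z ω φ t).div_const (Real.sqrt 2)
      refine h1.congr fun m => ?_
      rw [stepIntegral, Finset.sum_div]
      exact Finset.sum_congr rfl fun i _ => by rw [hω, hω, sub_div]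
    · rw [mul_div_cancel₀ _ (by positivity)]
      ring

end

end SHE

end

theorem theoremC1
    {Ω : Type u} [mΩ : MeasurableSpace Ω] (P : Measure Ω) [IsProbabilityMeasure P]
    (𝓕 : Filtration ℝ≥0 mΩ) (Zbar : Ω → SHE.Path)
    (hadapted : ∀ t : ℝ≥0, Measurable[𝓕 t] (fun ω => Zbar ω t))
    (hM : ∀ φ : SHE.TestFn, SHE.IsLocalMartingale (SHE.martM Zbar φ) 𝓕 P)
    (hΓ : ∀ φ : SHE.TestFn, SHE.IsLocalMartingale (SHE.martG Zbar φ) 𝓕 P) :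
    (∃ (Ω' : Type u) (_ : MeasurableSpace Ω') (P' : Measure Ω') (_ : IsProbabilityMeasure P')
      (W : ℝ≥0 → SHE.L2 → Ω' → ℝ) (z₀ : Ω' → SHE.Distr) (Z : Ω' → SHE.Path),
      SHE.IsSHESolution P' W z₀ Z ∧ P'.map z₀ = P.map (fun ω => Zbar ω 0)) ∧
    ∀ (Ω' : Type v) (_ : MeasurableSpace Ω') (P' : Measure Ω') (_ : IsProbabilityMeasure P')
      (W : ℝ≥0 → SHE.L2 → Ω' → ℝ) (z₀ : Ω' → SHE.Distr) (Z : Ω' → SHE.Path),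
      SHE.IsSHESolution P' W z₀ Z → P'.map z₀ = P.map (fun ω => Zbar ω 0) →
        P.map Zbar = P'.map Z := by
  have hB := SHE.isScaledBrownian_martM hadapted hM hΓ
  have hsol := SHE.isSHESolution_cylW hadapted hB
  refine ⟨⟨Ω, mΩ, P, inferInstance, _, _, _, hsol, rfl⟩, ?_⟩
  intro Ω' _ P' _ W z₀ Z hsol' hinit
  exact hsol.law_unique hsol' hinit
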